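/- Let $k\ge 3$ and $\ell\ge\max\{k-1,3\}$ be integers and let $K\subset\mathbb R^3$ be a (non-degenerate) tetrahedron with vertices $\mathcal V(K)$, edges $\mathcal E(K)$ and faces $\mathcal F(K)$. For each face $F$ fix a unit normal vector $\boldsymbol n=\boldsymbol n_F$, and for each edge $e$ fix two linearly independent unit vectors $\boldsymbol n_1,\boldsymbol n_2$ normal to $e$. Let $\mathbb P_m(G)$ be the space of restrictions to $G$ of polynomials of total degree at most $m$, $\mathbb T$ the space of trace-free $3\times3$ real matrices, and $\mathbb P_m(K;\mathbb T)$ the $\mathbb T$-valued polynomials of degree at most $m$. Let $\operatorname{sym}\boldsymbol A=\frac12(\boldsymbol A+\boldsymbol A^{\intercal})$, let $\operatorname{curl}$ act row-wise on matrix fields, let $\boldsymbol A\times\boldsymbol b$ denote the row-wise and $\boldsymbol b\times\boldsymbol A$ the column-wise cross product, and let $\boldsymbol n\cdot\boldsymbol A=\boldsymbol n^{\intercal}\boldsymbol A$. For a face with unit normal $\boldsymbol n$ let $\partial_n=\boldsymbol n\cdot\nabla$ and $\operatorname{div}_F\boldsymbol v=(\nabla-\boldsymbol n\,\partial_n)\cdot\boldsymbol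 v$. Denote by $(\cdot,\cdot)_G$ the $L^2$ inner product on $G=e,F,K$. Define the space of shape functions $$\boldsymbol\Sigma_{\ell,k}(K)=\operatorname{sym}\operatorname{curl}\mathbb P_{\ell+1}(K;\mathbb T)\oplus\boldsymbol x\boldsymbol x^{\intercal}\,\mathbb P_{k-2}(K)$$ and the bubble space $$\boldsymbol B_{\ell+1}(\operatorname{sym}\operatorname{curl},K;\mathbb T)=\{\boldsymbol\tau\in\mathbb P_{\ell+1}(K;\mathbb T):\ (\boldsymbol n\cdot\boldsymbol\tau\times\boldsymbol n)|_F=\boldsymbol 0,\ (\boldsymbol n\times\operatorname{sym}(\boldsymbol\tau\times\boldsymbol n)\times\boldsymbol n)|_F=\boldsymbol 0\ \ \forall F\in\mathcal F(K)\}.$$ Then the following degrees of freedom are unisolvent for $\boldsymbol\Sigma_{\ell,k}(K)$: \begin{align*} &\boldsymbol\tau(\delta) && \forall\,\delta\in\mathcal V(K),\\ &(\boldsymbol n_i^{\intercal}\boldsymbol\tau\boldsymbol n_j,q)_e && \forall\, q\in\mathbb P_{\ell-2}(e),\ e\in\mathcal E(K),\ i,j=1,2,\\ &(\boldsymbol n^{\intercal}\boldsymbol\tau\boldsymbol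 n,q)_F && \forall\, q\in\mathbb P_{\ell-3}(F),\ F\in\mathcal F(K),\\ &(2\operatorname{div}_F(\boldsymbol\tau\boldsymbol n)+\partial_n(\boldsymbol n^{\intercal}\boldsymbol\tau\boldsymbol n),q)_F && \forall\, q\in\mathbb P_{\ell-1}(F),\ F\in\mathcal F(K),\\ &(\boldsymbol\tau,\boldsymbol\varsigma)_K && \forall\,\boldsymbol\varsigma\in\nabla^2\mathbb P_{k-2}(K),\\ &(\boldsymbol\tau,\boldsymbol\varsigma)_K && \forall\,\boldsymbol\varsigma\in\operatorname{sym}\operatorname{curl}\boldsymbol B_{\ell+1}(\operatorname{sym}\operatorname{curl},K;\mathbb T). \end{align*} That is, for every choice of symmetric matrices as vertex values and of linear functionals on the respective test spaces as values of the moments (the edge functionals being symmetric in $i,j$), there is exactly one $\boldsymbol\tau\in\boldsymbol\Sigma_{\ell,k}(K)$ whose degrees of freedom take these values. -/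

import Mathlib

open MvPolynomial Matrix MeasureTheory

noncomputable section

namespace DivDiv

/-- Points and vectors of three-dimensional space (the Euclidean structure is only used through
the dot product). -/
abbrev Vec : Type := Fin 3 → ℝ

/-- Real polynomials in three variables. A tetrahedron has non-empty interior, so they are
identified with the polynomial functions on it. -/
abbrev Poly : Type := MvPolynomial (Fin 3) ℝ

/-- Real `3 × 3` matrices. -/
abbrev Mat : Type := Matrix (Fin 3) (Fin 3) ℝ

/-- Polynomial `3 × 3` tensor fields. -/
abbrev PolyMat : Type := Matrix (Fin 3) (Fin 3) Poly

/-- A tetrahedron, given by four affinely independent vertices. -/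
abbrev Tetrahedron : Type := Affine.Simplex ℝ Vec 3

/-! ### Matrix and vector operations -/

/-- The symmetric part `(A + Aᵀ) / 2`. -/
def sym {R : Type} [CommRing R] [Algebra ℝ R] (A : Matrix (Fin 3) (Fin 3) R) :
    Matrix (Fin 3) (Fin 3) R :=
  (1 / 2 : ℝ) • (A + Aᵀ)

/-- Row-wise cross product `A × b`. -/
def crossRight (A : Mat) (b : Vec) : Mat :=
  Matrix.of fun i => A i ⨯₃ b

/-- Column-wise cross product `b × A`. -/
def crossLeft (b : Vec) (A : Mat) : Mat :=
  (Matrix.of fun j => b ⨯₃ Aᵀ j)ᵀ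

/-- The value of a polynomial tensor field at a point. -/
def evalMat (τ : PolyMat) (x : Vec) : Mat :=
  τ.map (MvPolynomial.eval x)

/-! ### Differential operators -/

/-- The curl of a polynomial vector field. -/
def curlVec (u : Fin 3 → Poly) : Fin 3 → Poly :=
  ![pderiv 1 (u 2) - pderiv 2 (u 1), pderiv 2 (u 0) - pderiv 0 (u 2),
    pderiv 0 (u 1) - pderiv 1 (u 0)]

/-- The row-wise curl of a polynomial tensor field. -/
def curlMat (A : PolyMat) : PolyMat :=
  Matrix.of fun i => curlVec (A i)

/-- The operator `sym curl`. -/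
def symCurl : PolyMat →ₗ[ℝ] PolyMat where
  toFun A := sym (curlMat A)
  map_add' A B := by
    ext1 i j
    fin_cases i <;> fin_cases j <;> simp [sym, curlMat, curlVec, ← smul_add] <;> ring
  map_smul' c A := by
    ext1 i j
    fin_cases i <;> fin_cases j <;>
      simp [sym, curlMat, curlVec, ← smul_add, ← smul_sub, smul_comm c]

/-- The Hessian `∇² q`. -/
def hess : Poly →ₗ[ℝ] PolyMat where
  toFun q := Matrix.of fun i j => pderiv i (pderiv j q)
  map_add' p q := by ext1 i j; simp
  map_smul' c q := by ext1 i j; simp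

/-- The directional derivative `∂_n p` along a constant vector `n`. -/
def dirDeriv (n : Vec) (p : Poly) : Poly :=
  ∑ i, n i • pderiv i p

/-- The surface divergence `∇_F · v`, with `∇_F = ∇ - n ∂_n`, for a plane with unit normal `n`. -/
def surfDiv (n : Vec) (v : Fin 3 → Poly) : Poly :=
  ∑ i, (pderiv i (v i) - n i • dirDeriv n (v i))

/-- The polynomial vector field `τ b` for a constant vector `b`. -/
def mulConst (τ : PolyMat) (b : Vec) : Fin 3 → Poly :=
  fun i => ∑ j, b j • τ i j

/-- The polynomial `aᵀ τ b` for constant vectors `a`, `b`. -/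
def bilin (a : Vec) (τ : PolyMat) (b : Vec) : Poly :=
  ∑ i, a i • mulConst τ b i

/-- The trace `2 div_F (τ n) + ∂_n (nᵀ τ n)`. -/
def shearTrace (n : Vec) (τ : PolyMat) : Poly :=
  2 * surfDiv n (mulConst τ n) + dirDeriv n (bilin n τ n)

/-! ### Polynomial spaces -/

/-- Polynomials of total degree at most `m`. -/
abbrev PolyLE (m : ℕ) : Submodule ℝ Poly := restrictTotalDegree (Fin 3) ℝ m

/-- Restriction of polynomials of total degree at most `m` to a set `G`. -/
def restrictPoly (G : Set Vec) (m : ℕ) : PolyLE m →ₗ[ℝ] (G → ℝ) where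
  toFun q x := eval (x : Vec) (q : Poly)
  map_add' p q := by ext x; simp
  map_smul' c q := by ext x; simp [smul_eval]

/-- `ℙ_m(G)`: functions on `G` that are restrictions of polynomials of degree at most `m`. -/
abbrev PolyOn (G : Set Vec) (m : ℕ) : Submodule ℝ (G → ℝ) :=
  LinearMap.range (restrictPoly G m)

/-- `ℙ_m(K; 𝕋)`: trace-free tensor fields whose entries are polynomials of degree at most `m`. -/
def traceFree (m : ℕ) : Submodule ℝ PolyMat where
  carrier := {τ | (∀ i j, τ i j ∈ PolyLE m) ∧ τ.trace = 0}
  add_mem' := by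
    rintro σ τ ⟨h1, h2⟩ ⟨h3, h4⟩
    exact ⟨fun i j => add_mem (h1 i j) (h3 i j), by rw [trace_add, h2, h4, add_zero]⟩
  zero_mem' := ⟨fun i j => zero_mem _, trace_zero _ _⟩
  smul_mem' := by
    rintro c τ ⟨h1, h2⟩
    exact ⟨fun i j => Submodule.smul_mem _ c (h1 i j), by rw [trace_smul, h2, smul_zero]⟩

/-- The map `q ↦ x xᵀ q`. -/
def xxT : Poly →ₗ[ℝ] PolyMat where
  toFun q := Matrix.of fun i j => X i * X j * q
  map_add' p q := by ext1 i j; simp [mul_add]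
  map_smul' c q := by ext1 i j; simp

/-- The space of shape functions `Σ_{ℓ,k} = sym curl ℙ_{ℓ+1}(K; 𝕋) ⊕ x xᵀ ℙ_{k-2}(K)`. -/
def shapeSpace (l k : ℕ) : Submodule ℝ PolyMat :=
  (traceFree (l + 1)).map symCurl ⊔ (PolyLE (k - 2)).map xxT

/-- The space of Hessians `∇² ℙ_m(K)`. -/
def hessSpace (m : ℕ) : Submodule ℝ PolyMat :=
  (PolyLE m).map hess

/-! ### Geometry of a tetrahedron -/

/-- The closed tetrahedron as a set of points. -/
def body (K : Tetrahedron) : Set Vec :=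
  convexHull ℝ (Set.range K.points)

/-- The closed face of `K` opposite to the `i`-th vertex. -/
def face (K : Tetrahedron) (i : Fin 4) : Set Vec :=
  convexHull ℝ (K.points '' {i}ᶜ)

/-- The six edges of a tetrahedron, as pairs of vertex indices in increasing order. -/
abbrev Edge : Type := {e : Fin 4 × Fin 4 // e.1 < e.2}

/-- The closed edge joining two vertices of `K`. -/
def edge (K : Tetrahedron) (e : Edge) : Set Vec :=
  segment ℝ (K.points e.1.1) (K.points e.1.2)

/-- `n` is a unit normal vector of the `i`-th face of `K` (of either orientation). -/
def IsUnitFaceNormal (K : Tetrahedron) (i : Fin 4) (n : Vec) : Prop :=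
  n ⬝ᵥ n = 1 ∧ ∀ a b : Fin 4, a ≠ i → b ≠ i → n ⬝ᵥ (K.points a - K.points b) = 0

/-- `ν 0`, `ν 1` are two linearly independent unit normal vectors of the edge `e` of `K`. -/
def IsEdgeNormalPair (K : Tetrahedron) (e : Edge) (ν : Fin 2 → Vec) : Prop :=
  (∀ i, ν i ⬝ᵥ ν i = 1 ∧ ν i ⬝ᵥ (K.points e.1.2 - K.points e.1.1) = 0) ∧ LinearIndependent ℝ ν

/-! ### Integrals -/

/-- The line integral of `f` along the edge `e` with respect to arc length. -/
def edgeIntegral (K : Tetrahedron) (e : Edge) (f : Vec → ℝ) : ℝ :=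
  let a := K.points e.1.1
  let u := K.points e.1.2 - a
  √(u ⬝ᵥ u) * ∫ s in (0 : ℝ)..1, f (a + s • u)

/-- The surface integral of `f` over the `i`-th face with respect to surface area, in the affine
parametrization `(s, t) ↦ a + s u + t w` with `s, t ≥ 0`, `s + t ≤ 1`, whose area element is
`|u × w| ds dt`. -/
def faceIntegral (K : Tetrahedron) (i : Fin 4) (f : Vec → ℝ) : ℝ :=
  let a := K.points (i.succAbove 0)
  let u := K.points (i.succAbove 1) - a
  let w := K.points (i.succAbove 2) - a
  √((u ⨯₃ w) ⬝ᵥ (u ⨯₃ w)) *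
    ∫ s in (0 : ℝ)..1, ∫ t in (0 : ℝ)..(1 - s), f (a + s • u + t • w)

/-- The `L²` inner product `(p, q)_e` of (the restrictions of) two polynomials on an edge. -/
def edgeInner (K : Tetrahedron) (e : Edge) (p q : Poly) : ℝ :=
  edgeIntegral K e fun x => eval x p * eval x q

/-- The `L²` inner product `(p, q)_F` of (the restrictions of) two polynomials on a face. -/
def faceInner (K : Tetrahedron) (i : Fin 4) (p q : Poly) : ℝ :=
  faceIntegral K i fun x => eval x p * eval x q

/-- The `L²` inner product `(τ, ς)_K = ∫_K τ : ς` of two polynomial tensor fields. -/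
def bodyInner (K : Tetrahedron) (τ ς : PolyMat) : ℝ :=
  ∫ x in body K, ∑ i, ∑ j, evalMat τ x i j * evalMat ς x i j

/-! ### Bubble functions -/

lemma evalMat_add (σ τ : PolyMat) (x : Vec) :
    evalMat (σ + τ) x = evalMat σ x + evalMat τ x := by
  ext i j; simp [evalMat]

lemma evalMat_smul (c : ℝ) (τ : PolyMat) (x : Vec) :
    evalMat (c • τ) x = c • evalMat τ x := by
  ext i j; simp [evalMat, smul_eval]

lemma crossRight_add (A B : Mat) (b : Vec) :
    crossRight (A + B) b = crossRight A b + crossRight B b := by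
  ext i j; fin_cases j <;> simp [crossRight, cross_apply] <;> ring

lemma crossRight_smul (c : ℝ) (A : Mat) (b : Vec) :
    crossRight (c • A) b = c • crossRight A b := by
  ext i j; fin_cases j <;> simp [crossRight, cross_apply] <;> ring

lemma crossLeft_add (A B : Mat) (b : Vec) :
    crossLeft b (A + B) = crossLeft b A + crossLeft b B := by
  ext i j; fin_cases i <;> simp [crossLeft, cross_apply] <;> ring

lemma crossLeft_smul (c : ℝ) (A : Mat) (b : Vec) :
    crossLeft b (c • A) = c • crossLeft b A := by
  ext i j; fin_cases i <;> simp [crossLeft, cross_apply] <;> ring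

lemma sym_add (A B : Mat) : sym (A + B) = sym A + sym B := by
  ext i j; simp [sym]; ring

lemma sym_smul (c : ℝ) (A : Mat) : sym (c • A) = c • sym A := by
  ext i j; simp [sym]; ring

/-- The trace `n · A × n`. -/
def tr₂ (n : Vec) (A : Mat) : Vec := n ᵥ* crossRight A n

/-- The trace `n × sym (A × n) × n`. -/
def tr₁ (n : Vec) (A : Mat) : Mat := crossRight (crossLeft n (sym (crossRight A n))) n

/-- The `sym curl` bubble space `B_m(sym curl, K; 𝕋)`: trace-free polynomial tensor fields `τ` of
degree at most `m` with `n · τ × n = 0` and `n × sym (τ × n) × n = 0` on every face, where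
`n i` is a unit normal vector of the `i`-th face. -/
def bubble (K : Tetrahedron) (n : Fin 4 → Vec) (m : ℕ) : Submodule ℝ PolyMat where
  carrier := {τ | τ ∈ traceFree m ∧ ∀ i, ∀ x ∈ face K i,
    tr₂ (n i) (evalMat τ x) = 0 ∧ tr₁ (n i) (evalMat τ x) = 0}
  add_mem' := by
    rintro σ τ ⟨h1, h2⟩ ⟨h3, h4⟩
    refine ⟨add_mem h1 h3, fun i x hx => ?_⟩
    obtain ⟨a, b⟩ := h2 i x hx
    obtain ⟨c, d⟩ := h4 i x hx
    simp only [tr₁, tr₂, evalMat_add, crossRight_add, crossLeft_add, sym_add,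
      Matrix.vecMul_add] at *
    simp [a, b, c, d]
  zero_mem' := by
    refine ⟨zero_mem _, fun i x _ => ?_⟩
    have h : evalMat 0 x = (0 : ℝ) • (1 : Mat) := by ext; simp [evalMat]
    simp only [tr₁, tr₂, h, crossRight_smul, crossLeft_smul, sym_smul, Matrix.vecMul_smul]
    simp
  smul_mem' := by
    rintro c τ ⟨h1, h2⟩
    refine ⟨Submodule.smul_mem _ c h1, fun i x hx => ?_⟩
    obtain ⟨a, b⟩ := h2 i x hx
    simp only [tr₁, tr₂, evalMat_smul, crossRight_smul, crossLeft_smul, sym_smul,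
      Matrix.vecMul_smul] at *
    simp [a, b]

/-- The space `sym curl B_m(sym curl, K; 𝕋)`. -/
def symCurlBubble (K : Tetrahedron) (n : Fin 4 → Vec) (m : ℕ) : Submodule ℝ PolyMat :=
  (bubble K n m).map symCurl

end DivDiv

end

open DivDiv

open MvPolynomial Matrix MeasureTheory

noncomputable section

namespace DivDiv

/-! ### Polynomials of bounded degree -/

/-! Write ℓ = m + 3 and k = j + 2. Uniqueness and existence are proved separately, without counting
dimensions. Both rest on the following facts about div div.

Exactness for polynomials: div div kills every sym curl, and a symmetric field of degree at most ℓ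
that is killed by div div is the sym curl of a trace-free field of degree at most ℓ + 1
(`exists_symCurl_eq`). On the complement, q ↦ div div (x xᵀ q) multiplies the part of degree d by (d
+ 3)(d + 4), so it is invertible degree by degree (`divDiv_xxT`).

Green's identity: if nᵀτn and 2 div_F(τn) + ∂_n(nᵀτn) vanish on all faces and n_iᵀ τ n_j vanishes on
the common edge of two faces (`ZeroTrace`), then ∫ (div div τ) q = ∫ τ : ∇²q for every q
(`cellInt_divDiv_mul`).

Boundary functionals: for symmetric fields of degree ℓ they take all admissible values
(`exists_bdry_eq`), and their vanishing forces the traces to vanish (`zeroTrace_of_bdry_eq_zero`).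
The second statement also covers x xᵀ p with p of degree at most ℓ - 1, because n·x is constant on a
face plane and so the traces have lower degree than the field (`traceDegree_xxT`).

Exactness with boundary conditions: sym curl σ has zero traces exactly when σ can be replaced by a
bubble with the same sym curl (`symCurl_mem_symCurlBubble`, `zeroTrace_symCurl`), and div div maps
zero-trace symmetric fields of degree ℓ onto the polynomials of degree ℓ - 2 orthogonal to affine
functions (`exists_zeroTrace_divDiv_eq`).

Uniqueness: let all functionals vanish on τ = sym curl σ + x xᵀ p. The traces vanish, so by Green
div div (x xᵀ p) is orthogonal to all polynomials of degree at most j. It has such degree itself,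
hence p = 0. Now τ = sym curl σ is the sym curl of a bubble and orthogonal to all of these, hence
zero.

Existence: take a field τ_b of degree ℓ with the right boundary values, and choose p so that div div
(x xᵀ p) produces the missing moments against Hessians. Subtract from x xᵀ p a field τ_p of degree ℓ
with the same boundary values, and add a zero-trace β with div div β = div div (τ_p - τ_b). In τ_b +
(x xᵀ p - τ_p) + β the part other than x xᵀ p is killed by div div, hence is a sym curl, so the sum
is a shape function. A sym curl of a bubble finally adjusts the last moments without changing any
other. -/

lemma mem_polyLE_iff {p : Poly} {m : ℕ} :
    p ∈ PolyLE m ↔ ∀ s : Fin 3 →₀ ℕ, m < s.degree → coeff s p = 0 := by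
  rw [mem_restrictTotalDegree]
  constructor
  · intro h s hs
    by_contra hne
    have := le_totalDegree (mem_support_iff.2 hne)
    rw [Finsupp.degree_apply] at hs
    simp only [Finsupp.sum] at this
    omega
  · intro h
    rw [totalDegree, Finset.sup_le_iff]
    intro s hs
    by_contra hlt
    refine mem_support_iff.1 hs (h s ?_)
    rw [Finsupp.degree_apply]
    simp only [Finsupp.sum] at hlt
    omega

lemma polyLE_mono {m m' : ℕ} (h : m ≤ m') {p : Poly} (hp : p ∈ PolyLE m) : p ∈ PolyLE m' := by
  rw [mem_restrictTotalDegree] at *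
  exact hp.trans h

lemma polyLE_C (m : ℕ) (c : ℝ) : (C c : Poly) ∈ PolyLE m := by
  rw [mem_restrictTotalDegree]; simp

lemma polyLE_X (a : Fin 3) : (X a : Poly) ∈ PolyLE 1 := by
  rw [mem_restrictTotalDegree, totalDegree_X]

lemma polyLE_mul {m m' : ℕ} {p q : Poly} (hp : p ∈ PolyLE m) (hq : q ∈ PolyLE m') :
    p * q ∈ PolyLE (m + m') := by
  rw [mem_restrictTotalDegree] at *
  exact (totalDegree_mul _ _).trans (add_le_add hp hq)

lemma polyLE_C_mul {m : ℕ} (c : ℝ) {p : Poly} (hp : p ∈ PolyLE m) : C c * p ∈ PolyLE m := by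
  rw [← smul_eq_C_mul]
  exact Submodule.smul_mem _ _ hp

lemma polyLE_X_mul {m : ℕ} (a : Fin 3) {p : Poly} (hp : p ∈ PolyLE m) :
    X a * p ∈ PolyLE (m + 1) := by
  rw [add_comm]
  exact polyLE_mul (polyLE_X a) hp

lemma polyLE_pderiv {m : ℕ} (a : Fin 3) {p : Poly} (hp : p ∈ PolyLE m) :
    pderiv a p ∈ PolyLE (m - 1) := by
  rw [mem_polyLE_iff] at *
  intro s hs
  rw [coeff_pderiv, hp, zero_mul]
  rw [map_add, Finsupp.degree_single]
  omega

lemma polyLE_aeval {m : ℕ} {f : Fin 3 → Poly} (hf : ∀ a, f a ∈ PolyLE 1) {p : Poly}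
    (hp : p ∈ PolyLE m) : aeval f p ∈ PolyLE m := by
  have key : ∀ s : Fin 3 →₀ ℕ, (s.prod fun a e => f a ^ e) ∈ PolyLE s.degree := by
    intro s
    rw [mem_restrictTotalDegree, Finsupp.degree_apply, Finsupp.prod]
    refine (totalDegree_finsetProd _ _).trans (Finset.sum_le_sum fun a _ => ?_)
    refine (totalDegree_pow _ _).trans ?_
    have := (mem_restrictTotalDegree _ _ _).1 (hf a)
    nlinarith
  rw [p.as_sum, map_sum]
  refine Submodule.sum_mem _ fun s hs => ?_
  rw [aeval_monomial, algebraMap_eq]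
  refine polyLE_C_mul _ (polyLE_mono ?_ (key s))
  by_contra h
  exact mem_support_iff.1 hs (mem_polyLE_iff.1 hp s (by omega))

lemma exists_eq_C_add_sum_X_mul {m : ℕ} {p : Poly} (hp : p ∈ PolyLE (m + 1)) :
    ∃ (c : ℝ) (r : Fin 3 → Poly), (∀ a, r a ∈ PolyLE m) ∧ p = C c + ∑ a, X a * r a := by
  suffices h : ∀ s : Fin 3 →₀ ℕ, s.degree ≤ m + 1 → ∀ b : ℝ,
      ∃ (c : ℝ) (r : Fin 3 → Poly), (∀ a, r a ∈ PolyLE m) ∧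
        monomial s b = C c + ∑ a, X a * r a by
    have h' : ∀ s ∈ p.support, ∃ (c : ℝ) (r : Fin 3 → Poly), (∀ a, r a ∈ PolyLE m) ∧
        monomial s (coeff s p) = C c + ∑ a, X a * r a := by
      intro s hs
      refine h s ?_ _
      by_contra hlt
      exact mem_support_iff.1 hs (mem_polyLE_iff.1 hp s (by omega))
    choose! c r hr hc using h'
    refine ⟨∑ s ∈ p.support, c s, fun a => ∑ s ∈ p.support, r s a,
      fun a => Submodule.sum_mem _ fun s hs => hr s hs a, ?_⟩
    conv_lhs => rw [p.as_sum]
    rw [Finset.sum_congr rfl hc, Finset.sum_add_distrib, map_sum, Finset.sum_comm]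
    simp only [Finset.mul_sum]
  intro s hs b
  rcases eq_or_ne s 0 with rfl | hne
  · exact ⟨b, 0, fun a => zero_mem _, by simp [← C_apply]⟩
  · obtain ⟨a, ha⟩ := Finsupp.ne_iff.1 hne
    have ha' : 1 ≤ s a := Nat.one_le_iff_ne_zero.2 ha
    have hsa : (s - Finsupp.single a 1) + Finsupp.single a 1 = s := by
      ext i
      by_cases hi : i = a
      · subst hi; simp; omega
      · simp [Ne.symm hi]
    refine ⟨0, Pi.single a (monomial (s - Finsupp.single a 1) b), fun i => ?_, ?_⟩
    · by_cases hi : i = a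
      · subst hi
        rw [Pi.single_eq_same, mem_polyLE_iff]
        intro u hu
        rw [coeff_monomial, if_neg]
        rintro rfl
        have := congrArg Finsupp.degree hsa
        rw [map_add, Finsupp.degree_single] at this
        omega
      · rw [Pi.single_eq_of_ne hi]; exact zero_mem _
    · rw [Finset.sum_eq_single a (fun i _ hi => by rw [Pi.single_eq_of_ne hi, mul_zero])
        (fun h => absurd (Finset.mem_univ _) h), Pi.single_eq_same, X, monomial_mul, one_mul,
        add_comm (Finsupp.single a 1), hsa, map_zero, zero_add]

/-! ### Weighted homogeneous components -/

/-- The operator that multiplies the homogeneous component of degree `d` by `c d`. -/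
def wt (c : ℕ → ℝ) : Poly →ₗ[ℝ] Poly :=
  (basisMonomials (Fin 3) ℝ).constr ℝ fun s => monomial s (c s.degree)

lemma wt_monomial (c : ℕ → ℝ) (s : Fin 3 →₀ ℕ) (b : ℝ) :
    wt c (monomial s b) = monomial s (c s.degree * b) := by
  have h : (monomial s b : Poly) = b • basisMonomials (Fin 3) ℝ s := by
    simp [smul_monomial]
  rw [h, map_smul, wt, Module.Basis.constr_basis, smul_monomial, smul_eq_mul, mul_comm]

lemma poly_linearMap_ext {M : Type*} [AddCommMonoid M] [Module ℝ M] {f g : Poly →ₗ[ℝ] M}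
    (h : ∀ s b, f (monomial s b) = g (monomial s b)) (p : Poly) : f p = g p := by
  induction p using MvPolynomial.induction_on' with
  | monomial s b => exact h s b
  | add p q hp hq => rw [map_add, map_add, hp, hq]

lemma coeff_wt (c : ℕ → ℝ) (p : Poly) (s : Fin 3 →₀ ℕ) :
    coeff s (wt c p) = c s.degree * coeff s p := by
  induction p using MvPolynomial.induction_on' with
  | monomial u b =>
    rw [wt_monomial, coeff_monomial, coeff_monomial]
    split_ifs with h
    · rw [h]
    · rw [mul_zero]
  | add p q hp hq => rw [map_add, coeff_add, coeff_add, hp, hq, mul_add]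

lemma polyLE_wt (c : ℕ → ℝ) {m : ℕ} {p : Poly} (hp : p ∈ PolyLE m) : wt c p ∈ PolyLE m := by
  rw [mem_polyLE_iff] at *
  intro s hs
  rw [coeff_wt, hp s hs, mul_zero]

lemma wt_wt (c c' : ℕ → ℝ) (p : Poly) : wt c (wt c' p) = wt (fun d => c d * c' d) p := by
  ext s
  simp only [coeff_wt, mul_assoc]

lemma wt_add_apply (c c' : ℕ → ℝ) (p : Poly) : wt c p + wt c' p = wt (fun d => c d + c' d) p := by
  ext s
  simp only [coeff_add, coeff_wt, add_mul]

lemma wt_one (p : Poly) : wt (fun _ => 1) p = p := by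
  ext s
  simp only [coeff_wt, one_mul]

lemma wt_const (b : ℝ) (p : Poly) : wt (fun _ => b) p = b • p := by
  ext s
  simp only [coeff_wt, coeff_smul, smul_eq_mul]

lemma pderiv_wt (c : ℕ → ℝ) (a : Fin 3) (p : Poly) :
    pderiv a (wt c p) = wt (fun d => c (d + 1)) (pderiv a p) := by
  ext s
  simp only [coeff_wt, coeff_pderiv, map_add, Finsupp.degree_single]
  ring

lemma wt_X_mul (c : ℕ → ℝ) (a : Fin 3) (p : Poly) :
    wt c (X a * p) = X a * wt (fun d => c (d + 1)) p := by
  induction p using MvPolynomial.induction_on' with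
  | monomial s b =>
    rw [wt_monomial, X, monomial_mul, wt_monomial, monomial_mul, map_add, Finsupp.degree_single,
      one_mul, one_mul, add_comm 1]
  | add p q hp hq => simp only [mul_add, map_add, hp, hq]

/-- Euler's identity. The radial derivative plus a positive constant is thus a weight operator
without zeros, and reciprocal weights invert it. The homotopy formulas below all use this. -/
lemma sum_X_mul_pderiv_eq_wt (p : Poly) : ∑ a, X a * pderiv a p = wt (fun d => d) p := by
  induction p using MvPolynomial.induction_on' with
  | monomial s b =>
    simp only [X_mul_pderiv_monomial]
    rw [wt_monomial, ← Finset.sum_smul, Finsupp.degree_eq_sum, ← Nat.cast_smul_eq_nsmul ℝ,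
      smul_monomial, smul_eq_mul]
  | add p q hp hq => simp only [mul_add, map_add, Finset.sum_add_distrib, hp, hq]

lemma wt_congr_inv {c : ℕ → ℝ} (hc : ∀ d, c d ≠ 0) (p : Poly) :
    wt c (wt (fun d => (c d)⁻¹) p) = p := by
  rw [wt_wt]
  simp only [mul_inv_cancel₀ (hc _), wt_one]

/-- The homogeneous components of a polynomial that vanishes on a line through the origin vanish
there. -/
lemma eval_wt_eq_zero (c : ℕ → ℝ) {p : Poly} {x : Vec} (h : ∀ s : ℝ, eval (s • x) p = 0) :
    eval x (wt c p) = 0 := by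
  -- Restriction to the line s ↦ s x sends a monomial of degree d to a multiple of the d-th power of
  -- the variable, so weights by degree become weights on coefficients.
  let φ : Poly →ₐ[ℝ] Polynomial ℝ := aeval fun a => Polynomial.C (x a) * Polynomial.X
  have h1 : ∀ s b, φ (monomial s b) = Polynomial.monomial s.degree (eval x (monomial s b)) := by
    intro s b
    simp only [φ, aeval_monomial, eval_monomial, mul_pow, Finsupp.prod_mul]
    rw [← Polynomial.C_mul_X_pow_eq_monomial, Polynomial.C_mul, mul_assoc]
    congr 2
    · simp [Finsupp.prod]
    · simp [Finsupp.prod, Finsupp.degree_apply, Finset.prod_pow_eq_pow_sum]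
  have h2 : φ p = 0 := by
    apply Polynomial.funext
    intro s
    rw [Polynomial.eval_zero, ← h s, ← Polynomial.coe_evalRingHom, ← RingHom.coe_coe φ,
      ← RingHom.comp_apply]
    congr 1
    refine MvPolynomial.ringHom_ext (fun r => ?_) fun a => ?_
    · simp [φ]
    · simp [φ, mul_comm (x a)]
  let ψ : Polynomial ℝ →ₗ[ℝ] ℝ := Polynomial.lsum fun d => c d • LinearMap.id
  have h3 : eval x (wt c p) = ψ (φ p) := by
    have : ((aeval x).toLinearMap : Poly →ₗ[ℝ] ℝ) ∘ₗ wt c = ψ ∘ₗ φ.toLinearMap := by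
      apply LinearMap.ext
      apply poly_linearMap_ext
      intro s b
      simp only [LinearMap.comp_apply, AlgHom.toLinearMap_apply, h1, wt_monomial, ψ,
        Polynomial.lsum_apply]
      rw [Polynomial.sum_monomial_index _ _ (by simp)]
      simp [eval_monomial, mul_assoc]
    have h4 := LinearMap.congr_fun this p
    simpa [coe_aeval_eq_eval] using h4
  rw [h3, h2, map_zero]

/-! ### Differential operators on polynomials -/

lemma pderiv_comm (a b : Fin 3) (p : Poly) : pderiv a (pderiv b p) = pderiv b (pderiv a p) := by
  ext s
  simp only [coeff_pderiv]
  rw [add_right_comm]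
  by_cases h : a = b
  · subst h; ring
  · simp [h, Ne.symm h]
    ring

lemma curlVec_apply_zero (u : Fin 3 → Poly) : curlVec u 0 = pderiv 1 (u 2) - pderiv 2 (u 1) := rfl

lemma curlVec_apply_one (u : Fin 3 → Poly) : curlVec u 1 = pderiv 2 (u 0) - pderiv 0 (u 2) := rfl

lemma curlVec_apply_two (u : Fin 3 → Poly) : curlVec u 2 = pderiv 0 (u 1) - pderiv 1 (u 0) := rfl

/-- The divergence of a polynomial vector field. -/
def divVec (v : Fin 3 → Poly) : Poly := ∑ a, pderiv a (v a)

/-- The operator `div div`. -/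
def divDiv : PolyMat →ₗ[ℝ] Poly where
  toFun τ := ∑ i, ∑ j, pderiv i (pderiv j (τ i j))
  map_add' σ τ := by simp [Finset.sum_add_distrib]
  map_smul' c τ := by simp [Finset.smul_sum]

lemma divDiv_apply (τ : PolyMat) : divDiv τ = ∑ i, ∑ j, pderiv i (pderiv j (τ i j)) := rfl

lemma polyLE_divDiv {m : ℕ} {τ : PolyMat} (h : ∀ i j, τ i j ∈ PolyLE m) :
    divDiv τ ∈ PolyLE (m - 2) :=
  Submodule.sum_mem _ fun i _ => Submodule.sum_mem _ fun j _ =>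
    polyLE_pderiv i (polyLE_pderiv j (h i j))

lemma symCurl_apply (A : PolyMat) (i j : Fin 3) :
    symCurl A i j = (1 / 2 : ℝ) • (curlMat A i j + curlMat A j i) := rfl

lemma symCurl_isSymm (A : PolyMat) : (symCurl A).IsSymm := by
  ext1 i j
  rw [transpose_apply, symCurl_apply, symCurl_apply, add_comm]

lemma hess_apply (q : Poly) (i j : Fin 3) : hess q i j = pderiv i (pderiv j q) := rfl

lemma xxT_apply (q : Poly) (i j : Fin 3) : xxT q i j = X i * X j * q := rfl

lemma xxT_isSymm (q : Poly) : (xxT q).IsSymm := by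
  ext1 i j
  rw [transpose_apply, xxT_apply, xxT_apply, mul_comm (X j)]

lemma polyLE_curlVec {m : ℕ} {u : Fin 3 → Poly} (h : ∀ a, u a ∈ PolyLE m) (a : Fin 3) :
    curlVec u a ∈ PolyLE (m - 1) := by
  fin_cases a <;> exact sub_mem (polyLE_pderiv _ (h _)) (polyLE_pderiv _ (h _))

lemma polyLE_symCurl {m : ℕ} {A : PolyMat} (h : ∀ i j, A i j ∈ PolyLE m) (i j : Fin 3) :
    symCurl A i j ∈ PolyLE (m - 1) :=
  Submodule.smul_mem _ _ (add_mem (polyLE_curlVec (h i) j) (polyLE_curlVec (h j) i))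

lemma divVec_curlVec (u : Fin 3 → Poly) : divVec (curlVec u) = 0 := by
  simp only [divVec, Fin.sum_univ_three, curlVec, Matrix.cons_val_zero, Matrix.cons_val_one,
    Matrix.cons_val, map_sub]
  rw [pderiv_comm 1 0, pderiv_comm 2 0, pderiv_comm 2 1]
  ring

/-- The rows of a curl are divergence-free. Commuting the two derivatives reduces the transposed
half to the same fact. -/
lemma divDiv_symCurl (A : PolyMat) : divDiv (symCurl A) = 0 := by
  have h1 : ∑ i, ∑ j, pderiv i (pderiv j (curlMat A i j)) = 0 := by
    refine Finset.sum_eq_zero fun i _ => ?_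
    rw [← map_sum]
    have := divVec_curlVec (A i)
    rw [divVec] at this
    rw [show ∑ j, pderiv j (curlMat A i j) = 0 from this, map_zero]
  have h2 : ∑ i, ∑ j, pderiv i (pderiv j (curlMat A j i)) = 0 := by
    rw [Finset.sum_comm, ← h1]
    refine Finset.sum_congr rfl fun i _ => Finset.sum_congr rfl fun j _ => pderiv_comm _ _ _
  rw [divDiv_apply]
  simp only [symCurl_apply, Derivation.map_smul, map_add, smul_add, Finset.sum_add_distrib,
    ← Finset.smul_sum, h1, h2, smul_zero, add_zero]

/-- The row-wise curl of a multiple of the identity is skew. This gauge freedom lets potentials be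
made trace-free. -/
lemma symCurl_smul_one (φ : Poly) : symCurl (φ • (1 : PolyMat)) = 0 := by
  have h0 : ∀ i j, (φ • (1 : PolyMat)) i j = if i = j then φ else 0 := by
    intro i j
    rw [Matrix.smul_apply, Matrix.one_apply, smul_ite, smul_zero, smul_eq_mul, mul_one]
  have h1 : ∀ i j, curlMat (φ • (1 : PolyMat)) i j + curlMat (φ • (1 : PolyMat)) j i = 0 := by
    intro i j
    simp only [curlMat, curlVec, of_apply, h0]
    fin_cases i <;> fin_cases j <;> simp
  ext1 i j
  rw [symCurl_apply, h1, smul_zero, Matrix.zero_apply]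

lemma curlVec_grad (q : Poly) : curlVec (fun b => pderiv b q) = 0 := by
  ext1 a
  fin_cases a <;> simp [curlVec, pderiv_comm]

lemma symCurl_grad (v : Fin 3 → Poly) : symCurl (Matrix.of fun a b => pderiv b (v a)) = 0 := by
  ext1 i j
  have h : ∀ i, curlMat (Matrix.of fun a b => pderiv b (v a)) i = 0 := fun i => curlVec_grad (v i)
  rw [symCurl_apply, h, h]
  simp

/-- With E the radial derivative, the inner divergence of x xᵀ q is x (E + 4) q, and the divergence
of x p is (E + 3) p. -/
lemma divDiv_xxT (q : Poly) : divDiv (xxT q) = wt (fun d => (d + 3) * (d + 4)) q := by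
  have h1 : ∀ i, ∑ j, pderiv j (X i * X j * q) = X i * wt (fun d => d + 4) q := by
    intro i
    have : ∑ j, pderiv j (X i * X j * q) = X i * (∑ a, X a * pderiv a q) + (4 : ℝ) • (X i * q) := by
      fin_cases i <;>
        simp [Fin.sum_univ_three, pderiv_X, smul_eq_C_mul,
          show (C 4 : Poly) = 4 from map_ofNat C 4] <;> ring
    rw [this, sum_X_mul_pderiv_eq_wt, ← wt_add_apply, wt_const, mul_add, mul_smul_comm]
  have h2 : ∀ p : Poly, ∑ i, pderiv i (X i * p) = wt (fun d => d + 3) p := by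
    intro p
    rw [← wt_add_apply, wt_const, ← sum_X_mul_pderiv_eq_wt]
    simp [Fin.sum_univ_three, pderiv_X, smul_eq_C_mul, show (C 3 : Poly) = 3 from map_ofNat C 3]
    ring
  rw [divDiv_apply]
  simp only [xxT_apply, ← map_sum, h1, h2, wt_wt]

lemma exists_divDiv_xxT_eq {m : ℕ} {d : Poly} (hd : d ∈ PolyLE m) :
    ∃ p ∈ PolyLE m, divDiv (xxT p) = d := by
  refine ⟨_, polyLE_wt (fun e => (((e : ℝ) + 3) * (e + 4))⁻¹) hd, ?_⟩
  rw [divDiv_xxT, wt_congr_inv (c := fun e => ((e : ℝ) + 3) * (e + 4))]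
  intro e
  positivity

lemma xxT_eq_zero_of_divDiv {q : Poly} (h : divDiv (xxT q) = 0) : q = 0 := by
  rw [divDiv_xxT] at h
  ext s
  have := congrArg (coeff s) h
  rw [coeff_wt, coeff_zero] at this
  rw [coeff_zero]
  refine (mul_eq_zero.1 this).resolve_left ?_
  positivity

/-! ### Polynomial Poincaré lemmas -/

/-- Koszul homotopy: curl (V × x) = 2V + (x·∇)V - x div V. Dividing the degree-d part of v by d + 2
gives a V, still divergence-free, for which the right-hand side is v. -/
lemma exists_curlVec_eq {m : ℕ} {v : Fin 3 → Poly} (hv : ∀ a, v a ∈ PolyLE m)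
    (hdiv : divVec v = 0) : ∃ w : Fin 3 → Poly, (∀ a, w a ∈ PolyLE (m + 1)) ∧ curlVec w = v := by
  let c : ℕ → ℝ := fun d => ((d : ℝ) + 2)⁻¹
  let V : Fin 3 → Poly := fun a => wt c (v a)
  have hV : ∀ a, V a ∈ PolyLE m := fun a => polyLE_wt c (hv a)
  have hdV : pderiv 0 (V 0) + pderiv 1 (V 1) + pderiv 2 (V 2) = 0 := by
    have := congrArg (wt fun d => c (d + 1)) hdiv
    rw [divVec, Fin.sum_univ_three, map_add, map_add, map_zero] at this
    simpa only [V, pderiv_wt] using this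
  have hE : ∀ a, (2 : ℝ) • V a + (X 0 * pderiv 0 (V a) + X 1 * pderiv 1 (V a) +
      X 2 * pderiv 2 (V a)) = v a := by
    intro a
    have h := sum_X_mul_pderiv_eq_wt (V a)
    rw [Fin.sum_univ_three] at h
    rw [h, ← wt_const, wt_add_apply]
    simp only [V, add_comm (2 : ℝ)]
    rw [wt_congr_inv (c := fun d => (d : ℝ) + 2)]
    intro d
    positivity
  refine ⟨![X 2 * V 1 - X 1 * V 2, X 0 * V 2 - X 2 * V 0, X 1 * V 0 - X 0 * V 1], ?_, ?_⟩
  · intro a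
    fin_cases a <;> exact sub_mem (polyLE_X_mul _ (hV _)) (polyLE_X_mul _ (hV _))
  · ext1 a
    rw [← hE a]
    fin_cases a
    · simp [curlVec, pderiv_X, smul_eq_C_mul, show (C 2 : Poly) = 2 from map_ofNat C 2]
      linear_combination (-X 0) * hdV
    · simp [curlVec, pderiv_X, smul_eq_C_mul, show (C 2 : Poly) = 2 from map_ofNat C 2]
      linear_combination (-X 1) * hdV
    · simp [curlVec, pderiv_X, smul_eq_C_mul, show (C 2 : Poly) = 2 from map_ofNat C 2]
      linear_combination (-X 2) * hdV

/-- The field div τ is divergence-free, so it is curl w. A skew matrix built from w has row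
divergence -curl w, and adding it to τ makes every row a curl without changing the symmetric part.
-/
lemma exists_symCurl_eq {m : ℕ} {τ : PolyMat} (hτ : ∀ i j, τ i j ∈ PolyLE (m + 1))
    (hsymm : τ.IsSymm) (hdd : divDiv τ = 0) : ∃ σ ∈ traceFree (m + 2), symCurl σ = τ := by
  obtain ⟨w, hw, hcw⟩ := exists_curlVec_eq (m := m) (v := fun i => ∑ j, pderiv j (τ i j))
    (fun i => Submodule.sum_mem _ fun j _ => polyLE_pderiv j (hτ i j)) (by
      rw [divDiv_apply] at hdd
      simpa only [divVec, map_sum] using hdd)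
  let S : PolyMat := !![0, -w 2, w 1; w 2, 0, -w 0; -w 1, w 0, 0]
  have hS : ∀ i j, S i j ∈ PolyLE (m + 1) := by
    intro i j
    fin_cases i <;> fin_cases j <;>
      first | exact zero_mem _ | exact hw _ | exact neg_mem (hw _)
  have hrow : ∀ i, ∃ u : Fin 3 → Poly, (∀ a, u a ∈ PolyLE (m + 2)) ∧
      curlVec u = fun j => τ i j + S i j := by
    intro i
    refine exists_curlVec_eq (m := m + 1) (fun j => add_mem (hτ i j) (hS i j)) ?_
    have h := congrFun hcw i
    rw [divVec]
    simp only [map_add, Finset.sum_add_distrib]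
    rw [← h]
    fin_cases i <;> simp [curlVec, S, Fin.sum_univ_three]
    ring
  choose u hu hcu using hrow
  let A : PolyMat := Matrix.of u
  have hA : symCurl A = τ := by
    ext1 i j
    have h1 : ∀ i j, curlMat A i j = τ i j + S i j := fun i j => congrFun (hcu i) j
    have h2 : τ j i = τ i j := hsymm.apply i j
    have h3 : S i j + S j i = 0 := by fin_cases i <;> fin_cases j <;> simp [S]
    rw [symCurl_apply, h1, h1, h2, show τ i j + S i j + (τ i j + S j i) =
      (2 : ℝ) • τ i j + (S i j + S j i) by rw [two_smul]; ring, h3, add_zero, smul_smul]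
    norm_num
  -- Removing the trace subtracts a multiple of the identity, which sym curl does not see.
  refine ⟨A - ((1 / 3 : ℝ) • A.trace) • (1 : PolyMat), ⟨fun i j => ?_, ?_⟩, ?_⟩
  · refine sub_mem (hu i j) ?_
    have : A.trace ∈ PolyLE (m + 2) := Submodule.sum_mem _ fun i _ => hu i i
    rw [Matrix.smul_apply, Matrix.one_apply]
    split_ifs
    · rw [smul_eq_mul, mul_one]; exact Submodule.smul_mem _ _ this
    · rw [smul_zero]; exact zero_mem _
  · rw [trace_sub, trace_smul, trace_one, Fintype.card_fin, smul_eq_mul, smul_mul_assoc,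
      Nat.cast_ofNat, mul_comm, ← show (C 3 : Poly) = 3 from map_ofNat C 3, ← smul_eq_C_mul,
      smul_smul]
    norm_num
  · rw [map_sub, symCurl_smul_one, sub_zero, hA]

/-- The gradient of a polynomial at a point. -/
def gradAt (f : Poly) (x : Vec) : Vec := fun a => eval x (pderiv a f)

/-- The value of a polynomial vector field at a point. -/
def evalVec (v : Fin 3 → Poly) (x : Vec) : Vec := fun a => eval x (v a)

/-- The potential is f = x·V, where V divides the degree-d part of ω by d + 1. Then ∇f - ω = x ×
curl V, and n × (x × c) = (n·c)x - (n·x)c vanishes on the plane once n·curl V does. -/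
lemma exists_gradAt_of_origin {m : ℕ} {ω : Fin 3 → Poly} (hω : ∀ a, ω a ∈ PolyLE m) (n : Vec)
    (h : ∀ x : Vec, n ⬝ᵥ x = 0 → n ⬝ᵥ evalVec (curlVec ω) x = 0) :
    ∃ f ∈ PolyLE (m + 1), ∀ x : Vec, n ⬝ᵥ x = 0 → n ⨯₃ (gradAt f x - evalVec ω x) = 0 := by
  let c : ℕ → ℝ := fun d => ((d : ℝ) + 1)⁻¹
  let V : Fin 3 → Poly := fun a => wt c (ω a)
  have hE : ∀ a, V a + (X 0 * pderiv 0 (V a) + X 1 * pderiv 1 (V a) +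
      X 2 * pderiv 2 (V a)) = ω a := by
    intro a
    have h := sum_X_mul_pderiv_eq_wt (V a)
    rw [Fin.sum_univ_three] at h
    rw [h]
    have h1 : V a + wt (fun d => d) (V a) = wt (fun d => (d : ℝ) + 1) (V a) := by
      rw [← wt_add_apply (fun d => (d : ℝ)) (fun _ => 1), wt_one, add_comm]
    rw [h1]
    refine wt_congr_inv (c := fun d => (d : ℝ) + 1) (fun d => ?_) (ω a)
    positivity
  refine ⟨∑ b, X b * V b, Submodule.sum_mem _ fun b _ => polyLE_X_mul b (polyLE_wt c (hω b)), ?_⟩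
  intro x hx
  have hcurl : n ⬝ᵥ evalVec (curlVec V) x = 0 := by
    -- Closedness is known only on the plane. The plane is a union of lines through the origin, so
    -- reweighting by degree preserves it.
    have h0 := eval_wt_eq_zero (fun d => c (d + 1)) (p := ∑ a, n a • curlVec ω a) (x := x) (by
      intro s
      have := h (s • x) (by rw [dotProduct_smul, hx, smul_zero])
      simpa [dotProduct, evalVec, smul_eval] using this)
    have hc : ∀ a, curlVec V a = wt (fun d => c (d + 1)) (curlVec ω a) := by
      intro a
      fin_cases a <;> simp only [Fin.zero_eta, Fin.mk_one, Fin.reduceFinMk, V, curlVec_apply_zero,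
        curlVec_apply_one, curlVec_apply_two, pderiv_wt, map_sub]
    rw [← h0]
    simp only [dotProduct, evalVec, hc, map_sum, map_smul, smul_eval]
  have hg : gradAt (∑ b, X b * V b) x - evalVec ω x = x ⨯₃ evalVec (curlVec V) x := by
    ext a
    simp only [Pi.sub_apply, evalVec, gradAt]
    rw [← hE a]
    fin_cases a <;> simp [cross_apply, evalVec, curlVec_apply_zero,
      curlVec_apply_one, curlVec_apply_two, Fin.sum_univ_three, pderiv_X] <;> ring
  rw [hg, cross_cross_eq_smul_sub_smul', hcurl, dotProduct_comm x n, hx]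
  simp

/-- The restriction of a polynomial to the line through `x` in direction `w`. -/
def linePoly (p : Poly) (x w : Vec) : Polynomial ℝ :=
  aeval (fun a => Polynomial.C (x a) + Polynomial.C (w a) * Polynomial.X) p

lemma eval_linePoly (p : Poly) (x w : Vec) (s : ℝ) :
    (linePoly p x w).eval s = eval (x + s • w) p := by
  rw [linePoly, ← Polynomial.coe_evalRingHom, ← RingHom.coe_coe (aeval _), ← RingHom.comp_apply]
  congr 1
  refine MvPolynomial.ringHom_ext (fun r => ?_) fun i => ?_
  · simp
  · simp only [RingHom.comp_apply, RingHom.coe_coe, aeval_X, eval_X, Polynomial.coe_evalRingHom,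
      Polynomial.eval_add, Polynomial.eval_mul, Polynomial.eval_C, Polynomial.eval_X, Pi.add_apply,
      Pi.smul_apply, smul_eq_mul, mul_comm]

lemma derivative_linePoly (p : Poly) (x w : Vec) :
    Polynomial.derivative (linePoly p x w) = linePoly (∑ a, w a • pderiv a p) x w := by
  induction p using MvPolynomial.induction_on with
  | C r => simp [linePoly]
  | add p q hp hq =>
    simp only [linePoly, map_add, smul_add, Finset.sum_add_distrib] at *
    rw [hp, hq]
  | mul_X p i hp =>
    have h : (∑ a, w a • pderiv a (p * X i)) = (∑ a, w a • pderiv a p) * X i + w i • p := by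
      simp only [pderiv_mul, pderiv_X, smul_add, Finset.sum_add_distrib, Finset.sum_mul,
        smul_mul_assoc, Pi.single_apply, mul_ite, mul_one, mul_zero, smul_ite, smul_zero,
        Finset.sum_ite_eq, Finset.mem_univ, if_true]
    rw [h]
    simp only [linePoly, map_mul, map_add, map_smul, aeval_X, Polynomial.derivative_mul] at *
    rw [hp]
    rw [Polynomial.derivative_C, Polynomial.derivative_C, Polynomial.derivative_X,
      Polynomial.smul_eq_C_mul]
    ring

lemma hasDerivAt_eval_line (p : Poly) (x w : Vec) (s : ℝ) :
    HasDerivAt (fun s : ℝ => eval (x + s • w) p) (w ⬝ᵥ gradAt p (x + s • w)) s := by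
  have h := (linePoly p x w).hasDerivAt s
  rw [derivative_linePoly, eval_linePoly] at h
  simp only [eval_linePoly] at h
  refine h.congr_deriv ?_
  rw [map_sum]
  simp only [dotProduct, gradAt, smul_eval]

/-- Translation of polynomials. -/
def shift (a : Vec) : Poly →ₐ[ℝ] Poly := aeval fun i => X i + C (a i)

lemma eval_shift (a x : Vec) (p : Poly) : eval x (shift a p) = eval (x + a) p := by
  rw [← RingHom.coe_coe (shift a), ← RingHom.comp_apply]
  congr 1
  refine MvPolynomial.ringHom_ext (fun r => ?_) fun i => ?_ <;> simp [shift]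

lemma polyLE_shift (a : Vec) {m : ℕ} {p : Poly} (hp : p ∈ PolyLE m) : shift a p ∈ PolyLE m :=
  polyLE_aeval (fun i => add_mem (polyLE_X i) (polyLE_C _ _)) hp

lemma pderiv_shift (a : Vec) (b : Fin 3) (p : Poly) :
    pderiv b (shift a p) = shift a (pderiv b p) := by
  induction p using MvPolynomial.induction_on with
  | C r => simp [shift]
  | add p q hp hq => simp only [map_add, hp, hq]
  | mul_X p i hp =>
    rw [map_mul, pderiv_mul, hp, pderiv_mul, map_add, map_mul, map_mul]
    congr 2
    by_cases h : i = b
    · subst h; simp [shift]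
    · simp [shift, pderiv_X_of_ne h]

/-- The polynomial Poincaré lemma on a plane: a one-form whose tangential part on a plane is
closed agrees there tangentially with a gradient. -/
lemma exists_gradAt_of_plane {m : ℕ} {ω : Fin 3 → Poly} (hω : ∀ a, ω a ∈ PolyLE m) (n a : Vec)
    (h : ∀ x : Vec, n ⬝ᵥ x = n ⬝ᵥ a → n ⬝ᵥ evalVec (curlVec ω) x = 0) :
    ∃ f ∈ PolyLE (m + 1), ∀ x : Vec, n ⬝ᵥ x = n ⬝ᵥ a →
      n ⨯₃ (gradAt f x - evalVec ω x) = 0 := by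
  obtain ⟨f, hf, hfx⟩ := exists_gradAt_of_origin (ω := fun b => shift a (ω b))
    (fun b => polyLE_shift a (hω b)) n (by
      intro x hx
      rw [← h (x + a) (by rw [dotProduct_add, hx, zero_add])]
      congr 1
      ext b
      fin_cases b <;> simp [evalVec, curlVec, pderiv_shift, eval_shift])
  refine ⟨shift (-a) f, polyLE_shift _ hf, fun x hx => ?_⟩
  have := hfx (x - a) (by rw [dotProduct_sub, hx, sub_self])
  rw [← this]
  congr 1
  ext b
  simp [gradAt, evalVec, pderiv_shift, eval_shift, sub_eq_add_neg]

/-! ### Barycentric coordinates -/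

/-- The vertices of a tetrahedron as an affine basis. -/
def vertexBasis (K : Tetrahedron) : AffineBasis (Fin 4) ℝ Vec where
  toFun := K.points
  ind' := K.independent
  tot' := by
    rw [K.independent.affineSpan_eq_top_iff_card_eq_finrank_add_one]
    simp

lemma vertexBasis_apply (K : Tetrahedron) (i : Fin 4) : vertexBasis K i = K.points i := rfl

/-- The gradient of a barycentric coordinate. -/
def cov (K : Tetrahedron) (i : Fin 4) : Vec :=
  fun a => ((vertexBasis K).coord i).linear (Pi.single a 1)

/-- A barycentric coordinate as a polynomial. -/
def bary (K : Tetrahedron) (i : Fin 4) : Poly :=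
  C ((vertexBasis K).coord i 0) + ∑ a, C (cov K i a) * X a

lemma linear_coord (K : Tetrahedron) (i : Fin 4) (w : Vec) :
    ((vertexBasis K).coord i).linear w = cov K i ⬝ᵥ w := by
  conv_lhs => rw [pi_eq_sum_univ' w]
  rw [map_sum, dotProduct]
  refine Finset.sum_congr rfl fun a _ => ?_
  rw [map_smul, smul_eq_mul, mul_comm, cov]

lemma eval_bary (K : Tetrahedron) (i : Fin 4) (x : Vec) :
    eval x (bary K i) = (vertexBasis K).coord i x := by
  have h := AffineMap.decomp ((vertexBasis K).coord i)
  have h2 := congrFun h x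
  rw [h2, Pi.add_apply, linear_coord]
  simp [bary, dotProduct, add_comm]

lemma eval_bary_point (K : Tetrahedron) (i j : Fin 4) :
    eval (K.points j) (bary K i) = if i = j then 1 else 0 := by
  rw [eval_bary, ← vertexBasis_apply, AffineBasis.coord_apply]

lemma sum_eval_bary (K : Tetrahedron) (x : Vec) : ∑ i, eval x (bary K i) = 1 := by
  simp only [eval_bary, AffineBasis.sum_coord_apply_eq_one]

lemma sum_eval_bary_smul (K : Tetrahedron) (x : Vec) :
    ∑ i, eval x (bary K i) • K.points i = x := by
  simp only [eval_bary]
  exact (vertexBasis K).linear_combination_coord_eq_self x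

lemma eval_add_bary (K : Tetrahedron) (i : Fin 4) (x w : Vec) :
    eval (x + w) (bary K i) = eval x (bary K i) + cov K i ⬝ᵥ w := by
  rw [eval_bary, eval_bary, ← linear_coord, add_comm x w]
  have := ((vertexBasis K).coord i).map_vadd x w
  simpa [add_comm] using this

lemma cov_dotProduct_sub (K : Tetrahedron) (i : Fin 4) (x y : Vec) :
    cov K i ⬝ᵥ (x - y) = eval x (bary K i) - eval y (bary K i) := by
  rw [eq_sub_iff_add_eq, add_comm, ← eval_add_bary]
  congr 2
  abel_nf

lemma cov_dotProduct_points (K : Tetrahedron) (i j k : Fin 4) :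
    cov K i ⬝ᵥ (K.points j - K.points k) = (if i = j then 1 else 0) - if i = k then 1 else 0 := by
  rw [cov_dotProduct_sub, eval_bary_point, eval_bary_point]

lemma pderiv_bary (K : Tetrahedron) (i : Fin 4) (a : Fin 3) :
    pderiv a (bary K i) = C (cov K i a) := by
  rw [bary, map_add, pderiv_C, zero_add, map_sum]
  simp [pderiv_X, Pi.single_apply]

lemma polyLE_bary (K : Tetrahedron) (i : Fin 4) : bary K i ∈ PolyLE 1 :=
  add_mem (polyLE_C _ _) (Submodule.sum_mem _ fun _ _ => polyLE_C_mul _ (polyLE_X _))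

lemma bary_ne_zero (K : Tetrahedron) (i : Fin 4) : bary K i ≠ 0 := by
  intro h
  have := eval_bary_point K i i
  rw [h] at this
  simp at this

lemma polyLE_bary_mul (K : Tetrahedron) (i : Fin 4) {m : ℕ} {p : Poly} (hp : p ∈ PolyLE m) :
    bary K i * p ∈ PolyLE (m + 1) := by
  rw [add_comm]
  exact polyLE_mul (polyLE_bary K i) hp

lemma polyLE_of_bary_mul (K : Tetrahedron) (i : Fin 4) {m : ℕ} {p : Poly}
    (hp : bary K i * p ∈ PolyLE (m + 1)) : p ∈ PolyLE m := by
  rcases eq_or_ne p 0 with rfl | hne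
  · exact zero_mem _
  rw [mem_restrictTotalDegree] at *
  rw [totalDegree_mul_of_isDomain (bary_ne_zero K i) hne] at hp
  have h1 : (bary K i).totalDegree ≠ 0 := by
    intro h0
    rw [totalDegree_eq_zero_iff_eq_C] at h0
    obtain ⟨j, hj⟩ := exists_ne i
    have h1 := eval_bary_point K i i
    have h2 := eval_bary_point K i j
    rw [h0, eval_C] at h1 h2
    rw [if_pos rfl] at h1
    rw [if_neg hj.symm, h1] at h2
    exact one_ne_zero h2
  omega

lemma sum_cov_dotProduct (K : Tetrahedron) (w : Vec) : ∑ i, cov K i ⬝ᵥ w = 0 := by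
  have h := sum_eval_bary K (0 + w)
  simp only [eval_add_bary, Finset.sum_add_distrib, sum_eval_bary] at h
  linarith

/-- The edge vectors at one vertex and the gradients of the other three barycentric coordinates are
dual bases; the term i = a is zero. -/
lemma eq_sum_cov_smul (K : Tetrahedron) (a : Fin 4) (w : Vec) :
    w = ∑ i, (cov K i ⬝ᵥ w) • (K.points i - K.points a) := by
  have h := sum_eval_bary_smul K (K.points a + w)
  simp only [eval_add_bary, eval_bary_point, add_smul, Finset.sum_add_distrib, ite_smul, one_smul,
    zero_smul, Finset.sum_ite_eq', Finset.mem_univ, if_true, add_right_inj] at h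
  simp only [smul_sub, Finset.sum_sub_distrib, h]
  rw [← Finset.sum_smul, sum_cov_dotProduct, zero_smul, sub_zero]

lemma dotProduct_eq_sum_cov (K : Tetrahedron) (a : Fin 4) (u w : Vec) :
    u ⬝ᵥ w = ∑ i, (u ⬝ᵥ (K.points i - K.points a)) * (cov K i ⬝ᵥ w) := by
  conv_lhs => rw [eq_sum_cov_smul K a w]
  rw [dotProduct_sum]
  simp only [dotProduct_smul, smul_eq_mul, mul_comm]

lemma eq_sum_smul_cov (K : Tetrahedron) (a : Fin 4) (u : Vec) :
    u = ∑ i, (u ⬝ᵥ (K.points i - K.points a)) • cov K i := by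
  apply dotProduct_eq
  intro w
  rw [dotProduct_eq_sum_cov K a, sum_dotProduct]
  simp only [smul_dotProduct, smul_eq_mul]

lemma eq_zero_of_cov_dotProduct (K : Tetrahedron) (a : Fin 4) {w : Vec}
    (h : ∀ i, i ≠ a → cov K i ⬝ᵥ w = 0) : w = 0 := by
  rw [eq_sum_cov_smul K a w]
  refine Finset.sum_eq_zero fun i _ => ?_
  rcases eq_or_ne i a with rfl | hi
  · rw [sub_self, smul_zero]
  · rw [h i hi, zero_smul]

/-- A unit face normal is a nonzero multiple of the gradient of the barycentric coordinate. -/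
lemma IsUnitFaceNormal.exists_cov_eq {K : Tetrahedron} {i : Fin 4} {n : Vec}
    (h : IsUnitFaceNormal K i n) : ∃ c : ℝ, c ≠ 0 ∧ cov K i = c • n := by
  obtain ⟨a, ha⟩ := exists_ne i
  have h1 : n = (n ⬝ᵥ (K.points i - K.points a)) • cov K i := by
    conv_lhs => rw [eq_sum_smul_cov K a n]
    refine Finset.sum_eq_single i (fun j _ hj => ?_) (fun h => absurd (Finset.mem_univ _) h)
    rw [h.2 j a hj ha, zero_smul]
  have h2 : n ⬝ᵥ (K.points i - K.points a) ≠ 0 := by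
    intro h0
    have h3 := h.1
    rw [h1, h0, zero_smul] at h3
    simp at h3
  refine ⟨(n ⬝ᵥ (K.points i - K.points a))⁻¹, inv_ne_zero h2, ?_⟩
  nth_rewrite 2 [h1]
  rw [smul_smul, inv_mul_cancel₀ h2, one_smul]

/-! ### Polynomials vanishing on faces -/

/-- The affine subspace on which the barycentric coordinates with index in `Z` vanish. -/
def flat (K : Tetrahedron) (Z : Finset (Fin 4)) : Set Vec :=
  {x | ∀ z ∈ Z, eval x (bary K z) = 0}

lemma mem_flat_singleton {K : Tetrahedron} {i : Fin 4} {x : Vec} :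
    x ∈ flat K {i} ↔ eval x (bary K i) = 0 := by
  simp [flat]

lemma mem_flat_pair {K : Tetrahedron} {i j : Fin 4} {x : Vec} :
    x ∈ flat K {i, j} ↔ eval x (bary K i) = 0 ∧ eval x (bary K j) = 0 := by
  simp [flat]

lemma point_mem_flat (K : Tetrahedron) {Z : Finset (Fin 4)} {k : Fin 4} (hk : k ∉ Z) :
    K.points k ∈ flat K Z := by
  intro z hz
  rw [eval_bary_point, if_neg]
  rintro rfl
  exact hk hz

/-- The projection onto `flat K Z` along the directions from the vertices in `Z` to the vertex
`k`. -/
def projPoint (K : Tetrahedron) (Z : Finset (Fin 4)) (k : Fin 4) (x : Vec) : Vec :=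
  x - ∑ z ∈ Z, eval x (bary K z) • (K.points z - K.points k)

/-- Composition of polynomials with `projPoint`. -/
def projPoly (K : Tetrahedron) (Z : Finset (Fin 4)) (k : Fin 4) : Poly →ₐ[ℝ] Poly :=
  aeval fun a => X a - ∑ z ∈ Z, C ((K.points z - K.points k) a) * bary K z

lemma eval_projPoly (K : Tetrahedron) (Z : Finset (Fin 4)) (k : Fin 4) (p : Poly) (x : Vec) :
    eval x (projPoly K Z k p) = eval (projPoint K Z k x) p := by
  rw [← RingHom.coe_coe (projPoly K Z k), ← RingHom.comp_apply]
  congr 1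
  refine MvPolynomial.ringHom_ext (fun r => ?_) fun i => ?_
  · simp [projPoly]
  · simp [projPoly, projPoint, Finset.sum_apply, mul_comm]

lemma polyLE_projPoly (K : Tetrahedron) (Z : Finset (Fin 4)) (k : Fin 4) {m : ℕ} {p : Poly}
    (hp : p ∈ PolyLE m) : projPoly K Z k p ∈ PolyLE m :=
  polyLE_aeval (fun i => sub_mem (polyLE_X i)
    (Submodule.sum_mem _ fun z _ => polyLE_C_mul _ (polyLE_bary K z))) hp

lemma projPoint_mem (K : Tetrahedron) {Z : Finset (Fin 4)} {k : Fin 4} (hk : k ∉ Z) (x : Vec) :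
    projPoint K Z k x ∈ flat K Z := by
  intro j hj
  rw [projPoint, sub_eq_add_neg, eval_add_bary, dotProduct_neg, dotProduct_sum]
  have hjk : j ≠ k := by rintro rfl; exact hk hj
  simp only [dotProduct_smul, cov_dotProduct_points, hjk, if_false, sub_zero, smul_eq_mul, mul_ite,
    mul_one, mul_zero, Finset.sum_ite_eq, hj, if_true]
  ring

lemma projPoint_of_mem (K : Tetrahedron) {Z : Finset (Fin 4)} (k : Fin 4) {x : Vec}
    (hx : x ∈ flat K Z) : projPoint K Z k x = x := by
  rw [projPoint, Finset.sum_eq_zero, sub_zero]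
  intro z hz
  rw [hx z hz, zero_smul]

lemma projPoly_eq_zero {K : Tetrahedron} {Z : Finset (Fin 4)} {k : Fin 4} (hk : k ∉ Z) {p : Poly}
    (hp : ∀ x ∈ flat K Z, eval x p = 0) : projPoly K Z k p = 0 := by
  apply MvPolynomial.funext
  intro x
  rw [eval_projPoly, map_zero, hp _ (projPoint_mem K hk x)]

/-- Substitutions that are congruent modulo q have congruent results. This is used for two
projections that differ by a multiple of a barycentric coordinate. -/
lemma dvd_aeval_sub_aeval {q : Poly} {f g : Fin 3 → Poly} (h : ∀ a, q ∣ f a - g a) (p : Poly) :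
    q ∣ aeval f p - aeval g p := by
  induction p using MvPolynomial.induction_on with
  | C r => simp
  | add p p' hp hp' =>
    rw [map_add, map_add, add_sub_add_comm]
    exact dvd_add hp hp'
  | mul_X p i hp =>
    rw [map_mul, map_mul, aeval_X, aeval_X, show aeval f p * f i - aeval g p * g i =
      aeval f p * (f i - g i) + (aeval f p - aeval g p) * g i by ring]
    exact dvd_add ((h i).mul_left _) (hp.mul_right _)

/-- A polynomial that vanishes on a hyperplane section of a flat is, on the flat, a multiple of
the corresponding barycentric coordinate. -/
lemma exists_eq_bary_mul {K : Tetrahedron} {Z : Finset (Fin 4)} {j k : Fin 4}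
    (hj : j ∉ Z) (hk : k ∉ insert j Z) {m : ℕ} {p : Poly} (hm : p ∈ PolyLE (m + 1))
    (hp : ∀ x ∈ flat K (insert j Z), eval x p = 0) :
    ∃ r ∈ PolyLE m, ∀ x ∈ flat K Z, eval x p = eval x (bary K j) * eval x r := by
  have h0 := projPoly_eq_zero hk hp
  -- Both projections move points towards the same vertex k, so they differ only in the direction of
  -- vertex j, by a multiple of its coordinate. The projection onto the smaller flat kills p.
  have h1 : bary K j ∣ projPoly K Z k p - projPoly K (insert j Z) k p := by
    refine dvd_aeval_sub_aeval (fun a => ?_) p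
    rw [Finset.sum_insert hj, sub_sub_sub_cancel_left, add_sub_cancel_right]
    exact dvd_mul_left _ _
  rw [h0, sub_zero] at h1
  obtain ⟨r, hr⟩ := h1
  refine ⟨r, polyLE_of_bary_mul K j (hr ▸ polyLE_projPoly K Z k hm), fun x hx => ?_⟩
  rw [← map_mul, ← hr, eval_projPoly, projPoint_of_mem K k hx]

lemma exists_eq_bary_mul_of_plane {K : Tetrahedron} {i : Fin 4} {p : Poly}
    (hp : ∀ x ∈ flat K {i}, eval x p = 0) : ∃ r, p = bary K i * r := by
  obtain ⟨k, hk⟩ := exists_ne i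
  have hp' : ∀ x ∈ flat K (insert i ∅), eval x p = 0 := by simpa using hp
  obtain ⟨r, -, hr⟩ := exists_eq_bary_mul (Z := ∅) (j := i) (k := k) (by simp) (by simpa using hk)
    (m := p.totalDegree) (polyLE_mono (Nat.le_succ _) ((mem_restrictTotalDegree _ _ _).2 le_rfl))
    hp'
  refine ⟨r, MvPolynomial.funext fun x => ?_⟩
  rw [map_mul]
  exact hr x (by simp [flat])

/-- The barycentric coordinates are nonzero divisors on flats. -/
lemma eval_eq_zero_of_bary_mul {K : Tetrahedron} {Z : Finset (Fin 4)} {j : Fin 4} (hj : j ∉ Z)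
    {p : Poly} (hp : ∀ x ∈ flat K Z, eval x (bary K j) * eval x p = 0) :
    ∀ x ∈ flat K Z, eval x p = 0 := by
  have h := projPoly_eq_zero hj (p := bary K j * p) (by simpa using hp)
  rw [map_mul, mul_eq_zero] at h
  rcases h with h | h
  · have h1 := eval_projPoly K Z j (bary K j) (K.points j)
    rw [h, projPoint_of_mem K j (point_mem_flat K hj), eval_bary_point, if_pos rfl] at h1
    simp at h1
  · intro x hx
    have h1 := eval_projPoly K Z j p x
    rw [h, projPoint_of_mem K j hx, map_zero] at h1
    exact h1.symm

/-- The relative interior of the cell of the tetrahedron in `flat K Z`. -/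
def cell (K : Tetrahedron) (Z : Finset (Fin 4)) : Set Vec :=
  {x | x ∈ flat K Z ∧ ∀ i, i ∉ Z → 0 < eval x (bary K i)}

/-- A polynomial that vanishes on a cell vanishes on its affine span. -/
lemma eval_eq_zero_of_cell {K : Tetrahedron} {Z : Finset (Fin 4)} (hZ : Zᶜ.Nonempty) {p : Poly}
    (hp : ∀ x ∈ cell K Z, eval x p = 0) : ∀ x ∈ flat K Z, eval x p = 0 := by
  intro y hy
  set N : ℝ := (Zᶜ.card : ℝ)
  have hN : 0 < N := Nat.cast_pos.2 hZ.card_pos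
  -- The barycentre of the cell: on the segment from it to y, the points near it lie in the cell, so
  -- p vanishes at infinitely many points of the line.
  set c : Vec := (1 / N) • ∑ i ∈ Zᶜ, K.points i with hc
  have hcb : ∀ j, eval c (bary K j) = if j ∈ Z then 0 else 1 / N := by
    intro j
    obtain ⟨k, hk⟩ := hZ
    have h1 : c = K.points k + (1 / N) • ∑ i ∈ Zᶜ, (K.points i - K.points k) := by
      rw [hc, Finset.sum_sub_distrib, Finset.sum_const, smul_sub, ← Nat.cast_smul_eq_nsmul ℝ,
        smul_smul, one_div_mul_cancel hN.ne', one_smul]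
      abel
    rw [h1, eval_add_bary, eval_bary_point, dotProduct_smul, dotProduct_sum]
    simp only [cov_dotProduct_points, Finset.sum_sub_distrib, Finset.sum_ite_eq, Finset.sum_const,
      Finset.mem_compl, smul_eq_mul, nsmul_eq_mul]
    rw [mul_sub, ← mul_assoc, one_div_mul_cancel hN.ne']
    split_ifs <;> simp_all
  set q : Polynomial ℝ := linePoly p c (y - c) with hq
  have hqe : ∀ s : ℝ, q.eval s = eval (c + s • (y - c)) p := fun s => eval_linePoly _ _ _ _
  have hlin : ∀ (s : ℝ) j, eval (c + s • (y - c)) (bary K j) =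
      (1 - s) * eval c (bary K j) + s * eval y (bary K j) := by
    intro s j
    rw [eval_add_bary, dotProduct_smul, cov_dotProduct_sub, smul_eq_mul]
    ring
  obtain ⟨M, hM⟩ : ∃ M : ℝ, ∀ j, |eval y (bary K j)| ≤ M :=
    ⟨∑ j, |eval y (bary K j)|, fun j =>
      Finset.single_le_sum (f := fun j => |eval y (bary K j)|) (fun _ _ => abs_nonneg _)
        (Finset.mem_univ j)⟩
  have hM0 : 0 ≤ M := (abs_nonneg _).trans (hM 0)
  -- Chosen so that (1 - s)/N - sM > 0 for 0 ≤ s < ε, which keeps the nonzero coordinates positive.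
  set ε : ℝ := 1 / (1 + N * M) with hε
  have hNM : 0 ≤ N * M := mul_nonneg hN.le hM0
  have hε0 : 0 < ε := by positivity
  have hroot : ∀ s ∈ Set.Ico 0 ε, q.IsRoot s := by
    rintro s ⟨hs0, hs1⟩
    rw [Polynomial.IsRoot, hqe]
    refine hp _ ⟨fun z hz => ?_, fun j hj => ?_⟩
    · rw [hlin, hcb, if_pos hz, hy z hz]; ring
    · rw [hlin, hcb, if_neg hj]
      have h1 := neg_abs_le (eval y (bary K j))
      have h2 := hM j
      have h3 : s * (1 + N * M) < 1 := by
        rw [hε, lt_div_iff₀ (by positivity)] at hs1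
        exact hs1
      have h4 : 0 < (1 - s) * (1 / N) - s * M := by
        have : (1 - s) * (1 / N) - s * M = (1 - s * (1 + N * M)) / N := by
          field_simp
          ring
        rw [this]
        exact div_pos (by linarith) hN
      nlinarith
  have hq0 : q = 0 := Polynomial.eq_zero_of_infinite_isRoot q
    ((Set.Ico_infinite hε0).mono hroot)
  have := hqe 1
  rw [hq0, one_smul, add_sub_cancel, Polynomial.eval_zero] at this
  exact this.symm

/-- Polynomials on the face planes that agree on the edges are restrictions of one polynomial. -/
lemma exists_patch (K : Tetrahedron) {m : ℕ} {f : Fin 4 → Poly} (hf : ∀ i, f i ∈ PolyLE (m + 3))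
    (h : ∀ i j, i ≠ j → ∀ x ∈ flat K {i, j}, eval x (f i) = eval x (f j)) :
    ∃ g ∈ PolyLE (m + 3), ∀ i, ∀ x ∈ flat K {i}, eval x g = eval x (f i) := by
  obtain ⟨r₁, hr₁, h₁⟩ := exists_eq_bary_mul (K := K) (Z := {1}) (j := 0) (k := 2) (by decide)
    (by decide) (sub_mem (hf 1) (hf 0)) (by
      intro x hx
      rw [map_sub, h 0 1 (by decide) x hx, sub_self])
  -- Newton-type interpolation: each correction is a multiple of the coordinates of the faces
  -- already treated and so leaves the values there unchanged.
  set g₁ := f 0 + bary K 0 * r₁ with hg₁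
  have hg₁m : g₁ ∈ PolyLE (m + 3) := add_mem (hf 0) (polyLE_bary_mul K 0 hr₁)
  have hg₁0 : ∀ x ∈ flat K {0}, eval x g₁ = eval x (f 0) := by
    intro x hx
    rw [hg₁, map_add, map_mul, mem_flat_singleton.1 hx, zero_mul, add_zero]
  have hg₁1 : ∀ x ∈ flat K {1}, eval x g₁ = eval x (f 1) := by
    intro x hx
    have := h₁ x hx
    rw [map_sub] at this
    rw [hg₁, map_add, map_mul, ← this]; ring
  obtain ⟨s₂, hs₂, h₂⟩ := exists_eq_bary_mul (K := K) (Z := {2}) (j := 0) (k := 1) (by decide)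
    (by decide) (sub_mem (hf 2) hg₁m) (by
      intro x hx
      have hx' := mem_flat_pair.1 hx
      rw [map_sub, hg₁0 x (mem_flat_singleton.2 hx'.1), h 0 2 (by decide) x hx, sub_self])
  obtain ⟨r₂, hr₂, h₂'⟩ := exists_eq_bary_mul (K := K) (Z := {2}) (j := 1) (k := 0) (by decide)
    (by decide) hs₂ (by
      refine eval_eq_zero_of_bary_mul (j := 0) (by decide) fun x hx => ?_
      have hx' := mem_flat_pair.1 hx
      rw [← h₂ x (mem_flat_singleton.2 hx'.2), map_sub, hg₁1 x (mem_flat_singleton.2 hx'.1),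
        h 1 2 (by decide) x hx, sub_self])
  set g₂ := g₁ + bary K 0 * (bary K 1 * r₂) with hg₂
  have hg₂m : g₂ ∈ PolyLE (m + 3) :=
    add_mem hg₁m (polyLE_bary_mul K 0 (polyLE_bary_mul K 1 hr₂))
  have hg₂0 : ∀ x ∈ flat K {0}, eval x g₂ = eval x (f 0) := by
    intro x hx
    rw [hg₂, map_add, map_mul, mem_flat_singleton.1 hx, zero_mul, add_zero, hg₁0 x hx]
  have hg₂1 : ∀ x ∈ flat K {1}, eval x g₂ = eval x (f 1) := by
    intro x hx
    rw [hg₂, map_add, map_mul, map_mul, mem_flat_singleton.1 hx, zero_mul, mul_zero, add_zero,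
      hg₁1 x hx]
  have hg₂2 : ∀ x ∈ flat K {2}, eval x g₂ = eval x (f 2) := by
    intro x hx
    have := h₂ x hx
    rw [map_sub, h₂' x hx] at this
    rw [hg₂, map_add, map_mul, map_mul, ← this]; ring
  -- The mismatch on the last face vanishes on its three edges, so three coordinates split off. The
  -- degree bound m + 3 leaves room for exactly this.
  obtain ⟨s₃, hs₃, h₃⟩ := exists_eq_bary_mul (K := K) (Z := {3}) (j := 0) (k := 1) (by decide)
    (by decide) (sub_mem (hf 3) hg₂m) (by
      intro x hx
      have hx' := mem_flat_pair.1 hx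
      rw [map_sub, hg₂0 x (mem_flat_singleton.2 hx'.1), h 0 3 (by decide) x hx, sub_self])
  obtain ⟨t₃, ht₃, h₃'⟩ := exists_eq_bary_mul (K := K) (Z := {3}) (j := 1) (k := 0) (by decide)
    (by decide) hs₃ (by
      refine eval_eq_zero_of_bary_mul (j := 0) (by decide) fun x hx => ?_
      have hx' := mem_flat_pair.1 hx
      rw [← h₃ x (mem_flat_singleton.2 hx'.2), map_sub, hg₂1 x (mem_flat_singleton.2 hx'.1),
        h 1 3 (by decide) x hx, sub_self])
  obtain ⟨r₃, hr₃, h₃''⟩ := exists_eq_bary_mul (K := K) (Z := {3}) (j := 2) (k := 0) (by decide)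
    (by decide) ht₃ (by
      refine eval_eq_zero_of_bary_mul (j := 1) (by decide) fun x hx => ?_
      have hx' := mem_flat_pair.1 hx
      rw [← h₃' x (mem_flat_singleton.2 hx'.2)]
      revert x
      have := eval_eq_zero_of_bary_mul (K := K) (Z := {2, 3}) (j := 0) (p := s₃) (by decide) (by
        intro x hx
        have hx' := mem_flat_pair.1 hx
        rw [← h₃ x (mem_flat_singleton.2 hx'.2), map_sub, hg₂2 x (mem_flat_singleton.2 hx'.1),
          h 2 3 (by decide) x hx, sub_self])
      exact fun x hx _ => this x hx)
  refine ⟨g₂ + bary K 0 * (bary K 1 * (bary K 2 * r₃)), add_mem hg₂m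
    (polyLE_bary_mul K 0 (polyLE_bary_mul K 1 (polyLE_bary_mul K 2 hr₃))), fun i x hx => ?_⟩
  have hx' := mem_flat_singleton.1 hx
  simp only [map_add, map_mul]
  fin_cases i
  · simp only [Fin.zero_eta] at hx hx' ⊢
    rw [hx', zero_mul, add_zero, hg₂0 x hx]
  · simp only [Fin.mk_one] at hx hx' ⊢
    rw [hx', zero_mul, mul_zero, add_zero, hg₂1 x hx]
  · simp only [Fin.reduceFinMk] at hx hx' ⊢
    rw [hx', zero_mul, mul_zero, mul_zero, add_zero, hg₂2 x hx]
  · simp only [Fin.reduceFinMk] at hx hx' ⊢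
    have := h₃ x hx
    rw [h₃' x hx, h₃'' x hx, map_sub] at this
    rw [← this]; ring

/-! ### Cross products and the traces of the `sym curl` operator -/

lemma eq_smul_of_cross_eq_zero {n v : Vec} (hn : n ⬝ᵥ n = 1) (h : n ⨯₃ v = 0) :
    v = (n ⬝ᵥ v) • n := by
  have h1 := cross_cross_eq_smul_sub_smul' n n v
  rw [h, hn, one_smul, map_zero] at h1
  exact (sub_eq_zero.1 h1.symm).symm

lemma crossRight_apply (A : Mat) (b : Vec) (i : Fin 3) : crossRight A b i = A i ⨯₃ b := rfl

lemma crossRight_one (n : Vec) :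
    crossRight 1 n = !![0, -n 2, n 1; n 2, 0, -n 0; -n 1, n 0, 0] := by
  ext i j
  fin_cases i <;> fin_cases j <;> simp [crossRight, cross_apply, Matrix.one_apply]

/-- The matrix I × n is skew and is annihilated by n from the left, so neither trace sees multiples
of the identity. -/
lemma traces_eq_zero_of_crossRight {n : Vec} {A : Mat} {c : ℝ}
    (h : crossRight (A - c • (1 : Mat)) n = 0) : tr₂ n A = 0 ∧ tr₁ n A = 0 := by
  have hA : crossRight A n = c • crossRight 1 n := by
    rw [← crossRight_smul, ← sub_eq_zero, ← h, sub_eq_add_neg, sub_eq_add_neg, ← neg_smul,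
      crossRight_add, crossRight_smul (-c), neg_smul, crossRight_smul]
  constructor
  · rw [tr₂, hA, crossRight_one]
    ext j
    fin_cases j <;> simp [vecMul, dotProduct, Fin.sum_univ_three] <;> ring
  · have hs : sym (c • crossRight 1 n) = 0 := by
      rw [sym_smul, crossRight_one]
      ext i j
      fin_cases i <;> fin_cases j <;> simp [sym]
    rw [tr₁, hA, hs]
    ext i j
    fin_cases i <;> fin_cases j <;> simp [crossRight, crossLeft, cross_apply]

/-- Put B = A × n. Then Bn = 0 automatically and nᵀB = 0 by the first trace, so sym B is tangential
and the second trace kills it. A skew B with Bn = 0 equals β (I × n). All rows of A - βI are then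
parallel to n, so its trace -3β equals nᵀAn - β, which determines β. -/
lemma crossRight_eq_zero_of_traces {n : Vec} {A : Mat} (hn : n ⬝ᵥ n = 1) (htr : A.trace = 0)
    (h₂ : tr₂ n A = 0) (h₁ : tr₁ n A = 0) :
    crossRight (A + (1 / 2 * (n ⬝ᵥ A *ᵥ n)) • (1 : Mat)) n = 0 := by
  set B := crossRight A n with hB
  have hBn : ∀ i, B i ⬝ᵥ n = 0 := fun i => by
    rw [hB, crossRight_apply, dotProduct_comm, dot_cross_self]
  have hnB : ∀ j, n ⬝ᵥ Bᵀ j = 0 := fun j => congrFun h₂ j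
  set S := sym B with hS
  have hSij : ∀ i j, S i j = 1 / 2 * (B i j + B j i) := fun i j => by simp [hS, sym]; ring
  have hnS : ∀ j, n ⬝ᵥ Sᵀ j = 0 := fun j => by
    have h1 := hBn j
    have h2 := hnB j
    simp only [dotProduct, Fin.sum_univ_three, transpose_apply] at h1 h2 ⊢
    rw [hSij, hSij, hSij]
    linarith
  have hSn : ∀ i, S i ⬝ᵥ n = 0 := fun i => by
    have h1 := hBn i
    have h2 := hnB i
    simp only [dotProduct, Fin.sum_univ_three, transpose_apply] at h1 h2 ⊢
    rw [hSij, hSij, hSij]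
    linarith
  have hM : ∀ i j, (n ⨯₃ Sᵀ j) i = 0 := by
    intro i
    set w : Vec := fun j => (n ⨯₃ Sᵀ j) i with hw
    have h3 : w ⨯₃ n = 0 := congrFun h₁ i
    have h4 : n ⨯₃ w = 0 := by rw [← cross_anticomm, h3, neg_zero]
    have h5 : n ⬝ᵥ w = 0 := by
      have e0 := hSn 0
      have e1 := hSn 1
      have e2 := hSn 2
      simp only [dotProduct, Fin.sum_univ_three] at e0 e1 e2 ⊢
      fin_cases i <;> simp [hw, cross_apply]
      · linear_combination n 1 * e2 - n 2 * e1
      · linear_combination n 2 * e0 - n 0 * e2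
      · linear_combination n 0 * e1 - n 1 * e0
    have h6 := eq_smul_of_cross_eq_zero hn h4
    rw [h5, zero_smul] at h6
    exact fun j => congrFun h6 j
  have hS0 : ∀ i j, S i j = 0 := by
    intro i j
    have h3 : n ⨯₃ Sᵀ j = 0 := funext fun i => hM i j
    have h4 := eq_smul_of_cross_eq_zero hn h3
    rw [hnS, zero_smul] at h4
    exact congrFun h4 i
  have hskew : ∀ i j, B j i = -B i j := fun i j => by
    have := hSij i j
    rw [hS0] at this
    linarith
  set b : Vec := ![B 2 1, B 0 2, B 1 0] with hb
  have hd : ∀ i, B i i = 0 := fun i => by have := hskew i i; linarith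
  have hbn : n ⨯₃ b = 0 := by
    have e0 := hBn 0
    have e1 := hBn 1
    have e2 := hBn 2
    simp only [dotProduct, Fin.sum_univ_three, hd, hskew 1 0, hskew 0 2, hskew 2 1] at e0 e1 e2
    ext i
    fin_cases i <;> simp [cross_apply, hb] <;> linarith
  have hb' := eq_smul_of_cross_eq_zero hn hbn
  set β := n ⬝ᵥ b
  have hBβ : B = β • crossRight 1 n := by
    have e0 : B 2 1 = β * n 0 := congrFun hb' 0
    have e1 : B 0 2 = β * n 1 := congrFun hb' 1
    have e2 : B 1 0 = β * n 2 := congrFun hb' 2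
    rw [crossRight_one]
    ext i j
    fin_cases i <;> fin_cases j <;>
      simp [hd, hskew 1 0, hskew 0 2, hskew 2 1, e0, e1, e2]
  have hzero : crossRight (A + (-β) • (1 : Mat)) n = 0 := by
    rw [crossRight_add, crossRight_smul, ← hB, hBβ, neg_smul, add_neg_cancel]
  have hrow : ∀ i, (A + (-β) • (1 : Mat)) i = (n ⬝ᵥ (A + (-β) • (1 : Mat)) i) • n := fun i => by
    refine eq_smul_of_cross_eq_zero hn ?_
    rw [← cross_anticomm, ← crossRight_apply, hzero, neg_eq_zero]
    rfl
  have hβ : 1 / 2 * (n ⬝ᵥ A *ᵥ n) = -β := by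
    have e0 := congrFun (hrow 0) 0
    have e1 := congrFun (hrow 1) 1
    have e2 := congrFun (hrow 2) 2
    simp only [Matrix.add_apply, Matrix.smul_apply, Pi.smul_apply, dotProduct, Fin.sum_univ_three,
      smul_eq_mul, Matrix.one_apply] at e0 e1 e2
    simp [trace, Fin.sum_univ_three] at htr
    simp [dotProduct, Fin.sum_univ_three, mulVec] at e0 e1 e2 hn ⊢
    linear_combination (1 / 2 : ℝ) * htr - (1 / 2 : ℝ) * (e0 + e1 + e2) + (β / 2) * hn
  rw [hβ, hzero]

/-! ### Traces -/

/-- The traces of the `div div` operator vanish. -/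
structure ZeroTrace (K : Tetrahedron) (n : Fin 4 → Vec) (τ : PolyMat) : Prop where
  face : ∀ i, ∀ x ∈ flat K {i}, eval x (bilin (n i) τ (n i)) = 0
  edge : ∀ i j, i ≠ j → ∀ x ∈ flat K {i, j}, eval x (bilin (n i) τ (n j)) = 0
  shear : ∀ i, ∀ x ∈ flat K {i}, eval x (shearTrace (n i) τ) = 0

lemma dirDeriv_bilin (a n : Vec) (τ : PolyMat) (b : Vec) :
    dirDeriv n (bilin a τ b) = ∑ i, a i • dirDeriv n (mulConst τ b i) := by
  simp only [dirDeriv, bilin, map_sum, Derivation.map_smul, Finset.smul_sum]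
  rw [Finset.sum_comm]
  exact Finset.sum_congr rfl fun i _ => Finset.sum_congr rfl fun j _ => smul_comm _ _ _

/-- Since n is constant, the normal part subtracted in the surface divergence of τn is ∂_n(nᵀτn). -/
lemma shearTrace_eq (n : Vec) (τ : PolyMat) :
    shearTrace n τ = 2 * divVec (mulConst τ n) - dirDeriv n (bilin n τ n) := by
  rw [shearTrace, surfDiv, Finset.sum_sub_distrib, ← dirDeriv_bilin, divVec]
  ring

lemma bilin_symCurl (a b : Vec) (σ : PolyMat) :
    (2 : ℝ) • bilin a (symCurl σ) b = bilin a (curlMat σ) b + bilin b (curlMat σ) a := by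
  simp only [bilin, mulConst, symCurl_apply, Finset.smul_sum]
  rw [Finset.sum_comm (f := fun i j => b i • a j • curlMat σ i j), ← Finset.sum_add_distrib]
  refine Finset.sum_congr rfl fun i _ => ?_
  rw [← Finset.sum_add_distrib]
  refine Finset.sum_congr rfl fun j _ => ?_
  rw [smul_comm (b j) (a i), ← smul_add, ← smul_add, smul_comm (2 : ℝ), smul_comm (2 : ℝ),
    smul_smul (2 : ℝ)]
  norm_num

/-- The transposed half of the sym curl contributes a combination of rows of a curl, which is
divergence-free. -/
lemma shearTrace_symCurl (n : Vec) (σ : PolyMat) :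
    shearTrace n (symCurl σ) =
      divVec (mulConst (curlMat σ) n) - dirDeriv n (bilin n (curlMat σ) n) := by
  have h1 : bilin n (symCurl σ) n = bilin n (curlMat σ) n := by
    have h := bilin_symCurl n n σ
    rw [← two_smul ℝ] at h
    exact smul_right_injective _ (two_ne_zero (α := ℝ)) h
  have h2 : 2 * divVec (mulConst (symCurl σ) n) = divVec (mulConst (curlMat σ) n) := by
    have h3 : ∀ i, (2 : ℝ) • mulConst (symCurl σ) n i =
        mulConst (curlMat σ) n i + ∑ j, n j • curlMat σ j i := by
      intro i
      simp only [mulConst, symCurl_apply, Finset.smul_sum]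
      rw [← Finset.sum_add_distrib]
      refine Finset.sum_congr rfl fun j _ => ?_
      rw [← smul_add, smul_comm (2 : ℝ), smul_smul (2 : ℝ)]
      norm_num
    have h4 : ∑ i, pderiv i (∑ j, n j • curlMat σ j i) = 0 := by
      simp only [map_sum, Derivation.map_smul]
      rw [Finset.sum_comm]
      refine Finset.sum_eq_zero fun j _ => ?_
      rw [← Finset.smul_sum, show ∑ i, pderiv i (curlMat σ j i) = 0 from divVec_curlVec (σ j),
        smul_zero]
    have h5 : ∀ p : Poly, 2 * p = (2 : ℝ) • p := fun p => by
      rw [smul_eq_C_mul, show (C 2 : Poly) = 2 from map_ofNat C 2]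
    rw [h5, divVec, Finset.smul_sum]
    simp only [← Derivation.map_smul, h3, map_add, Finset.sum_add_distrib]
    rw [h4, add_zero, divVec]
  rw [shearTrace_eq, h1, h2]

lemma eval_bilin (a b : Vec) (τ : PolyMat) (x : Vec) :
    eval x (bilin a τ b) = a ⬝ᵥ evalVec (mulConst τ b) x := by
  simp [bilin, dotProduct, evalVec, smul_eval]

/-- The cross product of a constant vector with a polynomial vector field. -/
def crossConst (n : Vec) (U : Fin 3 → Poly) : Fin 3 → Poly := (fun a => C (n a)) ⨯₃ U

lemma evalVec_crossConst (n : Vec) (U : Fin 3 → Poly) (x : Vec) :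
    evalVec (crossConst n U) x = n ⨯₃ evalVec U x := by
  ext a
  fin_cases a <;> simp [evalVec, crossConst, cross_apply]

lemma polyLE_crossConst {m : ℕ} {n : Vec} {U : Fin 3 → Poly} (h : ∀ a, U a ∈ PolyLE m)
    (a : Fin 3) : crossConst n U a ∈ PolyLE m := by
  fin_cases a <;> exact sub_mem (polyLE_C_mul _ (h _)) (polyLE_C_mul _ (h _))

/-- From curl (n × U) = n div U - (n·∇)U: the surface rotation of the rotated field is the surface
divergence. -/
lemma dotProduct_curlVec_crossConst {n : Vec} (hn : n ⬝ᵥ n = 1) (U : Fin 3 → Poly) (x : Vec) :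
    n ⬝ᵥ evalVec (curlVec (crossConst n U)) x =
      eval x (divVec U) - eval x (dirDeriv n (∑ i, n i • U i)) := by
  have h : eval x (divVec U) = (n ⬝ᵥ n) * eval x (divVec U) := by rw [hn, one_mul]
  rw [h]
  simp only [divVec, dirDeriv, dotProduct, Fin.sum_univ_three, evalVec, curlVec_apply_zero,
    curlVec_apply_one, curlVec_apply_two, crossConst, cross_apply, Matrix.cons_val_zero,
    Matrix.cons_val_one, Matrix.cons_val, map_sub, map_add, pderiv_C_mul, map_mul, eval_C,
    Derivation.map_smul, smul_eval]
  ring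

/-! ### Derivatives along faces and edges -/

/-- A choice of unit normal vectors of all faces. -/
abbrev IsFaceNormals (K : Tetrahedron) (n : Fin 4 → Vec) : Prop := ∀ i, IsUnitFaceNormal K i (n i)

lemma IsFaceNormals.cov_dotProduct_eq_zero {K : Tetrahedron} {n : Fin 4 → Vec}
    (hn : IsFaceNormals K n) {i : Fin 4} {w : Vec} : cov K i ⬝ᵥ w = 0 ↔ n i ⬝ᵥ w = 0 := by
  obtain ⟨c, hc0, hc⟩ := (hn i).exists_cov_eq
  rw [hc, smul_dotProduct, smul_eq_mul, mul_eq_zero, or_iff_right hc0]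

lemma IsFaceNormals.mem_flat_iff {K : Tetrahedron} {n : Fin 4 → Vec}
    (hn : IsFaceNormals K n) {i a : Fin 4} (ha : a ≠ i) {x : Vec} :
    n i ⬝ᵥ x = n i ⬝ᵥ K.points a ↔ x ∈ flat K {i} := by
  rw [← sub_eq_zero, ← dotProduct_sub, ← hn.cov_dotProduct_eq_zero, cov_dotProduct_sub,
    eval_bary_point, if_neg ha.symm, sub_zero, mem_flat_singleton]

lemma IsFaceNormals.add_smul_cross_mem {K : Tetrahedron} {n : Fin 4 → Vec}
    (hn : IsFaceNormals K n) {i j : Fin 4} {x : Vec} (hx : x ∈ flat K {i, j}) (s : ℝ) :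
    x + s • (n i ⨯₃ n j) ∈ flat K {i, j} := by
  rw [mem_flat_pair] at *
  rw [eval_add_bary, eval_add_bary, hx.1, hx.2, zero_add, zero_add, hn.cov_dotProduct_eq_zero,
    hn.cov_dotProduct_eq_zero]
  simp

lemma exists_ne_ne (i j : Fin 4) : ∃ k, k ≠ i ∧ k ≠ j := by
  revert i j
  decide

lemma exists_ne_ne_ne (i j k : Fin 4) : ∃ l, l ≠ i ∧ l ≠ j ∧ l ≠ k := by
  revert i j k
  decide

lemma IsFaceNormals.cross_ne_zero {K : Tetrahedron} {n : Fin 4 → Vec}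
    (hn : IsFaceNormals K n) {i j : Fin 4} (hij : i ≠ j) : n i ⨯₃ n j ≠ 0 := by
  intro h
  obtain ⟨c, -, hc⟩ := (hn i).exists_cov_eq
  obtain ⟨d, -, hd⟩ := (hn j).exists_cov_eq
  obtain ⟨k, hki, hkj⟩ := exists_ne_ne i j
  -- Binet–Cauchy with the dual edge vectors gives 1, so the two coordinate gradients are
  -- independent.
  have h1 := cross_dot_cross (cov K i) (cov K j) (K.points i - K.points k)
    (K.points j - K.points k)
  have h2 : cov K i ⨯₃ cov K j = 0 := by
    rw [hc, hd, map_smul, LinearMap.map_smul₂, h]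
    simp
  rw [h2] at h1
  simp only [cov_dotProduct_points] at h1
  simp [hki.symm, hkj.symm, hij, hij.symm] at h1

lemma eq_smul_cross {u v w : Vec} (h : u ⨯₃ v ≠ 0) (hu : u ⬝ᵥ w = 0) (hv : v ⬝ᵥ w = 0) :
    ∃ c : ℝ, w = c • (u ⨯₃ v) := by
  set N := u ⨯₃ v with hN
  have hN0 : N ⬝ᵥ N ≠ 0 := fun h' => h (dotProduct_self_eq_zero.1 h')
  have h1 : w ⨯₃ N = 0 := by
    rw [hN, cross_cross_eq_smul_sub_smul', dotProduct_comm w, hv, hu]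
    simp
  have h2 := cross_cross_eq_smul_sub_smul' N w N
  rw [h1, map_zero, eq_comm, sub_eq_zero] at h2
  refine ⟨(N ⬝ᵥ N)⁻¹ * (N ⬝ᵥ w), ?_⟩
  rw [mul_smul, dotProduct_comm N w, ← h2, smul_smul, inv_mul_cancel₀ hN0, one_smul]

/-- Two independent normals of a direction span all of its normals. -/
lemma exists_eq_add_of_cross_ne_zero {u v t w : Vec} (h : u ⨯₃ v ≠ 0) (ht : t ≠ 0)
    (hu : u ⬝ᵥ t = 0) (hv : v ⬝ᵥ t = 0) (hw : w ⬝ᵥ t = 0) : ∃ a b : ℝ, w = a • u + b • v := by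
  obtain ⟨c, rfl⟩ := eq_smul_cross h hu hv
  set N := u ⨯₃ v with hN
  have hN0 : N ⬝ᵥ N ≠ 0 := fun h' => h (dotProduct_self_eq_zero.1 h')
  have hwN : N ⬝ᵥ w = 0 := by
    rw [dotProduct_smul, smul_eq_mul, mul_eq_zero, dotProduct_comm] at hw
    exact hw.resolve_left fun hc => ht (by rw [hc, zero_smul])
  have h1 := cross_cross_eq_smul_sub_smul' N N w
  rw [hwN, zero_smul, zero_sub, hN, cross_cross_eq_smul_sub_smul, ← hN] at h1
  have h2 : w = (-(N ⬝ᵥ N)⁻¹) • (-((N ⬝ᵥ N) • w)) := by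
    rw [smul_neg, neg_smul, neg_neg, smul_smul, inv_mul_cancel₀ hN0, one_smul]
  rw [← h1] at h2
  refine ⟨-(N ⬝ᵥ N)⁻¹ * -(v ⬝ᵥ (N ⨯₃ w)), -(N ⬝ᵥ N)⁻¹ * (u ⬝ᵥ (N ⨯₃ w)), h2.trans ?_⟩
  module

lemma IsFaceNormals.exists_eq_smul_cross {K : Tetrahedron} {n : Fin 4 → Vec}
    (hn : IsFaceNormals K n) {i j : Fin 4} (hij : i ≠ j) {w : Vec} (hi : n i ⬝ᵥ w = 0)
    (hj : n j ⬝ᵥ w = 0) : ∃ c : ℝ, w = c • (n i ⨯₃ n j) :=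
  eq_smul_cross (hn.cross_ne_zero hij) hi hj

/-- A polynomial whose derivative along an edge line vanishes is constant on the line. -/
lemma IsFaceNormals.eval_eq_of_gradAt {K : Tetrahedron} {n : Fin 4 → Vec}
    (hn : IsFaceNormals K n) {i j : Fin 4} (hij : i ≠ j) {p : Poly}
    (hp : ∀ x ∈ flat K {i, j}, (n i ⨯₃ n j) ⬝ᵥ gradAt p x = 0) {x y : Vec}
    (hx : x ∈ flat K {i, j}) (hy : y ∈ flat K {i, j}) : eval x p = eval y p := by
  have hd : ∀ i, eval x (bary K i) = 0 → eval y (bary K i) = 0 → n i ⬝ᵥ (y - x) = 0 := by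
    intro i h1 h2
    rw [← hn.cov_dotProduct_eq_zero, cov_dotProduct_sub, h1, h2, sub_zero]
  rw [mem_flat_pair] at hx hy
  obtain ⟨c, hc⟩ := hn.exists_eq_smul_cross hij (hd i hx.1 hy.1) (hd j hx.2 hy.2)
  have h0 : Polynomial.derivative (linePoly p x (n i ⨯₃ n j)) = 0 := by
    apply Polynomial.funext
    intro s
    rw [derivative_linePoly, eval_linePoly, Polynomial.eval_zero,
      ← hp _ (hn.add_smul_cross_mem (mem_flat_pair.2 hx) s), map_sum]
    simp only [dotProduct, gradAt, smul_eval]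
  have h1 := Polynomial.eq_C_of_derivative_eq_zero h0
  have e0 := eval_linePoly p x (n i ⨯₃ n j) 0
  have e1 := eval_linePoly p x (n i ⨯₃ n j) c
  rw [h1, Polynomial.eval_C] at e0 e1
  rw [zero_smul, add_zero] at e0
  rw [← hc, add_sub_cancel] at e1
  rw [← e0, ← e1]

lemma IsFaceNormals.gradAt_dotProduct_eq_zero {K : Tetrahedron} {n : Fin 4 → Vec}
    (hn : IsFaceNormals K n) {i j : Fin 4} {p : Poly}
    (hp : ∀ x ∈ flat K {i, j}, eval x p = 0) {x : Vec} (hx : x ∈ flat K {i, j}) :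
    (n i ⨯₃ n j) ⬝ᵥ gradAt p x = 0 := by
  have h0 : linePoly p x (n i ⨯₃ n j) = 0 := by
    apply Polynomial.funext
    intro s
    rw [eval_linePoly, Polynomial.eval_zero, hp _ (hn.add_smul_cross_mem hx s)]
  have h1 := derivative_linePoly p x (n i ⨯₃ n j)
  rw [h0, Polynomial.derivative_zero] at h1
  have h2 := eval_linePoly (∑ a, (n i ⨯₃ n j) a • pderiv a p) x (n i ⨯₃ n j) 0
  rw [← h1, Polynomial.eval_zero, zero_smul, add_zero, map_sum] at h2
  rw [h2]
  simp only [dotProduct, gradAt, smul_eval]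

lemma gradAt_sub (p q : Poly) (x : Vec) : gradAt (p - q) x = gradAt p x - gradAt q x := by
  ext a; simp [gradAt]

lemma gradAt_mul (p q : Poly) (x : Vec) :
    gradAt (p * q) x = eval x p • gradAt q x + eval x q • gradAt p x := by
  ext a; simp [gradAt]

lemma gradAt_bary (K : Tetrahedron) (i : Fin 4) (x : Vec) : gradAt (bary K i) x = cov K i := by
  ext a; simp [gradAt, pderiv_bary]

lemma dotProduct_gradAt (w : Vec) (p : Poly) (x : Vec) :
    w ⬝ᵥ gradAt p x = eval x (dirDeriv w p) := by
  simp [dotProduct, gradAt, dirDeriv, smul_eval]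

/-- The gradient of a polynomial that vanishes on a face plane is normal to it. -/
lemma gradAt_eq_of_plane {K : Tetrahedron} {i : Fin 4} {p : Poly}
    (hp : ∀ x ∈ flat K {i}, eval x p = 0) :
    ∃ r : Poly, ∀ x ∈ flat K {i}, gradAt p x = eval x r • cov K i := by
  obtain ⟨r, rfl⟩ := exists_eq_bary_mul_of_plane hp
  refine ⟨r, fun x hx => ?_⟩
  rw [gradAt_mul, gradAt_bary, mem_flat_singleton.1 hx, zero_smul, zero_add]

/-! ### Potentials of face-wise closed one-forms -/

/-- One-forms on the face planes that are tangentially closed and agree tangentially on the edges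
have a common potential. -/
lemma IsFaceNormals.exists_potential {K : Tetrahedron} {n : Fin 4 → Vec}
    (hn : IsFaceNormals K n) {m : ℕ} {ω : Fin 4 → Fin 3 → Poly}
    (hω : ∀ i a, ω i a ∈ PolyLE (m + 2))
    (hclosed : ∀ i, ∀ x ∈ flat K {i}, n i ⬝ᵥ evalVec (curlVec (ω i)) x = 0)
    (hcompat : ∀ i j, i ≠ j → ∀ x ∈ flat K {i, j},
      (n i ⨯₃ n j) ⬝ᵥ (evalVec (ω i) x - evalVec (ω j) x) = 0) :
    ∃ f ∈ PolyLE (m + 3), ∀ i, ∀ x ∈ flat K {i}, n i ⨯₃ (gradAt f x - evalVec (ω i) x) = 0 := by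
  have hface : ∀ i, ∃ g ∈ PolyLE (m + 3), ∀ x ∈ flat K {i},
      n i ⨯₃ (gradAt g x - evalVec (ω i) x) = 0 := by
    intro i
    obtain ⟨a, ha⟩ := exists_ne i
    obtain ⟨g, hg, h⟩ := exists_gradAt_of_plane (hω i) (n i) (K.points a)
      (fun x hx => hclosed i x ((hn.mem_flat_iff ha).1 hx))
    exact ⟨g, hg, fun x hx => h x ((hn.mem_flat_iff ha).2 hx)⟩
  choose g hg hgx using hface
  have hleft : ∀ i j x, x ∈ flat K {i} →
      (n i ⨯₃ n j) ⬝ᵥ (gradAt (g i) x - evalVec (ω i) x) = 0 := by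
    intro i j x hx
    rw [dotProduct_comm, triple_product_permutation, triple_product_permutation,
      ← cross_anticomm, hgx i x hx, neg_zero, dotProduct_zero]
  have hconst : ∀ i j, i ≠ j → ∀ x y, x ∈ flat K {i, j} → y ∈ flat K {i, j} →
      eval x (g i) - eval x (g j) = eval y (g i) - eval y (g j) := by
    intro i j hij x y hx hy
    rw [← map_sub, ← map_sub]
    refine hn.eval_eq_of_gradAt hij (fun z hz => ?_) hx hy
    have hz' := mem_flat_pair.1 hz
    have h1 := hleft i j z (mem_flat_singleton.2 hz'.1)
    have h2 := hleft j i z (mem_flat_singleton.2 hz'.2)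
    have h3 := hcompat i j hij z hz
    rw [← cross_anticomm, neg_dotProduct, neg_eq_zero] at h2
    rw [dotProduct_sub] at h1 h2 h3
    rw [gradAt_sub, dotProduct_sub]
    linarith
  have hp : ∀ i : Fin 4, ∃ p : Fin 4, p ≠ 0 ∧ p ≠ i := by decide
  choose p hp0 hpi using hp
  -- The vertex p i lies on the common edge of faces 0 and i. Subtracting a constant makes each
  -- potential agree with that of face 0 along this edge.
  let g' : Fin 4 → Poly := fun i =>
    g i - C (eval (K.points (p i)) (g i) - eval (K.points (p i)) (g 0))
  have hg'0 : ∀ i, ∀ x ∈ flat K {0, i}, eval x (g' i) = eval x (g 0) := by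
    intro i x hx
    rw [map_sub, eval_C]
    rcases eq_or_ne 0 i with rfl | hi
    · ring
    · have h1 := hconst 0 i hi x (K.points (p i)) hx
        (point_mem_flat K (by simp [hp0 i, hpi i]))
      linarith
  obtain ⟨f, hf, hfx⟩ := exists_patch K (f := g') (m := m)
    (fun i => sub_mem (hg i) (polyLE_C _ _)) (by
      intro i j hij x hx
      -- Along the common edge of faces i and j the potentials differ by a constant. It is zero
      -- because vertex k lies on face 0 as well, where both agree with the potential of face 0.
      obtain ⟨k, hk0, hki, hkj⟩ := exists_ne_ne_ne 0 i j
      have h1 := hconst i j hij x (K.points k) hx (point_mem_flat K (by simp [hki, hkj]))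
      have h2 := hg'0 i (K.points k) (point_mem_flat K (by simp [hki, hk0]))
      have h3 := hg'0 j (K.points k) (point_mem_flat K (by simp [hkj, hk0]))
      simp only [g', map_sub, eval_C] at h2 h3 ⊢
      linarith)
  refine ⟨f, hf, fun i x hx => ?_⟩
  obtain ⟨r, hr⟩ := gradAt_eq_of_plane (K := K) (i := i) (p := f - g' i) (by
    intro y hy
    rw [map_sub, hfx i y hy, sub_self])
  obtain ⟨c, -, hc⟩ := (hn i).exists_cov_eq
  have h1 : gradAt f x - evalVec (ω i) x =
      (gradAt (g i) x - evalVec (ω i) x) + (eval x r * c) • n i := by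
    rw [mul_smul, ← hc, ← hr x hx, gradAt_sub, gradAt_sub]
    have : gradAt (C (eval (K.points (p i)) (g i) - eval (K.points (p i)) (g 0))) x = 0 := by
      ext a; simp [gradAt]
    rw [this]
    abel
  rw [h1, map_add, hgx i x hx, map_smul, cross_self, smul_zero, add_zero]

/-! ### Exactness of the bubble complex -/

lemma convex_flat (K : Tetrahedron) (Z : Finset (Fin 4)) : Convex ℝ (flat K Z) := by
  intro x hx y hy a b ha hb hab z hz
  have h : a • x + b • y = x + b • (y - x) := by
    rw [← eq_sub_iff_add_eq] at hab
    rw [hab, smul_sub, sub_smul, one_smul]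
    abel
  rw [h, eval_add_bary, dotProduct_smul, cov_dotProduct_sub, hx z hz, hy z hz]
  simp

lemma face_subset_flat (K : Tetrahedron) (i : Fin 4) : face K i ⊆ flat K {i} := by
  refine convexHull_min ?_ (convex_flat K _)
  rintro _ ⟨j, hj, rfl⟩
  exact point_mem_flat K (by simpa using hj)

lemma cell_subset_face (K : Tetrahedron) (i : Fin 4) : cell K {i} ⊆ face K i := by
  intro x hx
  have hxi := mem_flat_singleton.1 hx.1
  have h1 : ∑ j ∈ Finset.univ.erase i, eval x (bary K j) = 1 := by
    rw [← sum_eval_bary K x]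
    exact Finset.sum_erase _ hxi
  have h2 : ∑ j ∈ Finset.univ.erase i, eval x (bary K j) • K.points j = x := by
    conv_rhs => rw [← sum_eval_bary_smul K x]
    exact Finset.sum_erase _ (by rw [hxi, zero_smul])
  rw [← h2]
  refine (convex_convexHull ℝ _).sum_mem
    (fun j hj => (hx.2 j (by simpa using Finset.ne_of_mem_erase hj)).le) h1 fun j hj => ?_
  exact subset_convexHull _ _ ⟨j, by simpa using Finset.ne_of_mem_erase hj, rfl⟩

lemma eval_eq_zero_of_face {K : Tetrahedron} {i : Fin 4} {p : Poly}
    (hp : ∀ x ∈ face K i, eval x p = 0) : ∀ x ∈ flat K {i}, eval x p = 0 := by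
  obtain ⟨j, hj⟩ := exists_ne i
  exact eval_eq_zero_of_cell ⟨j, by simpa using hj⟩ fun x hx => hp x (cell_subset_face K i hx)

lemma evalVec_mulConst_curlMat (σ : PolyMat) (n : Vec) (x : Vec) (a : Fin 3) :
    evalVec (mulConst (curlMat σ) n) x a = n ⬝ᵥ evalVec (curlVec (σ a)) x := by
  simp [evalVec, mulConst, dotProduct, smul_eval, curlMat]

/-- Adding C' times the identity adds C' e_a to row a, and n·(∇C' × e_a) is the a-th component of n
× ∇C'. -/
lemma dotProduct_curlVec_row (σ : PolyMat) (C' : Poly) (n x : Vec) (a : Fin 3) :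
    n ⬝ᵥ evalVec (curlVec ((σ + C' • (1 : PolyMat)) a)) x =
      evalVec (mulConst (curlMat σ) n) x a + (n ⨯₃ gradAt C' x) a := by
  have h0 : ∀ b, (σ + C' • (1 : PolyMat)) a b = σ a b + if a = b then C' else 0 := by
    intro b
    rw [Matrix.add_apply, Matrix.smul_apply, Matrix.one_apply, smul_ite, smul_zero, smul_eq_mul,
      mul_one]
  rw [evalVec_mulConst_curlMat]
  simp only [dotProduct, Fin.sum_univ_three, evalVec, curlVec_apply_zero, curlVec_apply_one,
    curlVec_apply_two, h0, map_sub, map_add, cross_apply, gradAt]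
  fin_cases a <;> simp <;> ring

/-- A one-form with vanishing tangential part on a face plane is tangentially closed there. -/
lemma IsFaceNormals.dotProduct_curlVec_eq_zero {K : Tetrahedron} {n : Fin 4 → Vec}
    (hn : IsFaceNormals K n) {i : Fin 4} {ω : Fin 3 → Poly}
    (h : ∀ x ∈ flat K {i}, n i ⨯₃ evalVec ω x = 0) {x : Vec} (hx : x ∈ flat K {i}) :
    n i ⬝ᵥ evalVec (curlVec ω) x = 0 := by
  have h1 : ∀ a, ∃ r : Poly, ∀ x ∈ flat K {i},
      gradAt (crossConst (n i) ω a) x = eval x r • cov K i := fun a =>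
    gradAt_eq_of_plane fun y hy => congrFun ((evalVec_crossConst (n i) ω y).trans (h y hy)) a
  choose r hr using h1
  obtain ⟨c, hc0, hc⟩ := (hn i).exists_cov_eq
  set ρ : Vec := fun a => eval x (r a) with hρ
  have hr' : ∀ a b, eval x (pderiv b (crossConst (n i) ω a)) = ρ a * (c * n i b) := by
    intro a b
    have := congrFun (hr a x hx) b
    rw [hc] at this
    exact this
  have hnc : ∑ a, C (n i a) * crossConst (n i) ω a = 0 := dot_self_cross _ _
  -- The components of n × ω vanish on the plane, so their gradients are normal with coefficients ρ.
  -- Differentiating n·(n × ω) = 0 gives n·ρ = 0, while n·curl ω = -div (n × ω) is a multiple of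
  -- n·ρ.
  have h2 : (n i ⬝ᵥ ρ) = 0 := by
    have h3 : ∀ b, (n i ⬝ᵥ ρ) * (c * n i b) = 0 := by
      intro b
      have h4 := congrArg (fun p => eval x (pderiv b p)) hnc
      simp only [map_sum, pderiv_C_mul, map_mul, eval_C, hr', map_zero] at h4
      rw [dotProduct, Finset.sum_mul, ← h4]
      exact Finset.sum_congr rfl fun a _ => by ring
    have h5 := (hn i).1
    have h6 : (n i ⬝ᵥ ρ) * c * (n i ⬝ᵥ n i) = 0 := by
      simp only [dotProduct, Fin.sum_univ_three] at h3 ⊢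
      linear_combination n i 0 * h3 0 + n i 1 * h3 1 + n i 2 * h3 2
    rw [h5, mul_one] at h6
    exact (mul_eq_zero.1 h6).resolve_right hc0
  have h3 : n i ⬝ᵥ evalVec (curlVec ω) x =
      -∑ a, eval x (pderiv a (crossConst (n i) ω a)) := by
    simp only [Fin.sum_univ_three, evalVec, curlVec_apply_zero, curlVec_apply_one, dotProduct,
      curlVec_apply_two, crossConst, cross_apply, Matrix.cons_val_zero, Matrix.cons_val_one,
      Matrix.cons_val, map_sub, pderiv_C_mul, map_mul, eval_C]
    ring
  rw [h3, neg_eq_zero]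
  simp only [hr']
  rw [dotProduct] at h2
  rw [← mul_zero c, ← h2, Finset.mul_sum]
  exact Finset.sum_congr rfl fun a _ => by ring

lemma eval_bilin_symCurl (a b : Vec) (σ : PolyMat) (x : Vec) :
    2 * eval x (bilin a (symCurl σ) b) = a ⬝ᵥ evalVec (mulConst (curlMat σ) b) x +
      b ⬝ᵥ evalVec (mulConst (curlMat σ) a) x := by
  rw [← eval_bilin, ← eval_bilin, ← map_add, ← bilin_symCurl, smul_eval]

/-- A vanishing shear trace of sym curl σ thereby means that the one-form n × (curl σ)n is
tangentially closed on the face. -/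
lemma eval_shearTrace_symCurl {n : Vec} (hn : n ⬝ᵥ n = 1) (σ : PolyMat) (x : Vec) :
    eval x (shearTrace n (symCurl σ)) =
      n ⬝ᵥ evalVec (curlVec (crossConst n (mulConst (curlMat σ) n))) x := by
  rw [dotProduct_curlVec_crossConst hn, shearTrace_symCurl, map_sub]
  rfl

lemma cross_dotProduct_eq_zero {n u v : Vec} (h : n ⨯₃ v = 0) : (n ⨯₃ u) ⬝ᵥ v = 0 := by
  rw [dotProduct_comm, triple_product_permutation, triple_product_permutation,
    ← cross_anticomm, h, neg_zero, dotProduct_zero]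

/-- Potentials of trace-free tensor fields whose symmetric curl has vanishing traces can be chosen
in the bubble space. -/
theorem symCurl_mem_symCurlBubble {K : Tetrahedron} {n : Fin 4 → Vec} (hn : IsFaceNormals K n)
    {m : ℕ} {σ : PolyMat} (hσ : σ ∈ traceFree (m + 3)) (h : ZeroTrace K n (symCurl σ)) :
    symCurl σ ∈ symCurlBubble K n (m + 3) := by
  have hUm : ∀ i a, mulConst (curlMat σ) (n i) a ∈ PolyLE (m + 2) := fun i a =>
    Submodule.sum_mem _ fun j _ => Submodule.smul_mem _ _ (polyLE_curlVec (hσ.1 a) j)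
  set U : Fin 4 → Vec → Vec := fun i x => evalVec (mulConst (curlMat σ) (n i)) x with hU
  have hnU : ∀ i, ∀ x ∈ flat K {i}, n i ⬝ᵥ U i x = 0 := by
    intro i x hx
    have h1 := eval_bilin_symCurl (n i) (n i) σ x
    rw [h.face i x hx] at h1
    linarith
  -- The shear trace supplies closedness of n_i × U_i. On an edge, the difference of the two forms
  -- paired with n_i × n_j is n_j·U_i + n_i·U_j, twice the edge trace.
  obtain ⟨c, hc, hcx⟩ := hn.exists_potential (ω := fun i => crossConst (n i)
    (mulConst (curlMat σ) (n i))) (fun i => polyLE_crossConst (hUm i))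
    (fun i x hx => by rw [← eval_shearTrace_symCurl (hn i).1, h.shear i x hx]) (by
      intro i j hij x hx
      have hx' := mem_flat_pair.1 hx
      have hi := hnU i x (mem_flat_singleton.2 hx'.1)
      have hj := hnU j x (mem_flat_singleton.2 hx'.2)
      have h1 := eval_bilin_symCurl (n i) (n j) σ x
      rw [h.edge i j hij x hx] at h1
      rw [evalVec_crossConst, evalVec_crossConst, dotProduct_sub, cross_dot_cross, cross_dot_cross,
        (hn i).1, (hn j).1]
      simp only [hU] at hi hj
      rw [hi, hj]
      linarith)
  -- On face i the normal curl of the rows of σ + cI is U_i + n_i × ∇c = U_i + n_i × (n_i × U_i) =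
  -- 0. Edge compatibility is trivial because every face uses the same form.
  have hrow : ∀ a, ∃ v ∈ PolyLE (m + 4), ∀ i, ∀ x ∈ flat K {i},
      n i ⨯₃ (gradAt v x - evalVec ((σ + c • (1 : PolyMat)) a) x) = 0 := by
    intro a
    refine hn.exists_potential (m := m + 1) (ω := fun _ => (σ + c • (1 : PolyMat)) a)
      (fun i b => ?_) (fun i x hx => ?_) (fun i j _ x _ => by rw [sub_self, dotProduct_zero])
    · rw [Matrix.add_apply, Matrix.smul_apply, Matrix.one_apply]
      refine add_mem (hσ.1 a b) ?_
      split_ifs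
      · rwa [smul_eq_mul, mul_one]
      · rw [smul_zero]; exact zero_mem _
    · have h1 := hcx i x hx
      rw [evalVec_crossConst, map_sub, sub_eq_zero, cross_cross_eq_smul_sub_smul', hnU i x hx,
        (hn i).1, zero_smul, one_smul, zero_sub] at h1
      rw [dotProduct_curlVec_row, h1, Pi.neg_apply, add_neg_cancel]
  choose v hv hvx using hrow
  set G : PolyMat := Matrix.of fun a b => pderiv b (v a) with hG
  have hGm : ∀ a b, G a b ∈ PolyLE (m + 3) := fun a b => polyLE_pderiv b (hv a)
  have htr : G.trace ∈ PolyLE (m + 3) := Submodule.sum_mem _ fun i _ => hGm i i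
  set t : Poly := (1 / 3 : ℝ) • G.trace with ht
  have htm : t ∈ PolyLE (m + 3) := Submodule.smul_mem _ _ htr
  -- Subtracting the gradient rows G leaves on each face a multiple of the identity plus rows
  -- parallel to n_i. The term tI restores trace zero. Neither change affects the sym curl.
  refine ⟨σ - G + t • (1 : PolyMat), ⟨⟨fun i j => ?_, ?_⟩, fun i x hx => ?_⟩, ?_⟩
  · rw [Matrix.add_apply, Matrix.smul_apply, Matrix.one_apply]
    refine add_mem (sub_mem (hσ.1 i j) (hGm i j)) ?_
    split_ifs
    · rwa [smul_eq_mul, mul_one]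
    · rw [smul_zero]; exact zero_mem _
  · rw [trace_add, trace_sub, trace_smul, trace_one, Fintype.card_fin, hσ.2, ht, smul_eq_mul,
      smul_mul_assoc, Nat.cast_ofNat, mul_comm, ← show (C 3 : Poly) = 3 from map_ofNat C 3,
      ← smul_eq_C_mul, smul_smul]
    norm_num
  · refine traces_eq_zero_of_crossRight (c := eval x t - eval x c) ?_
    ext1 a
    rw [crossRight_apply]
    have h1 := hvx a i x (face_subset_flat K i hx)
    have h2 : (evalMat (σ - G + t • (1 : PolyMat)) x - (eval x t - eval x c) • (1 : Mat)) a =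
        -(gradAt (v a) x - evalVec ((σ + c • (1 : PolyMat)) a) x) := by
      ext b
      simp only [evalMat, gradAt, evalVec, Matrix.sub_apply, Matrix.add_apply, Matrix.smul_apply,
        Matrix.map_apply, map_add, map_sub, hG, of_apply, Pi.sub_apply, Pi.neg_apply,
        Matrix.one_apply, smul_eq_mul, map_mul]
      split_ifs
      · simp; ring
      · simp
    rw [h2, ← cross_anticomm, map_neg, h1, neg_zero, neg_zero]
    exact fun _ => rfl
  · rw [map_add, map_sub, symCurl_smul_one, hG, symCurl_grad, sub_zero, add_zero]

/-- The symmetric curl of a bubble function has vanishing traces. -/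
theorem zeroTrace_symCurl {K : Tetrahedron} {n : Fin 4 → Vec} (hn : IsFaceNormals K n)
    {m : ℕ} {σ : PolyMat} (hσ : σ ∈ bubble K n m) : ZeroTrace K n (symCurl σ) := by
  -- The multiple of the identity from `crossRight_eq_zero_of_traces`: on face i the rows of σ + c_i
  -- I have no tangential part. It depends on the face.
  set c : Fin 4 → Poly := fun i => (1 / 2 : ℝ) • bilin (n i) σ (n i) with hc
  have hrow : ∀ i, ∀ x ∈ flat K {i}, ∀ a,
      n i ⨯₃ evalVec ((σ + c i • (1 : PolyMat)) a) x = 0 := by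
    intro i x hx a
    rw [← evalVec_crossConst]
    ext b
    refine eval_eq_zero_of_face (fun y hy => ?_) x hx
    obtain ⟨h2, h1⟩ := hσ.2 i y hy
    have htr : (evalMat σ y).trace = 0 := by
      have := congrArg (eval y) hσ.1.2
      rw [map_zero] at this
      rw [← this]
      simp [trace, evalMat]
    have h3 := congrFun (crossRight_eq_zero_of_traces (hn i).1 htr h2 h1) a
    have h4 : (evalMat σ y + (1 / 2 * (n i ⬝ᵥ evalMat σ y *ᵥ n i)) • (1 : Mat)) a =
        evalVec ((σ + c i • (1 : PolyMat)) a) y := by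
      have h5 : eval y (c i) = 1 / 2 * (n i ⬝ᵥ evalMat σ y *ᵥ n i) := by
        rw [hc, smul_eval, eval_bilin]
        congr 2
        ext b
        simp [evalVec, mulConst, mulVec, dotProduct, evalMat, smul_eval, mul_comm]
      rw [← h5]
      ext b
      simp only [evalMat, evalVec, Matrix.add_apply, Matrix.smul_apply, Matrix.map_apply, map_add,
        Matrix.one_apply, smul_eq_mul, map_mul]
      split_ifs <;> simp
    rw [crossRight_apply, h4, ← cross_anticomm, ← evalVec_crossConst] at h3
    have h6 := congrFun h3 b
    rw [Pi.neg_apply, neg_eq_iff_eq_neg] at h6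
    refine h6.trans ?_
    simp
  set U : Fin 4 → Vec → Vec := fun i x => evalVec (mulConst (curlMat σ) (n i)) x with hU
  have hUx : ∀ i, ∀ x ∈ flat K {i}, U i x = -(n i ⨯₃ gradAt (c i) x) := by
    intro i x hx
    ext a
    have h1 := hn.dotProduct_curlVec_eq_zero (fun y hy => hrow i y hy a) hx
    rw [dotProduct_curlVec_row] at h1
    rw [Pi.neg_apply]
    exact eq_neg_of_add_eq_zero_left h1
  have hnU : ∀ i, ∀ x ∈ flat K {i}, n i ⬝ᵥ U i x = 0 := by
    intro i x hx
    rw [hUx i x hx, dotProduct_neg, dot_self_cross, neg_zero]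
  refine ⟨fun i x hx => ?_, fun i j hij x hx => ?_, fun i x hx => ?_⟩
  · have h1 := eval_bilin_symCurl (n i) (n i) σ x
    have h2 := hnU i x hx
    simp only [hU] at h2
    rw [h2] at h1
    linarith
  · have hx' := mem_flat_pair.1 hx
    have hxi := mem_flat_singleton.2 hx'.1
    have hxj := mem_flat_singleton.2 hx'.2
    -- The rows of σ + c_i I and of σ + c_j I both annihilate the edge direction t, so (c_i - c_j) t
    -- = 0.
    have hcc : ∀ y ∈ flat K {i, j}, eval y (c i - c j) = 0 := by
      intro y hy
      have hy' := mem_flat_pair.1 hy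
      obtain ⟨a, ha⟩ := Function.ne_iff.1 (hn.cross_ne_zero hij)
      have h1 := cross_dotProduct_eq_zero (u := n j)
        (hrow i y (mem_flat_singleton.2 hy'.1) a)
      have h2 := cross_dotProduct_eq_zero (u := n i)
        (hrow j y (mem_flat_singleton.2 hy'.2) a)
      rw [← cross_anticomm, neg_dotProduct, neg_eq_zero] at h2
      have h3 : ∀ C' : Poly, ∀ w : Vec, w ⬝ᵥ evalVec ((σ + C' • (1 : PolyMat)) a) y =
          w ⬝ᵥ evalVec (σ a) y + w a * eval y C' := by
        intro C' w
        have : evalVec ((σ + C' • (1 : PolyMat)) a) y =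
            evalVec (σ a) y + Pi.single a (eval y C') := by
          ext b
          simp only [evalVec, Matrix.add_apply, Matrix.smul_apply, map_add,
            Matrix.one_apply, smul_eq_mul, map_mul, Pi.add_apply, Pi.single_apply, @eq_comm _ b]
          split_ifs <;> simp
        rw [this, dotProduct_add, dotProduct_single]
      rw [h3] at h1 h2
      have h4 : (n i ⨯₃ n j) a * (eval y (c i) - eval y (c j)) = 0 := by linarith
      rw [map_sub]
      exact (mul_eq_zero.1 h4).resolve_left ha
    have h1 := eval_bilin_symCurl (n i) (n j) σ x
    have h2 := hUx i x hxi
    have h3 := hUx j x hxj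
    simp only [hU] at h2 h3
    rw [h2, h3, dotProduct_neg, dotProduct_neg] at h1
    have h4 := hn.gradAt_dotProduct_eq_zero hcc hx
    rw [gradAt_sub, dotProduct_sub] at h4
    have h5 : ∀ g : Vec, n i ⬝ᵥ n j ⨯₃ g = (n i ⨯₃ n j) ⬝ᵥ g := by
      intro g
      rw [dotProduct_comm _ g, triple_product_permutation, triple_product_permutation]
    have h6 : ∀ g : Vec, n j ⬝ᵥ n i ⨯₃ g = -((n i ⨯₃ n j) ⬝ᵥ g) := by
      intro g
      rw [← cross_anticomm (n j) (n i), neg_dotProduct, neg_neg, dotProduct_comm _ g,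
        triple_product_permutation, triple_product_permutation]
    rw [h5, h6] at h1
    linarith
  · rw [eval_shearTrace_symCurl (hn i).1]
    -- On the face U_i = -n_i × ∇c_i, so n_i × U_i is the tangential gradient of c_i. The difference
    -- has no tangential part, hence is closed, and the gradient drops out.
    have h1 := hn.dotProduct_curlVec_eq_zero (i := i)
      (ω := fun b => pderiv b (c i) - crossConst (n i) (mulConst (curlMat σ) (n i)) b) (by
        intro y hy
        have h2 := hUx i y hy
        simp only [hU] at h2
        have h3 : evalVec (fun b => pderiv b (c i) -
            crossConst (n i) (mulConst (curlMat σ) (n i)) b) y =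
            gradAt (c i) y - n i ⨯₃ evalVec (mulConst (curlMat σ) (n i)) y := by
          rw [← evalVec_crossConst]
          ext b
          simp [evalVec, gradAt]
        rw [h3, map_sub, h2, cross_cross_eq_smul_sub_smul', (hn i).1, dotProduct_neg,
          dot_self_cross]
        simp) hx
    have h4 : evalVec (curlVec fun b => pderiv b (c i) -
        crossConst (n i) (mulConst (curlMat σ) (n i)) b) x =
        -evalVec (curlVec (crossConst (n i) (mulConst (curlMat σ) (n i)))) x := by
      have h5 := curlVec_grad (c i)
      ext b
      have h6 := congrArg (eval x) (congrFun h5 b)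
      fin_cases b <;>
        simp only [Fin.zero_eta, Fin.mk_one, Fin.reduceFinMk, evalVec, curlVec_apply_zero,
          curlVec_apply_one, curlVec_apply_two, map_sub, Pi.neg_apply, Pi.zero_apply,
          map_zero] at h6 ⊢ <;> linarith
    rw [h4, dotProduct_neg, neg_eq_zero] at h1
    exact h1

/-! ### Integrals over simplices -/

/-- The corner simplex. -/
def corner (n : ℕ) : Set (Fin n → ℝ) := {y | (∀ i, 0 ≤ y i) ∧ ∑ i, y i ≤ 1}

lemma isClosed_corner (n : ℕ) : IsClosed (corner n) := by
  have : corner n = (⋂ i, {y : Fin n → ℝ | 0 ≤ y i}) ∩ {y | ∑ i, y i ≤ 1} := by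
    ext y; simp [corner]
  rw [this]
  refine (isClosed_iInter fun i => isClosed_le continuous_const (continuous_apply i)).inter
    (isClosed_le ?_ continuous_const)
  fun_prop

lemma isCompact_corner (n : ℕ) : IsCompact (corner n) := by
  refine (isCompact_Icc (a := (0 : Fin n → ℝ)) (b := 1)).of_isClosed_subset (isClosed_corner n) ?_
  rintro y ⟨h0, h1⟩
  exact ⟨h0, fun i => (Finset.single_le_sum (fun j _ => h0 j) (Finset.mem_univ i)).trans h1⟩

lemma measurableSet_corner (n : ℕ) : MeasurableSet (corner n) := (isClosed_corner n).measurableSet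

lemma insertNth_mem_corner {n : ℕ} (i : Fin (n + 1)) (u : ℝ) (y : Fin n → ℝ) :
    i.insertNth (α := fun _ => ℝ) u y ∈ corner (n + 1) ↔
      y ∈ corner n ∧ u ∈ Set.Icc 0 (1 - ∑ j, y j) := by
  simp only [corner, Set.mem_ofPred_eq, Fin.sum_univ_succAbove _ i, Fin.insertNth_apply_same,
    Fin.insertNth_apply_succAbove, Fin.forall_iff_succAbove i, Set.mem_Icc]
  constructor
  · rintro ⟨⟨h1, h2⟩, h3⟩
    exact ⟨⟨h2, by linarith⟩, h1, by linarith⟩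
  · rintro ⟨⟨h1, h2⟩, h3, h4⟩
    exact ⟨⟨h3, h1⟩, by linarith⟩

lemma integrableOn_corner {n : ℕ} {g : (Fin n → ℝ) → ℝ} (hg : Continuous g) :
    IntegrableOn g (corner n) :=
  hg.continuousOn.integrableOn_compact (isCompact_corner n)

lemma integral_corner_succ {n : ℕ} (i : Fin (n + 1)) {g : (Fin (n + 1) → ℝ) → ℝ}
    (hg : Continuous g) : ∫ x in corner (n + 1), g x =
      ∫ y in corner n, ∫ u in (0 : ℝ)..(1 - ∑ j, y j), g (i.insertNth (α := fun _ => ℝ) u y) := by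
  have hmp := (volume_preserving_piFinSuccAbove (fun _ : Fin (n + 1) => ℝ) i).symm
  rw [← integral_indicator (measurableSet_corner _), ← hmp.integral_comp',
    Measure.volume_eq_prod, integral_prod_symm]
  · rw [← integral_indicator (measurableSet_corner _)]
    refine integral_congr_ae (Filter.Eventually.of_forall fun y => ?_)
    simp only [MeasurableEquiv.piFinSuccAbove_symm_apply, Fin.insertNthEquiv, Equiv.coe_fn_mk]
    by_cases hy : y ∈ corner n
    · rw [Set.indicator_of_mem hy, intervalIntegral.integral_of_le (by have := hy.2; linarith),
        ← integral_Icc_eq_integral_Ioc, ← integral_indicator measurableSet_Icc]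
      congr 1
      ext u
      by_cases hu : u ∈ Set.Icc 0 (1 - ∑ j, y j)
      · rw [Set.indicator_of_mem hu,
          Set.indicator_of_mem ((insertNth_mem_corner i u y).2 ⟨hy, hu⟩)]
      · rw [Set.indicator_of_notMem hu,
          Set.indicator_of_notMem fun h => hu ((insertNth_mem_corner i u y).1 h).2]
    · rw [Set.indicator_of_notMem hy, ← integral_zero ℝ ℝ]
      congr 1
      ext u
      rw [Set.indicator_of_notMem fun h => hy ((insertNth_mem_corner i u y).1 h).1]
  · exact (hmp.integrable_comp_emb (MeasurableEquiv.measurableEmbedding _)).2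
      ((integrable_indicator_iff (measurableSet_corner _)).2 (integrableOn_corner hg))

/-- This affine map exchanges the i-th barycentric coordinate of the corner simplex with the omitted
one. In the innermost integral it is a reflection of the interval. -/
lemma integral_corner_flip {n : ℕ} (i : Fin (n + 1)) {g : (Fin (n + 1) → ℝ) → ℝ}
    (hg : Continuous g) : ∫ x in corner (n + 1), g (Function.update x i (1 - ∑ j, x j)) =
      ∫ x in corner (n + 1), g x := by
  rw [integral_corner_succ i hg, integral_corner_succ i
    (g := fun x => g (Function.update x i (1 - ∑ j, x j))) (hg.comp (by fun_prop))]
  refine integral_congr_ae (Filter.Eventually.of_forall fun y => ?_)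
  simp only [Fin.update_insertNth, Fin.sum_univ_succAbove _ i, Fin.insertNth_apply_same,
    Fin.insertNth_apply_succAbove]
  have h := intervalIntegral.integral_comp_sub_left (a := 0) (b := 1 - ∑ j, y j)
    (fun u => g (i.insertNth (α := fun _ => ℝ) u y)) (1 - ∑ j, y j)
  rw [sub_self, sub_zero] at h
  rw [← h]
  refine intervalIntegral.integral_congr fun u _ => ?_
  congr 2
  ring

lemma integral_corner_one (g : (Fin 1 → ℝ) → ℝ) :
    ∫ y in corner 1, g y = ∫ s in (0 : ℝ)..1, g fun _ => s := by
  have hmp := (volume_preserving_funUnique (Fin 1) ℝ).symm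
  have h := hmp.setIntegral_preimage_emb (MeasurableEquiv.measurableEmbedding _) g (corner 1)
  have hs : (MeasurableEquiv.funUnique (Fin 1) ℝ).symm ⁻¹' corner 1 = Set.Icc 0 1 := by
    ext s
    simp [corner, MeasurableEquiv.funUnique, uniqueElim]
  rw [hs] at h
  rw [intervalIntegral.integral_of_le zero_le_one, ← integral_Icc_eq_integral_Ioc]
  refine Eq.trans ?_ h.symm
  congr!

lemma integral_corner_two {g : (Fin 2 → ℝ) → ℝ} (hg : Continuous g) :
    ∫ y in corner 2, g y = ∫ s in (0 : ℝ)..1, ∫ t in (0 : ℝ)..(1 - s), g ![s, t] := by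
  rw [integral_corner_succ 1 hg, integral_corner_one]
  refine intervalIntegral.integral_congr fun s _ => ?_
  simp only [Finset.univ_unique, Finset.sum_singleton]
  refine intervalIntegral.integral_congr fun t _ => congrArg g ?_
  ext j
  fin_cases j <;> rfl

lemma eq_zero_of_integral_corner {n : ℕ} {g : (Fin n → ℝ) → ℝ} (hg : Continuous g)
    (h0 : ∀ y ∈ corner n, 0 ≤ g y) (h : ∫ y in corner n, g y = 0) {y : Fin n → ℝ}
    (hy : ∀ i, 0 < y i) (hy1 : ∑ i, y i < 1) : g y = 0 := by
  have hae : g =ᵐ[volume.restrict (corner n)] 0 := by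
    refine (setIntegral_eq_zero_iff_of_nonneg_ae ?_ (integrableOn_corner hg)).1 h
    exact (ae_restrict_iff' (measurableSet_corner n)).2 (Filter.Eventually.of_forall h0)
  set O : Set (Fin n → ℝ) := {y | (∀ i, 0 < y i) ∧ ∑ i, y i < 1} with hO
  have hOo : IsOpen O := by
    have : O = (⋂ i, {y : Fin n → ℝ | 0 < y i}) ∩ {y | ∑ i, y i < 1} := by
      ext y; simp [hO]
    rw [this]
    refine (isOpen_iInter_of_finite fun i => isOpen_lt continuous_const
      (continuous_apply i)).inter (isOpen_lt ?_ continuous_const)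
    fun_prop
  have hsub : O ⊆ corner n := fun y hy => ⟨fun i => (hy.1 i).le, hy.2.le⟩
  exact Measure.eqOn_open_of_ae_eq (ae_mono (Measure.restrict_mono hsub le_rfl) hae) hOo
    hg.continuousOn continuousOn_const ⟨hy, hy1⟩

/-- The affine parametrization of a simplex with given vertices. -/
def affPt {n : ℕ} (v : Fin (n + 1) → Vec) (y : Fin n → ℝ) : Vec :=
  v 0 + ∑ k, y k • (v k.succ - v 0)

lemma continuous_affPt {n : ℕ} (v : Fin (n + 1) → Vec) : Continuous (affPt v) := by
  unfold affPt
  fun_prop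

lemma continuous_eval_affPt {n : ℕ} (v : Fin (n + 1) → Vec) (p : Poly) :
    Continuous fun y => eval (affPt v y) p :=
  (MvPolynomial.continuous_eval p).comp (continuous_affPt v)

/-- The normalized integral of a polynomial over a simplex. -/
def cellInt {n : ℕ} (v : Fin (n + 1) → Vec) : Poly →ₗ[ℝ] ℝ where
  toFun p := ∫ y in corner n, eval (affPt v y) p
  map_add' p q := by
    simp only [map_add]
    exact integral_add (integrableOn_corner (continuous_eval_affPt v p))
      (integrableOn_corner (continuous_eval_affPt v q))
  map_smul' c p := by
    simp only [smul_eval, RingHom.id_apply, smul_eq_mul]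
    exact integral_const_mul _ _

lemma cellInt_apply {n : ℕ} (v : Fin (n + 1) → Vec) (p : Poly) :
    cellInt v p = ∫ y in corner n, eval (affPt v y) p := rfl

lemma affPt_insertNth {n : ℕ} (v : Fin (n + 2) → Vec) (k : Fin (n + 1)) (u : ℝ) (y : Fin n → ℝ) :
    affPt v (k.insertNth (α := fun _ => ℝ) u y) =
      affPt (v ∘ k.succ.succAbove) y + u • (v k.succ - v 0) := by
  simp only [affPt, Fin.sum_univ_succAbove _ k, Fin.insertNth_apply_same,
    Fin.insertNth_apply_succAbove, Function.comp, Fin.succ_succAbove_zero,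
    Fin.succ_succAbove_succ]
  abel

lemma affPt_insertNth_zero {n : ℕ} (v : Fin (n + 2) → Vec) (y : Fin n → ℝ) :
    affPt v ((0 : Fin (n + 1)).insertNth (α := fun _ => ℝ) (1 - ∑ j, y j) y) =
      affPt (v ∘ Fin.succ) y := by
  rw [affPt_insertNth]
  simp only [affPt, Function.comp, Fin.succ_succAbove_zero,
    Fin.succ_succAbove_succ, sub_smul, one_smul, Finset.sum_smul, smul_sub,
    Finset.sum_sub_distrib, Fin.zero_succAbove]
  abel

/-- The integral of a derivative along an edge direction of a simplex. -/
lemma cellInt_dirDeriv {n : ℕ} (v : Fin (n + 2) → Vec) (k : Fin (n + 1)) (p : Poly) :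
    cellInt v (dirDeriv (v k.succ - v 0) p) =
      (∫ y in corner n, eval (affPt v (k.insertNth (α := fun _ => ℝ) (1 - ∑ j, y j) y)) p) -
        cellInt (v ∘ k.succ.succAbove) p := by
  rw [cellInt_apply, integral_corner_succ k (continuous_eval_affPt v _), cellInt_apply,
    ← integral_sub]
  · refine integral_congr_ae (Filter.Eventually.of_forall fun y => ?_)
    simp only [affPt_insertNth]
    have h : ∀ u : ℝ, HasDerivAt
        (fun u : ℝ => eval (affPt (v ∘ k.succ.succAbove) y + u • (v k.succ - v 0)) p)
        (eval (affPt (v ∘ k.succ.succAbove) y + u • (v k.succ - v 0))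
          (dirDeriv (v k.succ - v 0) p)) u := by
      intro u
      rw [← dotProduct_gradAt]
      exact hasDerivAt_eval_line _ _ _ _
    rw [intervalIntegral.integral_eq_sub_of_hasDerivAt (fun u _ => h u)]
    · rw [zero_smul, add_zero]
    · refine Continuous.intervalIntegrable ?_ _ _
      exact (MvPolynomial.continuous_eval _).comp (by fun_prop)
  · refine integrableOn_corner ((continuous_eval_affPt v p).comp ?_)
    refine Continuous.finInsertNth k ?_ continuous_id
    fun_prop
  · exact integrableOn_corner (continuous_eval_affPt _ p)

lemma continuous_slant {n : ℕ} (k : Fin (n + 1)) {g : (Fin (n + 1) → ℝ) → ℝ}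
    (hg : Continuous g) :
    Continuous fun y : Fin n → ℝ => g (k.insertNth (α := fun _ => ℝ) (1 - ∑ j, y j) y) := by
  refine hg.comp (Continuous.finInsertNth k ?_ continuous_id)
  fun_prop

/-- Solving for different coordinates gives different parametrizations of the slanted facet. They
are related by corner flips, so contributions of several edge directions can be added there. -/
lemma integral_slant_one {g : (Fin 2 → ℝ) → ℝ} (hg : Continuous g) (k : Fin 2) :
    ∫ y in corner 1, g (k.insertNth (α := fun _ => ℝ) (1 - ∑ j, y j) y) =
      ∫ y in corner 1, g ((0 : Fin 2).insertNth (α := fun _ => ℝ) (1 - ∑ j, y j) y) := by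
  fin_cases k
  · rfl
  · rw [← integral_corner_flip 0 (continuous_slant _ hg)]
    refine integral_congr_ae (Filter.Eventually.of_forall fun y => ?_)
    simp only
    congr 1
    ext j
    fin_cases j <;> simp [Fin.insertNth, Fin.succAboveCases]

lemma integral_slant_two {g : (Fin 3 → ℝ) → ℝ} (hg : Continuous g) (k : Fin 3) :
    ∫ y in corner 2, g (k.insertNth (α := fun _ => ℝ) (1 - ∑ j, y j) y) =
      ∫ y in corner 2, g ((0 : Fin 3).insertNth (α := fun _ => ℝ) (1 - ∑ j, y j) y) := by
  have h1 : ∫ y in corner 2, g ((1 : Fin 3).insertNth (α := fun _ => ℝ) (1 - ∑ j, y j) y) =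
      ∫ y in corner 2, g ((0 : Fin 3).insertNth (α := fun _ => ℝ) (1 - ∑ j, y j) y) := by
    rw [← integral_corner_flip 0 (continuous_slant _ hg)]
    refine integral_congr_ae (Filter.Eventually.of_forall fun y => ?_)
    simp only
    congr 1
    ext j
    fin_cases j <;> simp [Fin.insertNth, Fin.succAboveCases, Fin.sum_univ_two]
    ring
  fin_cases k
  · rfl
  · exact h1
  · rw [← h1, ← integral_corner_flip 1 (continuous_slant _ hg)]
    refine integral_congr_ae (Filter.Eventually.of_forall fun y => ?_)
    simp only
    congr 1
    ext j
    fin_cases j <;> simp [Fin.insertNth, Fin.succAboveCases, Fin.sum_univ_two]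
    ring

/-! ### Integrals over the cells of a tetrahedron -/

lemma eval_affPt_bary (K : Tetrahedron) {n : ℕ} (s : Fin (n + 1) → Fin 4) (y : Fin n → ℝ)
    (j : Fin 4) : eval (affPt (K.points ∘ s) y) (bary K j) =
      (1 - ∑ k, y k) * (if j = s 0 then 1 else 0) +
        ∑ k : Fin n, y k * if j = s k.succ then 1 else 0 := by
  simp only [affPt, Function.comp, eval_add_bary, eval_bary_point, dotProduct_sum,
    dotProduct_smul, cov_dotProduct_points, smul_eq_mul, mul_sub, Finset.sum_sub_distrib]
  rw [← Finset.sum_mul]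
  ring

lemma eval_affPt_bary_nonneg (K : Tetrahedron) {n : ℕ} (s : Fin (n + 1) → Fin 4) {y : Fin n → ℝ}
    (hy : y ∈ corner n) (j : Fin 4) : 0 ≤ eval (affPt (K.points ∘ s) y) (bary K j) := by
  rw [eval_affPt_bary]
  refine add_nonneg (mul_nonneg (by linarith [hy.2]) (by split_ifs <;> norm_num))
    (Finset.sum_nonneg fun k _ => mul_nonneg (hy.1 k) (by split_ifs <;> norm_num))

lemma affPt_mem_flat (K : Tetrahedron) {n : ℕ} {s : Fin (n + 1) → Fin 4} {Z : Finset (Fin 4)}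
    (hs : ∀ k, s k ∉ Z) (y : Fin n → ℝ) : affPt (K.points ∘ s) y ∈ flat K Z := by
  intro z hz
  have h : ∀ k, z ≠ s k := by rintro k rfl; exact hs k hz
  rw [eval_affPt_bary, if_neg (h 0)]
  simp [h]

lemma cellInt_congr {K : Tetrahedron} {n : ℕ} {s : Fin (n + 1) → Fin 4} {Z : Finset (Fin 4)}
    (hs : ∀ k, s k ∉ Z) {p q : Poly} (h : ∀ x ∈ flat K Z, eval x p = eval x q) :
    cellInt (K.points ∘ s) p = cellInt (K.points ∘ s) q := by
  rw [cellInt_apply, cellInt_apply]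
  exact integral_congr_ae (Filter.Eventually.of_forall fun y => h _ (affPt_mem_flat K hs y))

lemma cellInt_eq_zero {K : Tetrahedron} {n : ℕ} {s : Fin (n + 1) → Fin 4} {Z : Finset (Fin 4)}
    (hs : ∀ k, s k ∉ Z) {p : Poly} (h : ∀ x ∈ flat K Z, eval x p = 0) :
    cellInt (K.points ∘ s) p = 0 := by
  rw [cellInt_congr (q := 0) hs (by simpa using h), map_zero]

/-- A point of a flat is parametrized by its barycentric coordinates. -/
lemma eq_affPt {K : Tetrahedron} {n : ℕ} {s : Fin (n + 1) → Fin 4} (hs : Function.Injective s)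
    {Z : Finset (Fin 4)} (hZ : ∀ j, j ∉ Z → j ∈ Set.range s) {x : Vec} (hx : x ∈ flat K Z) :
    ∑ k, eval x (bary K (s k)) = 1 ∧
      x = affPt (K.points ∘ s) fun k => eval x (bary K (s k.succ)) := by
  have h0 : ∀ j, j ∉ Finset.univ.image s → eval x (bary K j) = 0 := by
    intro j hj
    by_contra hne
    obtain ⟨k, rfl⟩ := hZ j fun h => hne (hx j h)
    exact hj (Finset.mem_image_of_mem _ (Finset.mem_univ _))
  have h1 : ∑ k, eval x (bary K (s k)) = 1 := by
    rw [← sum_eval_bary K x, ← Finset.sum_image (s := Finset.univ) (g := s)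
      (f := fun j => eval x (bary K j)) (fun a _ b _ h => hs h)]
    exact Finset.sum_subset (Finset.subset_univ _) fun j _ hj => h0 j hj
  have h2 : ∑ k, eval x (bary K (s k)) • K.points (s k) = x := by
    conv_rhs => rw [← sum_eval_bary_smul K x]
    rw [← Finset.sum_image (s := Finset.univ) (g := s)
      (f := fun j => eval x (bary K j) • K.points j) (fun a _ b _ h => hs h)]
    exact Finset.sum_subset (Finset.subset_univ _) fun j _ hj => by rw [h0 j hj, zero_smul]
  refine ⟨h1, ?_⟩
  conv_lhs => rw [← h2]
  rw [Fin.sum_univ_succ] at h1 ⊢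
  rw [← eq_sub_iff_add_eq] at h1
  rw [h1, affPt, sub_smul, one_smul, Finset.sum_smul]
  simp only [Function.comp, smul_sub, Finset.sum_sub_distrib]
  abel

lemma eval_eq_zero_of_cellInt {K : Tetrahedron} {n : ℕ} {s : Fin (n + 1) → Fin 4}
    (hs : Function.Injective s) {Z : Finset (Fin 4)} (hZ : ∀ j, j ∉ Z ↔ j ∈ Set.range s) {g : Poly}
    (h0 : ∀ x, (∀ j, 0 ≤ eval x (bary K j)) → 0 ≤ eval x g)
    (h : cellInt (K.points ∘ s) g = 0) : ∀ x ∈ cell K Z, eval x g = 0 := by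
  intro x hx
  obtain ⟨h1, h2⟩ := eq_affPt hs (fun j => (hZ j).1) hx.1
  have hpos : ∀ k, 0 < eval x (bary K (s k)) := fun k => hx.2 _ ((hZ _).2 ⟨k, rfl⟩)
  rw [h2]
  rw [Fin.sum_univ_succ] at h1
  exact eq_zero_of_integral_corner (continuous_eval_affPt _ g)
    (fun y hy => h0 _ (eval_affPt_bary_nonneg K s hy)) h (fun k => hpos k.succ)
    (by linarith [hpos 0])

/-- Weighted squares with vanishing integral vanish. -/
lemma eval_eq_zero_of_cellInt_mul_self {K : Tetrahedron} {n : ℕ} {s : Fin (n + 1) → Fin 4}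
    (hs : Function.Injective s) {Z : Finset (Fin 4)} (hZ : ∀ j, j ∉ Z ↔ j ∈ Set.range s)
    {w p : Poly} (h0 : ∀ x, (∀ j, 0 ≤ eval x (bary K j)) → 0 ≤ eval x w)
    (h1 : ∀ x ∈ cell K Z, 0 < eval x w) (h : cellInt (K.points ∘ s) (w * (p * p)) = 0) :
    ∀ x ∈ flat K Z, eval x p = 0 := by
  refine eval_eq_zero_of_cell ⟨s 0, by simpa using (hZ _).2 ⟨0, rfl⟩⟩ fun x hx => ?_
  have h2 := eval_eq_zero_of_cellInt hs hZ (fun x hx => by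
    rw [map_mul, map_mul]
    exact mul_nonneg (h0 x hx) (mul_self_nonneg _)) h x hx
  rw [map_mul, map_mul] at h2
  exact mul_self_eq_zero.1 ((mul_eq_zero.1 h2).resolve_left (h1 x hx).ne')

/-- The contraction of a polynomial vector field with the gradient of a barycentric coordinate. -/
def covDot (K : Tetrahedron) (i : Fin 4) (U : Fin 3 → Poly) : Poly := ∑ a, cov K i a • U a

lemma sum_covDot (K : Tetrahedron) (U : Fin 3 → Poly) : ∑ i, covDot K i U = 0 := by
  simp only [covDot]
  rw [Finset.sum_comm]
  refine Finset.sum_eq_zero fun a _ => ?_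
  rw [← Finset.sum_smul]
  have h := sum_cov_dotProduct K (Pi.single a 1)
  simp only [dotProduct_single, mul_one] at h
  rw [h, zero_smul]

/-- The divergence in terms of barycentric components. -/
lemma divVec_eq_sum (K : Tetrahedron) (a : Fin 4) (U : Fin 3 → Poly) :
    divVec U = ∑ i, dirDeriv (K.points i - K.points a) (covDot K i U) := by
  have h : ∀ b c : Fin 3, ∑ i, (K.points i - K.points a) b * cov K i c =
      if b = c then 1 else 0 := by
    intro b c
    have h1 := congrFun (eq_sum_cov_smul K a (Pi.single c 1)) b
    rw [Finset.sum_apply] at h1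
    simp only [dotProduct_single, mul_one, Pi.smul_apply, smul_eq_mul, Pi.single_apply] at h1
    rw [h1]
    exact Finset.sum_congr rfl fun i _ => mul_comm _ _
  simp only [dirDeriv, covDot, map_sum, Derivation.map_smul, Finset.smul_sum, smul_smul]
  rw [Finset.sum_comm]
  have h2 : ∀ b : Fin 3, ∑ i, ∑ c, ((K.points i - K.points a) b * cov K i c) • pderiv b (U c) =
      pderiv b (U b) := by
    intro b
    rw [Finset.sum_comm]
    simp only [← Finset.sum_smul, h, ite_smul, one_smul, zero_smul, Finset.sum_ite_eq,
      Finset.mem_univ, if_true]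
  simp only [h2, divVec]

/-- The divergence theorem on a tetrahedron. -/
lemma cellInt_divVec (K : Tetrahedron) (w : Fin 3 → Poly) :
    cellInt K.points (divVec w) =
      -∑ i : Fin 4, cellInt (K.points ∘ i.succAbove) (covDot K i w) := by
  have h1 : ∀ k : Fin 3, cellInt K.points
      (dirDeriv (K.points k.succ - K.points 0) (covDot K k.succ w)) =
      cellInt (K.points ∘ (0 : Fin 4).succAbove) (covDot K k.succ w) -
        cellInt (K.points ∘ k.succ.succAbove) (covDot K k.succ w) := by
    intro k
    rw [cellInt_dirDeriv, integral_slant_two (continuous_eval_affPt _ _)]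
    simp only [affPt_insertNth_zero]
    rfl
  have h2 := sum_covDot K w
  rw [Fin.sum_univ_succ] at h2
  rw [divVec_eq_sum K 0, Fin.sum_univ_succ, sub_self, map_add, map_sum]
  simp only [h1]
  -- Each edge direction at vertex 0 contributes on the facet opposite 0. The barycentric components
  -- sum to zero, so these contributions combine into the missing component.
  rw [Finset.sum_sub_distrib, ← map_sum, eq_neg_of_add_eq_zero_right h2,
    Fin.sum_univ_succ (n := 3), map_neg]
  have h3 : dirDeriv 0 (covDot K 0 w) = 0 := by simp [dirDeriv]
  rw [h3, map_zero]
  ring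

/-- The divergence theorem on a face for tangential fields with vanishing conormal traces. -/
lemma cellInt_face_div (K : Tetrahedron) (i : Fin 4) {U : Fin 3 → Poly}
    (hi : ∀ x ∈ flat K {i}, eval x (covDot K i U) = 0)
    (hU : ∀ j, j ≠ i → ∀ x ∈ flat K {i, j}, eval x (covDot K j U) = 0) :
    cellInt (K.points ∘ i.succAbove) (divVec U -
      dirDeriv (K.points i - K.points (i.succAbove 0)) (covDot K i U)) = 0 := by
  set s := i.succAbove with hs
  have hsi : ∀ k, s k ≠ i := fun k => Fin.succAbove_ne i k
  have hinj : Function.Injective s := Fin.succAbove_right_injective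
  -- The subtracted term is the derivative transverse to the face; the others are along its two
  -- edges at s 0.
  have h1 : divVec U - dirDeriv (K.points i - K.points (s 0)) (covDot K i U) =
      ∑ k : Fin 2, dirDeriv ((K.points ∘ s) k.succ - (K.points ∘ s) 0)
        (covDot K (s k.succ) U) := by
    rw [divVec_eq_sum K (s 0), Fin.sum_univ_succAbove _ i, add_sub_cancel_left, Fin.sum_univ_succ,
      ← hs, sub_self]
    have h3 : dirDeriv 0 (covDot K (s 0) U) = 0 := by simp [dirDeriv]
    rw [h3, zero_add]
    rfl
  have h2 : ∀ k : Fin 2, cellInt (K.points ∘ s) (dirDeriv ((K.points ∘ s) k.succ -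
      (K.points ∘ s) 0) (covDot K (s k.succ) U)) =
      cellInt (K.points ∘ (s ∘ Fin.succ)) (covDot K (s k.succ) U) := by
    intro k
    rw [cellInt_dirDeriv, integral_slant_one (continuous_eval_affPt _ _)]
    simp only [affPt_insertNth_zero]
    have h3 : cellInt ((K.points ∘ s) ∘ k.succ.succAbove) (covDot K (s k.succ) U) = 0 :=
      cellInt_eq_zero (K := K) (s := s ∘ k.succ.succAbove) (Z := {i, s k.succ}) (by
        intro j
        simp only [Function.comp, Finset.mem_insert, Finset.mem_singleton, not_or]
        exact ⟨hsi _, fun h => Fin.succAbove_ne _ _ (hinj h)⟩) (hU _ (hsi _))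
    rw [h3, sub_zero]
    rfl
  rw [h1, map_sum]
  simp only [h2]
  rw [← map_sum]
  refine cellInt_eq_zero (Z := {i, s 0}) (fun k => ?_) fun x hx => ?_
  · simp only [Function.comp, Finset.mem_insert, Finset.mem_singleton, not_or]
    exact ⟨hsi _, fun h => Fin.succ_ne_zero k (hinj h)⟩
  · have h3 := congrArg (eval x) (sum_covDot K U)
    rw [Fin.sum_univ_succAbove _ i, Fin.sum_univ_succ, map_add, map_add, ← hs, hU _ (hsi 0) x hx,
      hi x (mem_flat_singleton.2 (mem_flat_pair.1 hx).1), zero_add, zero_add, map_zero] at h3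
    exact h3

lemma covDot_eq {K : Tetrahedron} {i : Fin 4} {n : Vec} {c : ℝ} (h : cov K i = c • n)
    (U : Fin 3 → Poly) : covDot K i U = c • ∑ a, n a • U a := by
  rw [covDot, h, Finset.smul_sum]
  simp only [Pi.smul_apply, smul_eq_mul, smul_smul]

lemma dirDeriv_mul (w : Vec) (p q : Poly) :
    dirDeriv w (p * q) = p * dirDeriv w q + q * dirDeriv w p := by
  simp only [dirDeriv, pderiv_mul, smul_add, Finset.sum_add_distrib, Finset.mul_sum, mul_smul_comm]
  rw [add_comm]
  congr 1
  exact Finset.sum_congr rfl fun i _ => by rw [mul_comm]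

lemma dirDeriv_smul (w : Vec) (c : ℝ) (p : Poly) : dirDeriv w (c • p) = c • dirDeriv w p := by
  simp only [dirDeriv, Derivation.map_smul, Finset.smul_sum, smul_comm c]

lemma dirDeriv_bary (K : Tetrahedron) (i : Fin 4) (w : Vec) :
    dirDeriv w (bary K i) = C (cov K i ⬝ᵥ w) := by
  simp only [dirDeriv, pderiv_bary, dotProduct, map_sum, map_mul, smul_eq_C_mul, mul_comm]

/-- The Green identity for tensor fields with vanishing traces. -/
theorem cellInt_divDiv_mul {K : Tetrahedron} {n : Fin 4 → Vec} (hn : IsFaceNormals K n)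
    {θ : PolyMat} (hθ : θ.IsSymm) (hz : ZeroTrace K n θ) (q : Poly) :
    cellInt K.points (divDiv θ * q) = cellInt K.points (∑ i, ∑ j, θ i j * hess q i j) := by
  have e10 : θ 1 0 = θ 0 1 := hθ.apply 0 1
  have e20 : θ 2 0 = θ 0 2 := hθ.apply 0 2
  have e21 : θ 2 1 = θ 1 2 := hθ.apply 1 2
  -- The flux with div w = q div div θ - θ : ∇²q. It remains to show that its flux through each face
  -- is zero.
  set w : Fin 3 → Poly := fun a => (∑ b, pderiv b (θ a b)) * q - ∑ b, θ a b * pderiv b q with hw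
  have hdiv : divVec w = divDiv θ * q - ∑ i, ∑ j, θ i j * hess q i j := by
    simp only [hw, divVec, divDiv_apply, hess_apply, Fin.sum_univ_three, map_sub, map_add,
      pderiv_mul, e10, e20, e21]
    ring
  rw [← sub_eq_zero, ← map_sub, ← hdiv, cellInt_divVec, neg_eq_zero]
  refine Finset.sum_eq_zero fun i _ => ?_
  obtain ⟨c, hc0, hc⟩ := (hn i).exists_cov_eq
  set u := mulConst θ (n i) with hu
  set U : Fin 3 → Poly := fun a => q * u a with hU
  have hbU : ∀ m : Vec, ∑ a, m a • U a = q * bilin m θ (n i) := by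
    intro m
    simp only [hU, bilin, Finset.mul_sum, mul_smul_comm]
    rfl
  have hface := cellInt_face_div K i (U := U) (fun x hx => by
    rw [covDot_eq hc, hbU, smul_eval, map_mul, hz.face i x hx, mul_zero, mul_zero])
    (fun j hj x hx => by
    obtain ⟨d, -, hd⟩ := (hn j).exists_cov_eq
    rw [covDot_eq hd, hbU, smul_eval, map_mul, hz.edge j i hj x (by rwa [Finset.pair_comm]),
      mul_zero, mul_zero])
  rw [covDot_eq hc, map_smul, smul_eq_mul]
  refine mul_eq_zero_of_right _ ?_
  rw [← neg_eq_zero, ← map_neg, ← hface]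
  refine cellInt_congr (Z := {i}) (fun k => by simp) fun x hx => ?_
  obtain ⟨R, hR⟩ := exists_eq_bary_mul_of_plane (hz.face i)
  have hx0 := mem_flat_singleton.1 hx
  have h1 : dirDeriv (K.points i - K.points (i.succAbove 0)) (covDot K i U) =
      c • (q * (bary K i * dirDeriv (K.points i - K.points (i.succAbove 0)) R + R) +
        bary K i * R * dirDeriv (K.points i - K.points (i.succAbove 0)) q) := by
    rw [covDot_eq hc, hbU, hR, dirDeriv_smul, dirDeriv_mul, dirDeriv_mul, dirDeriv_bary,
      cov_dotProduct_points, if_pos rfl, if_neg (Fin.succAbove_ne i 0).symm, sub_zero, C_1, mul_one]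
  -- With nᵀθn = λ_i R, this is the vanishing of the shear trace. It turns n·w into minus the
  -- surface divergence of q θn, whose integral over the face is zero by the other two traces.
  have h2 : eval x (divVec u) * 2 = c * eval x R := by
    have h3 := hz.shear i x hx
    rw [shearTrace_eq, hR, dirDeriv_mul, dirDeriv_bary, hc, smul_dotProduct, (hn i).1] at h3
    simp only [map_sub, map_mul, map_add, hx0, eval_C, smul_eq_mul, mul_one, map_ofNat] at h3
    linear_combination h3
  have h4 : ∑ a, n i a • w a = q * divVec u - ∑ b, u b * pderiv b q := by
    simp only [hw, hu, divVec, mulConst, Fin.sum_univ_three, smul_eq_C_mul, map_add, pderiv_C_mul,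
      e10, e20, e21]
    ring
  have h5 : divVec U = q * divVec u + ∑ b, u b * pderiv b q := by
    simp only [hU, divVec, Fin.sum_univ_three, pderiv_mul]
    ring
  rw [h1, h4, h5]
  simp only [map_neg, map_sub, map_add, map_mul, smul_eval, hx0]
  linear_combination (-eval x q) * h2

/-! ### The inner products -/

lemma dotProduct_self_pos {w : Vec} (h : w ≠ 0) : 0 < w ⬝ᵥ w :=
  (Finset.sum_nonneg fun i _ => mul_self_nonneg (w i)).lt_of_ne'
    (mt dotProduct_self_eq_zero.1 h)

/-- Only positivity of the length factor matters, here and in the two analogues below: prescribed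
values are rescaled at the very end. -/
lemma edgeInner_eq (K : Tetrahedron) (e : Edge) : ∃ c : ℝ, 0 < c ∧ ∀ p q : Poly,
    edgeInner K e p q = c * cellInt (K.points ∘ ![e.1.1, e.1.2]) (p * q) := by
  refine ⟨_, Real.sqrt_pos.2 (dotProduct_self_pos (w := K.points e.1.2 - K.points e.1.1) ?_),
    fun p q => ?_⟩
  · intro h
    exact e.2.ne' (K.independent.injective (sub_eq_zero.1 h))
  · rw [cellInt_apply, integral_corner_one]
    simp only [edgeInner, edgeIntegral, map_mul]
    congr 1
    refine intervalIntegral.integral_congr fun s _ => ?_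
    simp [affPt]

lemma faceInner_eq (K : Tetrahedron) (i : Fin 4) : ∃ c : ℝ, 0 < c ∧ ∀ p q : Poly,
    faceInner K i p q = c * cellInt (K.points ∘ i.succAbove) (p * q) := by
  set u := K.points (i.succAbove 1) - K.points (i.succAbove 0) with hu
  set w := K.points (i.succAbove 2) - K.points (i.succAbove 0) with hw
  refine ⟨_, Real.sqrt_pos.2 (dotProduct_self_pos (w := u ⨯₃ w) ?_), fun p q => ?_⟩
  · intro h
    have h1 := cross_dot_cross (cov K (i.succAbove 1)) (cov K (i.succAbove 2)) u w
    rw [h, hu, hw] at h1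
    simp only [cov_dotProduct_points] at h1
    simp at h1
  · rw [cellInt_apply, integral_corner_two (continuous_eval_affPt _ _)]
    simp only [faceInner, faceIntegral, map_mul]
    congr 1
    refine intervalIntegral.integral_congr fun s _ => ?_
    refine intervalIntegral.integral_congr fun t _ => ?_
    simp [affPt, Fin.sum_univ_two, add_assoc]

lemma body_eq_image (K : Tetrahedron) : body K = affPt K.points '' corner 3 := by
  have h : body K = {x | ∀ i, 0 ≤ eval x (bary K i)} := by
    simp only [eval_bary]
    exact (vertexBasis K).convexHull_eq_nonneg_coord
  rw [h]
  ext x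
  constructor
  · intro hx
    obtain ⟨h1, h2⟩ := eq_affPt (K := K) (s := id) (Z := ∅) Function.injective_id
      (fun j _ => ⟨j, rfl⟩) (x := x) (by simp [flat])
    refine ⟨_, ⟨fun k => hx _, ?_⟩, h2.symm⟩
    rw [Fin.sum_univ_succ] at h1
    have := hx 0
    simp only [id] at h1 ⊢
    linarith
  · rintro ⟨y, hy, rfl⟩
    exact eval_affPt_bary_nonneg K id hy

lemma bodyInner_eq (K : Tetrahedron) : ∃ c : ℝ, 0 < c ∧ ∀ τ ς : PolyMat,
    bodyInner K τ ς = c * cellInt K.points (∑ i, ∑ j, τ i j * ς i j) := by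
  let L : Vec →L[ℝ] Vec :=
    ∑ k : Fin 3, (ContinuousLinearMap.proj k).smulRight (K.points k.succ - K.points 0)
  have hL : ∀ y, affPt K.points y = K.points 0 + L y := by
    intro y
    simp [affPt, L]
  have hinj : Function.Injective L := by
    refine (injective_iff_map_eq_zero L).2 fun y hy => ?_
    ext k
    have h1 := eval_affPt_bary K id y k.succ
    have h2 := hL y
    rw [hy, add_zero] at h2
    rw [Function.comp_id, h2, eval_bary_point] at h1
    simpa [Fin.succ_ne_zero] using h1.symm
  have hdet : L.det ≠ 0 := by
    intro h
    have h1 := LinearMap.bot_lt_ker_of_det_eq_zero (f := (L : Vec →ₗ[ℝ] Vec)) h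
    rw [LinearMap.ker_eq_bot.2 hinj] at h1
    exact lt_irrefl _ h1
  refine ⟨|L.det|, abs_pos.2 hdet, fun τ ς => ?_⟩
  have h1 : ∀ x, ∑ i, ∑ j, evalMat τ x i j * evalMat ς x i j =
      eval x (∑ i, ∑ j, τ i j * ς i j) := by
    intro x
    simp [evalMat]
  simp only [bodyInner, h1]
  rw [body_eq_image, integral_image_eq_integral_abs_det_fderiv_smul volume
    (measurableSet_corner 3) (f' := fun _ => L), cellInt_apply, ← integral_const_mul]
  · rfl
  · intro x _
    have : affPt K.points = fun y => K.points 0 + L y := funext hL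
    rw [this]
    exact (L.hasFDerivAt.const_add _).hasFDerivWithinAt
  · intro x _ y _ hxy
    rw [hL, hL, add_right_inj] at hxy
    exact hinj hxy

/-! ### Boundary degrees of freedom -/

lemma eval_bilin_eq (a b : Vec) (τ : PolyMat) (x : Vec) :
    eval x (bilin a τ b) = a ⬝ᵥ (evalMat τ x *ᵥ b) := by
  rw [eval_bilin]
  congr 1
  ext i
  simp [evalVec, mulConst, mulVec, dotProduct, evalMat, smul_eval, mul_comm]

/-- The map `τ ↦ aᵀ τ b`. -/
def bilinMap (a b : Vec) : PolyMat →ₗ[ℝ] Poly where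
  toFun τ := bilin a τ b
  map_add' σ τ := by
    apply MvPolynomial.funext
    intro x
    simp only [map_add, eval_bilin_eq, evalMat_add, add_mulVec, dotProduct_add]
  map_smul' c τ := by
    apply MvPolynomial.funext
    intro x
    simp only [RingHom.id_apply, smul_eval, eval_bilin_eq, evalMat_smul, smul_mulVec,
      dotProduct_smul, smul_eq_mul]

lemma bilinMap_apply (a b : Vec) (τ : PolyMat) : bilinMap a b τ = bilin a τ b := rfl

/-- The map `τ ↦ 2 div_F (τ n) + ∂_n (nᵀ τ n)`. -/
def shearMap (n : Vec) : PolyMat →ₗ[ℝ] Poly where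
  toFun τ := shearTrace n τ
  map_add' σ τ := by
    simp only [shearTrace_eq, ← bilinMap_apply, map_add]
    simp only [divVec, mulConst, dirDeriv, Matrix.add_apply, Fin.sum_univ_three, smul_add, map_add]
    ring
  map_smul' c τ := by
    simp only [shearTrace_eq, ← bilinMap_apply, map_smul, dirDeriv_smul, RingHom.id_apply]
    simp only [divVec, mulConst, Matrix.smul_apply, Fin.sum_univ_three, smul_eq_C_mul,
      pderiv_C_mul, map_add]
    ring

lemma shearMap_apply (n : Vec) (τ : PolyMat) : shearMap n τ = shearTrace n τ := rfl

/-- The functional `q ↦ ∫ p q` on polynomials of degree at most `m`. -/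
def moment {d : ℕ} (v : Fin (d + 1) → Vec) (m : ℕ) : Poly →ₗ[ℝ] Module.Dual ℝ (PolyLE m) :=
  ((LinearMap.mul ℝ Poly).compr₂ (cellInt v)).compl₂ (PolyLE m).subtype

lemma moment_apply {d : ℕ} (v : Fin (d + 1) → Vec) (m : ℕ) (p : Poly) (q : PolyLE m) :
    moment v m p q = cellInt v (p * q) := rfl

/-- The vertices of an edge. -/
abbrev edgeIdx (e : Edge) : Fin 2 → Fin 4 := ![e.1.1, e.1.2]

/-- The faces that contain an edge. -/
abbrev edgeFaces (e : Edge) : Finset (Fin 4) := {e.1.1, e.1.2}ᶜ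

lemma not_mem_edgeFaces {e : Edge} {j : Fin 4} :
    j ∉ edgeFaces e ↔ j ∈ Set.range (edgeIdx e) := by
  simp only [edgeFaces, edgeIdx, Finset.mem_compl, Finset.mem_insert, Finset.mem_singleton,
    not_not, Set.mem_range, Fin.exists_fin_two, Matrix.cons_val_zero, Matrix.cons_val_one,
    eq_comm (b := j)]

lemma edgeIdx_not_mem (e : Edge) (k : Fin 2) : edgeIdx e k ∉ edgeFaces e :=
  not_mem_edgeFaces.2 ⟨k, rfl⟩

lemma edgeIdx_injective (e : Edge) : Function.Injective (edgeIdx e) := by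
  intro a b h
  have := e.2.ne
  fin_cases a <;> fin_cases b <;> simp_all

lemma exists_edgeFaces_eq {i j : Fin 4} (h : i ≠ j) : ∃ e : Edge, edgeFaces e = {i, j} := by
  revert i j
  decide

lemma edgeFaces_eq (e : Edge) : ∃ i j, i ≠ j ∧ edgeFaces e = {i, j} := by
  revert e
  decide

/-- Values of the degrees of freedom that are attached to the boundary. -/
abbrev BdryData (m : ℕ) : Type :=
  (Fin 4 → Mat) × (Edge → Fin 2 → Fin 2 → Module.Dual ℝ (PolyLE (m + 1))) ×
    (Fin 4 → Module.Dual ℝ (PolyLE m)) × (Fin 4 → Module.Dual ℝ (PolyLE (m + 2)))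

/-- The degrees of freedom that are attached to the boundary. -/
def bdry (K : Tetrahedron) (n : Fin 4 → Vec) (ν : Edge → Fin 2 → Vec) (m : ℕ) :
    PolyMat →ₗ[ℝ] BdryData m where
  toFun τ :=
    ⟨fun δ => evalMat τ (K.points δ),
      fun e a b => moment (K.points ∘ edgeIdx e) (m + 1) (bilinMap (ν e a) (ν e b) τ),
      fun i => moment (K.points ∘ i.succAbove) m (bilinMap (n i) (n i) τ),
      fun i => moment (K.points ∘ i.succAbove) (m + 2) (shearMap (n i) τ)⟩
  map_add' σ τ := by
    simp only [evalMat_add, map_add]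
    rfl
  map_smul' c τ := by
    simp only [evalMat_smul, map_smul]
    rfl

lemma bdry_apply (K : Tetrahedron) (n : Fin 4 → Vec) (ν : Edge → Fin 2 → Vec) (m : ℕ)
    (τ : PolyMat) : bdry K n ν m τ =
      ⟨fun δ => evalMat τ (K.points δ),
      fun e a b => moment (K.points ∘ edgeIdx e) (m + 1) (bilinMap (ν e a) (ν e b) τ),
      fun i => moment (K.points ∘ i.succAbove) m (bilinMap (n i) (n i) τ),
      fun i => moment (K.points ∘ i.succAbove) (m + 2) (shearMap (n i) τ)⟩ := rfl

/-- The boundary traces of `τ` agree with polynomials of the degrees that belong to tensor fields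
of degree `m + 3`. -/
structure TraceDegree (K : Tetrahedron) (n : Fin 4 → Vec) (ν : Edge → Fin 2 → Vec) (m : ℕ)
    (τ : PolyMat) : Prop where
  edge : ∀ e a b, ∃ p ∈ PolyLE (m + 3), ∀ x ∈ flat K (edgeFaces e),
    eval x (bilin (ν e a) τ (ν e b)) = eval x p
  face : ∀ i, ∃ p ∈ PolyLE (m + 3), ∀ x ∈ flat K {i}, eval x (bilin (n i) τ (n i)) = eval x p
  shear : ∀ i, ∃ p ∈ PolyLE (m + 2), ∀ x ∈ flat K {i}, eval x (shearTrace (n i) τ) = eval x p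

lemma polyLE_mulConst {m : ℕ} {τ : PolyMat} (h : ∀ i j, τ i j ∈ PolyLE m) (b : Vec) (i : Fin 3) :
    mulConst τ b i ∈ PolyLE m :=
  Submodule.sum_mem _ fun j _ => Submodule.smul_mem _ _ (h i j)

lemma polyLE_bilin {m : ℕ} {τ : PolyMat} (h : ∀ i j, τ i j ∈ PolyLE m) (a b : Vec) :
    bilin a τ b ∈ PolyLE m :=
  Submodule.sum_mem _ fun i _ => Submodule.smul_mem _ _ (polyLE_mulConst h b i)

lemma polyLE_dirDeriv {m : ℕ} {p : Poly} (h : p ∈ PolyLE m) (w : Vec) :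
    dirDeriv w p ∈ PolyLE (m - 1) :=
  Submodule.sum_mem _ fun i _ => Submodule.smul_mem _ _ (polyLE_pderiv i h)

lemma polyLE_shearTrace {m : ℕ} {τ : PolyMat} (h : ∀ i j, τ i j ∈ PolyLE m) (n : Vec) :
    shearTrace n τ ∈ PolyLE (m - 1) := by
  rw [shearTrace_eq, two_mul]
  have h1 : divVec (mulConst τ n) ∈ PolyLE (m - 1) :=
    Submodule.sum_mem _ fun i _ => polyLE_pderiv i (polyLE_mulConst h n i)
  exact sub_mem (add_mem h1 h1) (polyLE_dirDeriv (polyLE_bilin h n n) n)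

lemma traceDegree_of_polyLE {K : Tetrahedron} {n : Fin 4 → Vec} {ν : Edge → Fin 2 → Vec} {m : ℕ}
    {τ : PolyMat} (h : ∀ i j, τ i j ∈ PolyLE (m + 3)) : TraceDegree K n ν m τ where
  edge _ _ _ := ⟨_, polyLE_bilin h _ _, fun _ _ => rfl⟩
  face _ := ⟨_, polyLE_bilin h _ _, fun _ _ => rfl⟩
  shear _ := ⟨_, polyLE_shearTrace h _, fun _ _ => rfl⟩

lemma TraceDegree.add {K : Tetrahedron} {n : Fin 4 → Vec} {ν : Edge → Fin 2 → Vec} {m : ℕ}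
    {σ τ : PolyMat} (hσ : TraceDegree K n ν m σ) (hτ : TraceDegree K n ν m τ) :
    TraceDegree K n ν m (σ + τ) where
  edge e a b := by
    obtain ⟨p, hp, h⟩ := hσ.edge e a b
    obtain ⟨q, hq, h'⟩ := hτ.edge e a b
    exact ⟨p + q, add_mem hp hq, fun x hx => by
      rw [← bilinMap_apply, map_add, map_add, map_add, bilinMap_apply, bilinMap_apply, h x hx,
        h' x hx]⟩
  face i := by
    obtain ⟨p, hp, h⟩ := hσ.face i
    obtain ⟨q, hq, h'⟩ := hτ.face i
    exact ⟨p + q, add_mem hp hq, fun x hx => by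
      rw [← bilinMap_apply, map_add, map_add, map_add, bilinMap_apply, bilinMap_apply, h x hx,
        h' x hx]⟩
  shear i := by
    obtain ⟨p, hp, h⟩ := hσ.shear i
    obtain ⟨q, hq, h'⟩ := hτ.shear i
    exact ⟨p + q, add_mem hp hq, fun x hx => by
      rw [← shearMap_apply, map_add, map_add, map_add, shearMap_apply, shearMap_apply, h x hx,
        h' x hx]⟩

lemma dotProduct_sub_eq_of_flat {K : Tetrahedron} {Z : Finset (Fin 4)} {k : Fin 4} (hk : k ∉ Z)
    {w : Vec} (hw : ∀ j, j ∉ Z → w ⬝ᵥ (K.points j - K.points k) = 0) {x : Vec}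
    (hx : x ∈ flat K Z) : w ⬝ᵥ x = w ⬝ᵥ K.points k := by
  rw [← sub_eq_zero, ← dotProduct_sub, dotProduct_eq_sum_cov K k w]
  refine Finset.sum_eq_zero fun j _ => ?_
  by_cases hj : j ∈ Z
  · rw [cov_dotProduct_sub, hx j hj, point_mem_flat K hk j hj, sub_self]
    simp
  · rw [hw j hj]
    simp

lemma eval_bilin_xxT (a b : Vec) (p : Poly) (x : Vec) :
    eval x (bilin a (xxT p) b) = (a ⬝ᵥ x) * (b ⬝ᵥ x) * eval x p := by
  simp [bilin, mulConst, xxT_apply, dotProduct, Fin.sum_univ_three, smul_eval]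
  ring

/-- Normal components of x are constant along an edge or a face plane, so x xᵀ p has traces of the
degree of p, although the field itself may have degree m + 4. In the shear trace a factor x survives
only together with a derivative of p. -/
lemma traceDegree_xxT {K : Tetrahedron} {n : Fin 4 → Vec} (hn : IsFaceNormals K n)
    {ν : Edge → Fin 2 → Vec} (hν : ∀ e, IsEdgeNormalPair K e (ν e)) {m : ℕ} {p : Poly}
    (hp : p ∈ PolyLE (m + 2)) : TraceDegree K n ν m (xxT p) where
  edge e a b := by
    have h1 : ∀ c, ∀ x ∈ flat K (edgeFaces e), ν e c ⬝ᵥ x = ν e c ⬝ᵥ K.points e.1.1 := by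
      intro c x hx
      refine dotProduct_sub_eq_of_flat (edgeIdx_not_mem e 0) (fun j hj => ?_) hx
      obtain ⟨k, rfl⟩ := not_mem_edgeFaces.1 hj
      fin_cases k
      · simp
      · exact ((hν e).1 c).2
    refine ⟨C ((ν e a ⬝ᵥ K.points e.1.1) * (ν e b ⬝ᵥ K.points e.1.1)) * p,
      polyLE_C_mul _ (polyLE_mono (Nat.le_succ _) hp), fun x hx => ?_⟩
    rw [eval_bilin_xxT, h1 a x hx, h1 b x hx, map_mul, eval_C]
  face i := by
    obtain ⟨k, hk, -⟩ := exists_ne_ne i i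
    refine ⟨C ((n i ⬝ᵥ K.points k) * (n i ⬝ᵥ K.points k)) * p,
      polyLE_C_mul _ (polyLE_mono (Nat.le_succ _) hp), fun x hx => ?_⟩
    rw [eval_bilin_xxT, (hn.mem_flat_iff hk).2 hx, map_mul, eval_C]
  shear i := by
    obtain ⟨k, hk, -⟩ := exists_ne_ne i i
    set γ := n i ⬝ᵥ K.points k with hγ
    have hE : ∀ x, eval x (shearTrace (n i) (xxT p)) = 2 * ((n i ⬝ᵥ x) * (4 * eval x p +
        ∑ a, x a * eval x (pderiv a p))) - 2 * (n i ⬝ᵥ n i) * (n i ⬝ᵥ x) * eval x p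
        - (n i ⬝ᵥ x) * (n i ⬝ᵥ x) * eval x (dirDeriv (n i) p) := by
      intro x
      rw [shearTrace_eq]
      simp only [divVec, dirDeriv, bilin, mulConst, xxT_apply, Fin.sum_univ_three, dotProduct,
        smul_eq_C_mul, map_add, map_sub, map_mul, pderiv_mul, pderiv_X,
        eval_C, eval_X, map_ofNat]
      simp
      ring
    refine ⟨C (2 * γ) * (C 3 * p + ∑ a, X a * pderiv a p) - C (γ * γ) * dirDeriv (n i) p, ?_,
      fun x hx => ?_⟩
    · refine sub_mem (polyLE_C_mul _ (add_mem (polyLE_C_mul _ hp) (Submodule.sum_mem _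
        fun a _ => ?_))) (polyLE_C_mul _ (polyLE_mono (Nat.sub_le _ _) (polyLE_dirDeriv hp _)))
      have := polyLE_X_mul a (polyLE_pderiv a hp)
      exact this
    · rw [hE, (hn.mem_flat_iff hk).2 hx, (hn i).1, ← hγ]
      simp only [map_sub, map_mul, map_add, eval_C, map_sum, eval_X]
      ring

lemma eq_point_of_flat {K : Tetrahedron} {Z : Finset (Fin 4)} {k : Fin 4}
    (hZ : ∀ j, j ∉ Z → j = k) {x : Vec} (hx : x ∈ flat K Z) : x = K.points k := by
  rw [← sub_eq_zero]
  refine eq_zero_of_cov_dotProduct K k fun j hj => ?_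
  rw [cov_dotProduct_sub, hx j (by by_contra h; exact hj (hZ j h)), eval_bary_point, if_neg hj,
    sub_self]

/-- A polynomial on an edge line that vanishes at both vertices and whose moments vanish. -/
lemma eval_eq_zero_of_edge {K : Tetrahedron} {e : Edge} {m : ℕ} {p : Poly}
    (hp : p ∈ PolyLE (m + 3)) (h0 : ∀ k, eval (K.points (edgeIdx e k)) p = 0)
    (h : ∀ q ∈ PolyLE (m + 1), cellInt (K.points ∘ edgeIdx e) (p * q) = 0) :
    ∀ x ∈ flat K (edgeFaces e), eval x p = 0 := by
  have h01 : e.1.1 ≠ e.1.2 := e.2.ne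
  have hn0 : e.1.1 ∉ edgeFaces e := edgeIdx_not_mem e 0
  have hn1 : e.1.2 ∉ edgeFaces e := edgeIdx_not_mem e 1
  have hcover : ∀ j, j ∉ edgeFaces e → j = e.1.1 ∨ j = e.1.2 := fun j hj => by
    simpa [or_iff_not_imp_left] using hj
  obtain ⟨r, hr, hr'⟩ := exists_eq_bary_mul (K := K) hn0 (k := e.1.2)
    (by simp [h01.symm]) hp (fun x hx => by
      rw [eq_point_of_flat (k := e.1.2) (fun j hj => ?_) hx]
      · exact h0 1
      · rw [Finset.mem_insert, not_or] at hj
        exact (hcover j hj.2).resolve_left hj.1)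
  obtain ⟨s, hs, hs'⟩ := exists_eq_bary_mul (K := K) hn1 (k := e.1.1)
    (by simp [h01]) hr (fun x hx => by
      rw [eq_point_of_flat (k := e.1.1) (fun j hj => ?_) hx]
      · have := hr' _ (point_mem_flat K hn0)
        rw [eval_bary_point, if_pos rfl, one_mul] at this
        rw [← this]
        exact h0 0
      · rw [Finset.mem_insert, not_or] at hj
        exact (hcover j hj.2).resolve_right hj.1)
  have hps : ∀ x ∈ flat K (edgeFaces e), eval x p = eval x (bary K e.1.1 * bary K e.1.2 * s) := by
    intro x hx
    rw [hr' x hx, hs' x hx]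
    simp only [map_mul]
    ring
  have hs0 := eval_eq_zero_of_cellInt_mul_self (edgeIdx_injective e) (Z := edgeFaces e)
    (fun j => not_mem_edgeFaces) (w := bary K e.1.1 * bary K e.1.2) (p := s)
    (fun x hx => by rw [map_mul]; exact mul_nonneg (hx _) (hx _))
    (fun x hx => by rw [map_mul]; exact mul_pos (hx.2 _ hn0) (hx.2 _ hn1)) (by
      rw [← h s hs]
      refine cellInt_congr (edgeIdx_not_mem e) fun x hx => ?_
      rw [map_mul, (eval x).map_mul p, hps x hx]
      simp only [map_mul]
      ring)
  intro x hx
  rw [hps x hx, map_mul, hs0 x hx, mul_zero]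

/-- A polynomial on a face plane that vanishes on the edges and whose moments vanish. -/
lemma eval_eq_zero_of_face_moment {K : Tetrahedron} {i : Fin 4} {m : ℕ} {p : Poly}
    (hp : p ∈ PolyLE (m + 3)) (h0 : ∀ j, j ≠ i → ∀ x ∈ flat K {i, j}, eval x p = 0)
    (h : ∀ q ∈ PolyLE m, cellInt (K.points ∘ i.succAbove) (p * q) = 0) :
    ∀ x ∈ flat K {i}, eval x p = 0 := by
  set s := i.succAbove with hs
  have hsi : ∀ k, s k ≠ i := fun k => Fin.succAbove_ne i k
  have hss : ∀ {k k'}, k ≠ k' → s k ≠ s k' := fun h h' => h (Fin.succAbove_right_injective h')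
  have hn : ∀ k, s k ∉ ({i} : Finset (Fin 4)) := fun k => by simp [hsi]
  -- Splitting off one coordinate keeps the quotient zero on the other edges, where that coordinate
  -- is a nonzero divisor.
  have step : ∀ {m' : ℕ} {q r : Poly} (j k k' : Fin 3), j ≠ k → j ≠ k' → k ≠ k' →
      (∀ x ∈ flat K {i, s k}, eval x q = 0) →
      (∀ x ∈ flat K {i}, eval x q = eval x (bary K (s j)) * eval x r) → r ∈ PolyLE (m' + 1) →
      (∀ x ∈ flat K {i, s k}, eval x r = 0) := by
    intro m' q r j k k' hjk _ _ hq hqr _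
    refine eval_eq_zero_of_bary_mul (j := s j) (by simp [hsi, hss hjk]) fun x hx => ?_
    rw [← hqr x (mem_flat_singleton.2 (mem_flat_pair.1 hx).1), hq x hx]
  have hswap : ∀ j, ({i, j} : Finset (Fin 4)) = insert j {i} := fun j => Finset.pair_comm i j
  obtain ⟨r0, hr0, h1⟩ := exists_eq_bary_mul (K := K) (hn 0) (k := s 1)
    (by simp [hsi, hss]) hp (by rw [← hswap]; exact h0 _ (hsi 0))
  have hr01 := step 0 1 2 (by decide) (by decide) (by decide) (h0 _ (hsi 1)) h1 hr0
  have hr02 := step 0 2 1 (by decide) (by decide) (by decide) (h0 _ (hsi 2)) h1 hr0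
  obtain ⟨r1, hr1, h2⟩ := exists_eq_bary_mul (K := K) (hn 1) (k := s 0)
    (by simp [hsi, hss]) hr0 (by rw [← hswap]; exact hr01)
  have hr12 := step 1 2 0 (by decide) (by decide) (by decide) hr02 h2 hr1
  obtain ⟨r2, hr2, h3⟩ := exists_eq_bary_mul (K := K) (hn 2) (k := s 0)
    (by simp [hsi, hss]) hr1 (by rw [← hswap]; exact hr12)
  have hpr : ∀ x ∈ flat K {i}, eval x p =
      eval x (bary K (s 0) * bary K (s 1) * bary K (s 2) * r2) := by
    intro x hx
    rw [h1 x hx, h2 x hx, h3 x hx]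
    simp only [map_mul]
    ring
  have hz := eval_eq_zero_of_cellInt_mul_self (K := K) (Z := {i}) (s := s)
    Fin.succAbove_right_injective (fun j => by simp [hs])
    (w := bary K (s 0) * bary K (s 1) * bary K (s 2)) (p := r2)
    (fun x hx => by simp only [map_mul]; exact mul_nonneg (mul_nonneg (hx _) (hx _)) (hx _))
    (fun x hx => by
      simp only [map_mul]
      exact mul_pos (mul_pos (hx.2 _ (hn 0)) (hx.2 _ (hn 1))) (hx.2 _ (hn 2))) (by
      rw [← h r2 hr2]
      refine cellInt_congr hn fun x hx => ?_
      rw [map_mul, (eval x).map_mul p, hpr x hx]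
      simp only [map_mul]
      ring)
  intro x hx
  rw [hpr x hx, map_mul, hz x hx, mul_zero]

lemma IsEdgeNormalPair.cross_ne_zero {K : Tetrahedron} {e : Edge} {ν : Fin 2 → Vec}
    (h : IsEdgeNormalPair K e ν) : ν 0 ⨯₃ ν 1 ≠ 0 := by
  have h1 : ![ν 0, ν 1] = ν := by
    ext a
    fin_cases a <;> rfl
  rw [crossProduct_ne_zero_iff_linearIndependent, h1]
  exact h.2

lemma bilin_add_smul (a b c d : ℝ) (u v u' v' : Vec) (τ : PolyMat) (x : Vec) :
    eval x (bilin (a • u + b • v) τ (c • u' + d • v')) =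
      a * c * eval x (bilin u τ u') + a * d * eval x (bilin u τ v') +
        b * c * eval x (bilin v τ u') + b * d * eval x (bilin v τ v') := by
  simp only [eval_bilin_eq, mulVec_add, mulVec_smul, add_dotProduct, dotProduct_add,
    smul_dotProduct, dotProduct_smul, smul_eq_mul]
  ring

lemma edge_ne_zero (K : Tetrahedron) (e : Edge) : K.points e.1.2 - K.points e.1.1 ≠ 0 := fun h =>
  e.2.ne' (K.independent.injective (sub_eq_zero.1 h))

lemma IsFaceNormals.dotProduct_edge {K : Tetrahedron} {n : Fin 4 → Vec} (hn : IsFaceNormals K n)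
    {e : Edge} {i : Fin 4} (hi : i ∈ edgeFaces e) :
    n i ⬝ᵥ (K.points e.1.2 - K.points e.1.1) = 0 :=
  (hn i).2 _ _ (fun h => edgeIdx_not_mem e 1 (by rw [← h] at hi; exact hi))
    (fun h => edgeIdx_not_mem e 0 (by rw [← h] at hi; exact hi))

/-- Unisolvence of the boundary degrees of freedom. -/
theorem zeroTrace_of_bdry_eq_zero {K : Tetrahedron} {n : Fin 4 → Vec} (hn : IsFaceNormals K n)
    {ν : Edge → Fin 2 → Vec} (hν : ∀ e, IsEdgeNormalPair K e (ν e)) {m : ℕ} {τ : PolyMat}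
    (hτ : TraceDegree K n ν m τ) (h : bdry K n ν m τ = 0) : ZeroTrace K n τ := by
  rw [bdry_apply] at h
  simp only [Prod.mk_eq_zero] at h
  obtain ⟨hV, hE, hF, hS⟩ := h
  have hedge : ∀ e a b, ∀ x ∈ flat K (edgeFaces e), eval x (bilin (ν e a) τ (ν e b)) = 0 := by
    intro e a b
    obtain ⟨p, hp, hp'⟩ := hτ.edge e a b
    have := eval_eq_zero_of_edge hp (fun k => by
      have h0 := congrFun hV (edgeIdx e k)
      rw [← hp' _ (point_mem_flat K (edgeIdx_not_mem e k)), eval_bilin_eq, h0]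
      simp) (fun q hq => by
      have h0 := LinearMap.congr_fun (congrFun (congrFun (congrFun hE e) a) b) ⟨q, hq⟩
      rw [moment_apply] at h0
      refine (cellInt_congr (edgeIdx_not_mem e) fun x hx => ?_).trans h0
      rw [map_mul, map_mul, ← hp' x hx]
      rfl)
    exact fun x hx => (hp' x hx).trans (this x hx)
  have hline : ∀ i j, i ≠ j → ∀ i' ∈ ({i, j} : Finset (Fin 4)), ∀ j' ∈ ({i, j} : Finset (Fin 4)),
      ∀ x ∈ flat K {i, j}, eval x (bilin (n i') τ (n j')) = 0 := by
    intro i j hij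
    obtain ⟨e, he⟩ := exists_edgeFaces_eq hij
    rw [← he]
    intro i' hi' j' hj' x hx
    -- The two face normals at an edge lie in the span of the prescribed edge normals, so all their
    -- mixed components vanish there.
    have key : ∀ a ∈ edgeFaces e, ∃ c d : ℝ, n a = c • ν e 0 + d • ν e 1 := fun a ha =>
      exists_eq_add_of_cross_ne_zero (hν e).cross_ne_zero (edge_ne_zero K e) ((hν e).1 0).2
        ((hν e).1 1).2 (hn.dotProduct_edge ha)
    obtain ⟨a, b, hab⟩ := key i' hi'
    obtain ⟨c, d, hcd⟩ := key j' hj'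
    rw [hab, hcd, bilin_add_smul, hedge _ _ _ x hx, hedge _ _ _ x hx, hedge _ _ _ x hx,
      hedge _ _ _ x hx]
    simp
  refine ⟨fun i => ?_, fun i j hij => hline i j hij i (by simp) j (by simp), fun i => ?_⟩
  · obtain ⟨p, hp, hp'⟩ := hτ.face i
    have := eval_eq_zero_of_face_moment hp (fun j hj x hx => by
      rw [← hp' x (mem_flat_singleton.2 (mem_flat_pair.1 hx).1)]
      exact hline i j hj.symm i (by simp) i (by simp) x hx) (fun q hq => by
      have h0 := LinearMap.congr_fun (congrFun hF i) ⟨q, hq⟩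
      rw [moment_apply] at h0
      refine (cellInt_congr (Z := {i}) (fun k => by simp) fun x hx => ?_).trans h0
      rw [map_mul, map_mul, ← hp' x hx]
      rfl)
    exact fun x hx => (hp' x hx).trans (this x hx)
  · obtain ⟨p, hp, hp'⟩ := hτ.shear i
    have := eval_eq_zero_of_cellInt_mul_self (K := K) (s := i.succAbove) (Z := {i})
      Fin.succAbove_right_injective (fun j => by simp) (w := 1) (p := p) (by simp) (by simp) (by
      have h0 := LinearMap.congr_fun (congrFun hS i) ⟨p, hp⟩
      rw [moment_apply] at h0
      refine (cellInt_congr (Z := {i}) (fun k => by simp) fun x hx => ?_).trans h0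
      rw [one_mul, map_mul, map_mul]
      exact congrArg (· * _) (hp' x hx).symm)
    exact fun x hx => (hp' x hx).trans (this x hx)

/-- Face and edge traces control the vertex and edge values: at a vertex the three adjacent face
normals form a basis, and on an edge the prescribed normals are combinations of two face normals. -/
lemma bdry_eq_of_traces {K : Tetrahedron} {n : Fin 4 → Vec} (hn : IsFaceNormals K n)
    {ν : Edge → Fin 2 → Vec} (hν : ∀ e, IsEdgeNormalPair K e (ν e)) {m : ℕ} {τ : PolyMat}
    (hface : ∀ i, ∀ x ∈ flat K {i}, eval x (bilin (n i) τ (n i)) = 0)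
    (hedge : ∀ i j, i ≠ j → ∀ x ∈ flat K {i, j}, eval x (bilin (n i) τ (n j)) = 0) :
    bdry K n ν m τ =
      (0, 0, 0, fun i => moment (K.points ∘ i.succAbove) (m + 2) (shearMap (n i) τ)) := by
  rw [bdry_apply]
  refine Prod.ext (funext fun δ => ?_) (Prod.ext
    (funext fun e => funext fun a => funext fun b => ?_)
    (Prod.ext (funext fun i => ?_) rfl))
  · have h1 : ∀ i j, i ≠ δ → j ≠ δ →
        n i ⬝ᵥ (evalMat τ (K.points δ) *ᵥ n j) = 0 := by
      intro i j hi hj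
      rw [← eval_bilin_eq]
      rcases eq_or_ne i j with rfl | hij
      · exact hface i _ (point_mem_flat K (by simpa using hi.symm))
      · exact hedge i j hij _ (point_mem_flat K (by simp [hi.symm, hj.symm]))
    have h2 : ∀ j, j ≠ δ → evalMat τ (K.points δ) *ᵥ n j = 0 := fun j hj =>
      eq_zero_of_cov_dotProduct K δ fun i hi => hn.cov_dotProduct_eq_zero.2 (h1 i j hi hj)
    refine funext fun a => eq_zero_of_cov_dotProduct K δ fun j hj =>
      hn.cov_dotProduct_eq_zero.2 ?_
    rw [dotProduct_comm]
    exact congrFun (h2 j hj) a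
  · ext q
    obtain ⟨i, j, hij, he⟩ := edgeFaces_eq e
    have key : ∀ a, ∃ c d : ℝ, ν e a = c • n i + d • n j := fun a =>
      exists_eq_add_of_cross_ne_zero (hn.cross_ne_zero hij) (edge_ne_zero K e)
        (hn.dotProduct_edge (by simp [he])) (hn.dotProduct_edge (by simp [he])) ((hν e).1 a).2
    obtain ⟨a1, b1, h1⟩ := key a
    obtain ⟨a2, b2, h2⟩ := key b
    rw [moment_apply]
    refine cellInt_eq_zero (edgeIdx_not_mem e) fun x hx => ?_
    rw [he] at hx
    have hx' : x ∈ flat K {j, i} := by rwa [Finset.pair_comm]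
    rw [map_mul, bilinMap_apply, h1, h2, bilin_add_smul, hedge i j hij x hx,
      hedge j i hij.symm x hx', hface i x (mem_flat_singleton.2 (mem_flat_pair.1 hx).1),
      hface j x (mem_flat_singleton.2 (mem_flat_pair.1 hx).2)]
    simp
  · ext q
    rw [moment_apply]
    refine cellInt_eq_zero (Z := {i}) (fun k => by simp) fun x hx => ?_
    rw [map_mul, bilinMap_apply, hface i x hx, zero_mul]

lemma ZeroTrace.bdry_eq_zero {K : Tetrahedron} {n : Fin 4 → Vec} (hn : IsFaceNormals K n)
    {ν : Edge → Fin 2 → Vec} (hν : ∀ e, IsEdgeNormalPair K e (ν e)) {m : ℕ} {τ : PolyMat}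
    (h : ZeroTrace K n τ) : bdry K n ν m τ = 0 := by
  rw [bdry_eq_of_traces hn hν h.face h.edge]
  refine Prod.ext rfl (Prod.ext rfl (Prod.ext rfl (funext fun i => ?_)))
  ext q
  rw [moment_apply]
  refine cellInt_eq_zero (Z := {i}) (fun k => by simp) fun x hx => ?_
  rw [map_mul, shearMap_apply, h.shear i x hx, zero_mul]

/-! ### Prescribing the boundary degrees of freedom -/

/-- A functional is in the range of a family of functionals if it vanishes on its common kernel. -/
lemma exists_dual_eq {X Y : Type*} [AddCommGroup X] [Module ℝ X] [AddCommGroup Y] [Module ℝ Y]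
    [FiniteDimensional ℝ Y] (L : X →ₗ[ℝ] Module.Dual ℝ Y) (φ : Module.Dual ℝ Y)
    (h : ∀ y, (∀ x, L x y = 0) → φ y = 0) : ∃ x, L x = φ := by
  rw [← LinearMap.mem_range,
    ← Subspace.dualCoannihilator_dualAnnihilator_eq (W := LinearMap.range L),
    Submodule.mem_dualAnnihilator]
  intro y hy
  refine h y fun x => ?_
  rw [Submodule.mem_dualCoannihilator] at hy
  exact hy _ ⟨x, rfl⟩

lemma moment_apply_eq_zero {K : Tetrahedron} {d : ℕ} {s : Fin (d + 1) → Fin 4}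
    {Z : Finset (Fin 4)} (hs : ∀ k, s k ∉ Z) {m : ℕ} (p : Poly) {q : PolyLE m}
    (hq : ∀ x ∈ flat K Z, eval x (q : Poly) = 0) : moment (K.points ∘ s) m p q = 0 := by
  rw [moment_apply]
  exact cellInt_eq_zero hs fun x hx => by rw [map_mul, hq x hx, mul_zero]

lemma moment_congr {K : Tetrahedron} {d : ℕ} {s : Fin (d + 1) → Fin 4} {Z : Finset (Fin 4)}
    (hs : ∀ k, s k ∉ Z) (m : ℕ) {p p' : Poly} (h : ∀ x ∈ flat K Z, eval x p = eval x p') :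
    moment (K.points ∘ s) m p = moment (K.points ∘ s) m p' := by
  ext q
  rw [moment_apply, moment_apply]
  exact cellInt_congr hs fun x hx => by rw [map_mul, map_mul, h x hx]

lemma moment_eq_zero {K : Tetrahedron} {d : ℕ} {s : Fin (d + 1) → Fin 4} {Z : Finset (Fin 4)}
    (hs : ∀ k, s k ∉ Z) (m : ℕ) {p : Poly} (h : ∀ x ∈ flat K Z, eval x p = 0) :
    moment (K.points ∘ s) m p = 0 := by
  rw [moment_congr hs m (p' := 0) (by simpa using h), map_zero]

/-- Every functional on polynomials on a cell is represented by a weighted moment. -/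
lemma exists_moment_eq {K : Tetrahedron} {d : ℕ} {s : Fin (d + 1) → Fin 4}
    (hs : Function.Injective s) {Z : Finset (Fin 4)} (hZ : ∀ j, j ∉ Z ↔ j ∈ Set.range s)
    {w : Poly} (h0 : ∀ x, (∀ j, 0 ≤ eval x (bary K j)) → 0 ≤ eval x w)
    (h1 : ∀ x ∈ cell K Z, 0 < eval x w) {m : ℕ} (φ : Module.Dual ℝ (PolyLE m))
    (hφ : ∀ q : PolyLE m, (∀ x ∈ flat K Z, eval x (q : Poly) = 0) → φ q = 0) :
    ∃ r ∈ PolyLE m, moment (K.points ∘ s) m (w * r) = φ := by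
  -- By duality it suffices to treat q orthogonal to all w r. Taking r = q gives ∫ w q² = 0, so q
  -- vanishes on the flat.
  obtain ⟨r, hr⟩ := exists_dual_eq
    ((moment (K.points ∘ s) m ∘ₗ LinearMap.mulLeft ℝ w) ∘ₗ (PolyLE m).subtype) φ fun q hq =>
      hφ q (eval_eq_zero_of_cellInt_mul_self hs hZ h0 h1 (by
        have := hq q
        rwa [LinearMap.comp_apply, LinearMap.comp_apply, moment_apply, LinearMap.mulLeft_apply,
          mul_assoc] at this))
  exact ⟨r, r.2, hr⟩

/-- Symmetric tensor fields with entries of degree at most `m`. -/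
def symPoly (m : ℕ) : Submodule ℝ PolyMat where
  carrier := {τ | (∀ i j, τ i j ∈ PolyLE m) ∧ τ.IsSymm}
  add_mem' h h' := ⟨fun i j => add_mem (h.1 i j) (h'.1 i j), h.2.add h'.2⟩
  zero_mem' := ⟨fun _ _ => zero_mem _, Matrix.isSymm_zero⟩
  smul_mem' c _ h := ⟨fun i j => Submodule.smul_mem _ c (h.1 i j), h.2.smul c⟩

/-- The tensor field `f S` for a constant matrix `S`. -/
def scaled (f : Poly) (S : Mat) : PolyMat := Matrix.of fun i j => C (S i j) * f

lemma scaled_mem {m : ℕ} {f : Poly} (hf : f ∈ PolyLE m) {S : Mat} (hS : S.IsSymm) :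
    scaled f S ∈ symPoly m :=
  ⟨fun i j => polyLE_C_mul _ hf, Matrix.IsSymm.ext fun i j => by
    simp only [scaled, of_apply, hS.apply i j]⟩

lemma evalMat_scaled (f : Poly) (S : Mat) (x : Vec) :
    evalMat (scaled f S) x = eval x f • S := by
  ext i j
  simp [evalMat, scaled, mul_comm]

lemma eval_bilin_scaled (a b : Vec) (f : Poly) (S : Mat) (x : Vec) :
    eval x (bilin a (scaled f S) b) = eval x f * (a ⬝ᵥ S *ᵥ b) := by
  rw [eval_bilin_eq, evalMat_scaled, smul_mulVec, dotProduct_smul, smul_eq_mul]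

lemma bilin_scaled (a b : Vec) (f : Poly) (S : Mat) :
    bilin a (scaled f S) b = C (a ⬝ᵥ S *ᵥ b) * f := by
  apply MvPolynomial.funext
  intro x
  rw [eval_bilin_scaled, map_mul, eval_C, mul_comm]

lemma mulConst_scaled (n : Vec) (f : Poly) (S : Mat) (a : Fin 3) :
    mulConst (scaled f S) n a = C ((S *ᵥ n) a) * f := by
  simp only [mulConst, scaled, of_apply, mulVec, dotProduct, map_sum, Finset.sum_mul,
    smul_eq_C_mul, map_mul]
  exact Finset.sum_congr rfl fun j _ => by ring

lemma shearTrace_scaled (n : Vec) (f : Poly) (S : Mat) : shearTrace n (scaled f S) =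
    2 * dirDeriv (S *ᵥ n) f - C (n ⬝ᵥ S *ᵥ n) * dirDeriv n f := by
  rw [shearTrace_eq, bilin_scaled, ← smul_eq_C_mul, dirDeriv_smul, smul_eq_C_mul]
  congr 2
  simp only [divVec, mulConst_scaled, pderiv_C_mul, dirDeriv, smul_eq_C_mul]

/-- On the face only derivatives of λ_i survive, and 2 ∂_{Sn}λ_i - (nᵀSn) ∂_nλ_i = c nᵀSn. -/
lemma eval_shearTrace_scaled {K : Tetrahedron} {i : Fin 4} {n : Vec} (hn : n ⬝ᵥ n = 1) {c : ℝ}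
    (hc : cov K i = c • n) (g : Poly) (S : Mat) {x : Vec} (hx : x ∈ flat K {i}) :
    eval x (shearTrace n (scaled (bary K i * g) S)) = c * (n ⬝ᵥ S *ᵥ n) * eval x g := by
  rw [shearTrace_scaled, dirDeriv_mul, dirDeriv_mul, dirDeriv_bary, dirDeriv_bary, hc,
    smul_dotProduct, smul_dotProduct, hn]
  simp only [map_sub, map_mul, map_add, mem_flat_singleton.1 hx, eval_C, map_ofNat, smul_eq_mul]
  ring

/-- The symmetrized product `(u vᵀ + v uᵀ) / 2`. -/
def symProd (u v : Vec) : Mat := (1 / 2 : ℝ) • (vecMulVec u v + vecMulVec v u)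

lemma symProd_isSymm (u v : Vec) : (symProd u v).IsSymm := by
  refine Matrix.IsSymm.ext fun i j => ?_
  simp only [symProd, Matrix.smul_apply, Matrix.add_apply, vecMulVec_apply, smul_eq_mul]
  ring

lemma symProd_mulVec (u v b : Vec) :
    symProd u v *ᵥ b = (1 / 2 : ℝ) • ((v ⬝ᵥ b) • u + (u ⬝ᵥ b) • v) := by
  ext i
  simp [symProd, mulVec, dotProduct, vecMulVec_apply, Fin.sum_univ_three]
  ring

lemma dotProduct_symProd_mulVec (a u v b : Vec) : a ⬝ᵥ symProd u v *ᵥ b =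
    1 / 2 * ((a ⬝ᵥ u) * (b ⬝ᵥ v) + (a ⬝ᵥ v) * (b ⬝ᵥ u)) := by
  rw [symProd_mulVec, dotProduct_smul, dotProduct_add, dotProduct_smul, dotProduct_smul,
    dotProduct_comm b, dotProduct_comm b]
  simp only [smul_eq_mul]
  ring

/-- The tensor field `λ_i λ_j λ_k r sym (t_ij t_ikᵀ)` with `t_ij = v_i - v_j`. -/
def faceBubble (K : Tetrahedron) (i j k : Fin 4) (r : Poly) : PolyMat :=
  scaled (bary K i * (bary K j * bary K k * r))
    (symProd (K.points i - K.points j) (K.points i - K.points k))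

lemma faceBubble_mem (K : Tetrahedron) (i j k : Fin 4) {m : ℕ} {r : Poly} (hr : r ∈ PolyLE m) :
    faceBubble K i j k r ∈ symPoly (m + 3) := by
  refine scaled_mem (polyLE_bary_mul K i ?_) (symProd_isSymm _ _)
  rw [mul_assoc]
  exact polyLE_bary_mul K j (polyLE_bary_mul K k hr)

lemma IsFaceNormals.dotProduct_points_eq_zero {K : Tetrahedron} {n : Fin 4 → Vec}
    (hn : IsFaceNormals K n) {a i j : Fin 4} (hi : i ≠ a) (hj : j ≠ a) :
    n a ⬝ᵥ (K.points i - K.points j) = 0 := (hn a).2 _ _ hi hj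

lemma eval_bilin_faceBubble {K : Tetrahedron} {n : Fin 4 → Vec} (hn : IsFaceNormals K n)
    (i j k : Fin 4) (r : Poly) (a b : Fin 4) {x : Vec} (ha : eval x (bary K a) = 0)
    (hb : eval x (bary K b) = 0) : eval x (bilin (n a) (faceBubble K i j k r) (n b)) = 0 := by
  rw [faceBubble, eval_bilin_scaled]
  by_cases h : (a = i ∨ a = j ∨ a = k) ∨ (b = i ∨ b = j ∨ b = k)
  · refine mul_eq_zero_of_left ?_ _
    rcases h with (rfl | rfl | rfl) | (rfl | rfl | rfl) <;> simp [ha, hb]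
  · simp only [not_or] at h
    obtain ⟨⟨h1, h2, h3⟩, h4, h5, h6⟩ := h
    rw [dotProduct_symProd_mulVec, hn.dotProduct_points_eq_zero (Ne.symm h1) (Ne.symm h2),
      hn.dotProduct_points_eq_zero (Ne.symm h1) (Ne.symm h3)]
    simp

/-- If a is neither j nor k, the constant matrix annihilates n_a. If a is exactly one of them, nᵀSn
= 0 because the other edge vector is tangential. If a = j = k, the scalar factor has a double zero.
-/
lemma eval_shearTrace_faceBubble_of_ne {K : Tetrahedron} {n : Fin 4 → Vec}
    (hn : IsFaceNormals K n) {i j k : Fin 4} (r : Poly) {a : Fin 4} (hai : i ≠ a)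
    {x : Vec} (hx : x ∈ flat K {a}) : eval x (shearTrace (n a) (faceBubble K i j k r)) = 0 := by
  obtain ⟨c, -, hc⟩ := (hn a).exists_cov_eq
  have hx0 := mem_flat_singleton.1 hx
  by_cases hj : j = a
  · subst hj
    have h1 : bary K i * (bary K j * bary K k * r) = bary K j * (bary K i * bary K k * r) := by
      ring
    rw [faceBubble, h1, eval_shearTrace_scaled (hn j).1 hc _ _ hx, dotProduct_symProd_mulVec]
    by_cases hk : k = j
    · subst hk
      simp [hx0]
    · rw [hn.dotProduct_points_eq_zero hai hk]
      simp
  · by_cases hk : k = a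
    · subst hk
      have h1 : bary K i * (bary K j * bary K k * r) = bary K k * (bary K i * bary K j * r) := by
        ring
      rw [faceBubble, h1, eval_shearTrace_scaled (hn k).1 hc _ _ hx, dotProduct_symProd_mulVec,
        hn.dotProduct_points_eq_zero hai hj]
      simp
    · rw [faceBubble, shearTrace_scaled, dotProduct_symProd_mulVec, symProd_mulVec,
        dotProduct_comm _ (n a), dotProduct_comm _ (n a), hn.dotProduct_points_eq_zero hai hj,
        hn.dotProduct_points_eq_zero hai hk]
      simp [dirDeriv]

lemma exists_eval_shearTrace_faceBubble {K : Tetrahedron} {n : Fin 4 → Vec}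
    (hn : IsFaceNormals K n) (i : Fin 4) : ∃ c : ℝ, c ≠ 0 ∧ ∀ j k, j ≠ i → k ≠ i → ∀ r : Poly,
      ∀ x ∈ flat K {i}, eval x (shearTrace (n i) (faceBubble K i j k r)) =
        c * (eval x (bary K j) * eval x (bary K k) * eval x r) := by
  obtain ⟨c, hc0, hc⟩ := (hn i).exists_cov_eq
  refine ⟨c⁻¹, inv_ne_zero hc0, fun j k hj hk r x hx => ?_⟩
  have h1 : ∀ j, j ≠ i → n i ⬝ᵥ (K.points i - K.points j) = c⁻¹ := by
    intro j hj
    have := cov_dotProduct_points K i i j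
    rw [hc, smul_dotProduct, if_pos rfl, if_neg hj.symm, sub_zero, smul_eq_mul] at this
    exact eq_inv_of_mul_eq_one_right this
  rw [faceBubble, eval_shearTrace_scaled (hn i).1 hc _ _ hx, dotProduct_symProd_mulVec, h1 j hj,
    h1 k hk]
  simp only [map_mul]
  field_simp
  ring

/-- Admissible values of the boundary degrees of freedom. -/
def bdryData (K : Tetrahedron) (m : ℕ) : Submodule ℝ (BdryData m) where
  carrier := {g | (∀ δ, (g.1 δ).IsSymm) ∧ (∀ e a b, g.2.1 e a b = g.2.1 e b a) ∧
    (∀ e a b, ∀ q : PolyLE (m + 1), (∀ x ∈ flat K (edgeFaces e), eval x (q : Poly) = 0) →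
      g.2.1 e a b q = 0) ∧
    (∀ i, ∀ q : PolyLE m, (∀ x ∈ flat K {i}, eval x (q : Poly) = 0) → g.2.2.1 i q = 0) ∧
    (∀ i, ∀ q : PolyLE (m + 2), (∀ x ∈ flat K {i}, eval x (q : Poly) = 0) → g.2.2.2 i q = 0)}
  add_mem' := by
    rintro g g' ⟨h1, h2, h3, h4, h5⟩ ⟨h1', h2', h3', h4', h5'⟩
    exact ⟨fun δ => (h1 δ).add (h1' δ), fun e a b => congrArg₂ (· + ·) (h2 e a b) (h2' e a b),
      fun e a b q hq => by simp [h3 e a b q hq, h3' e a b q hq],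
      fun i q hq => by simp [h4 i q hq, h4' i q hq],
      fun i q hq => by simp [h5 i q hq, h5' i q hq]⟩
  zero_mem' := ⟨fun _ => Matrix.isSymm_zero, fun _ _ _ => rfl, fun _ _ _ _ _ => rfl,
    fun _ _ _ => rfl, fun _ _ _ => rfl⟩
  smul_mem' := by
    rintro c g ⟨h1, h2, h3, h4, h5⟩
    exact ⟨fun δ => (h1 δ).smul c, fun e a b => congrArg (c • ·) (h2 e a b),
      fun e a b q hq => by simp [h3 e a b q hq],
      fun i q hq => by simp [h4 i q hq],
      fun i q hq => by simp [h5 i q hq]⟩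

lemma evalMat_isSymm {τ : PolyMat} (h : τ.IsSymm) (x : Vec) : (evalMat τ x).IsSymm :=
  h.map _

lemma bdry_mem {K : Tetrahedron} (n : Fin 4 → Vec) (ν : Edge → Fin 2 → Vec) (m : ℕ)
    {τ : PolyMat} (h : τ.IsSymm) : bdry K n ν m τ ∈ bdryData K m := by
  rw [bdry_apply]
  refine ⟨fun δ => evalMat_isSymm h _, fun e a b => ?_, fun e a b q hq => ?_, fun i q hq => ?_,
    fun i q hq => ?_⟩
  · have h1 : bilin (ν e a) τ (ν e b) = bilin (ν e b) τ (ν e a) := by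
      apply MvPolynomial.funext
      intro x
      rw [eval_bilin_eq, eval_bilin_eq, dotProduct_mulVec, dotProduct_comm, ← mulVec_transpose,
        evalMat_isSymm h x]
    exact congrArg (moment (K.points ∘ edgeIdx e) (m + 1)) h1
  · exact moment_apply_eq_zero (edgeIdx_not_mem e) _ hq
  · exact moment_apply_eq_zero (Z := {i}) (fun k => by simp) _ hq
  · exact moment_apply_eq_zero (Z := {i}) (fun k => by simp) _ hq

lemma evalMat_sum {ι : Type*} (s : Finset ι) (f : ι → PolyMat) (x : Vec) :
    evalMat (∑ i ∈ s, f i) x = ∑ i ∈ s, evalMat (f i) x :=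
  map_sum (AddMonoidHom.mk' (fun τ => evalMat τ x) fun σ τ => evalMat_add σ τ x) f s

lemma exists_bdry_vertex (K : Tetrahedron) (n : Fin 4 → Vec) (ν : Edge → Fin 2 → Vec) {m : ℕ}
    {g : BdryData m} (hg : g ∈ bdryData K m) :
    ∃ τ ∈ symPoly (m + 3), (bdry K n ν m τ).1 = g.1 := by
  refine ⟨∑ δ, scaled (bary K δ) (g.1 δ), Submodule.sum_mem _ fun δ _ =>
    scaled_mem (polyLE_mono (by omega) (polyLE_bary K δ)) (hg.1 δ), funext fun δ => ?_⟩
  rw [bdry_apply]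
  simp only [evalMat_sum, evalMat_scaled]
  rw [Finset.sum_eq_single δ (fun j _ hj => by rw [eval_bary_point, if_neg hj, zero_smul])
    (fun h => absurd (Finset.mem_univ _) h), eval_bary_point, if_pos rfl, one_smul]

lemma IsEdgeNormalPair.exists_dual {K : Tetrahedron} {e : Edge} {ν : Fin 2 → Vec}
    (h : IsEdgeNormalPair K e ν) :
    ∃ μ : Fin 2 → Vec, ∀ a b, ν a ⬝ᵥ μ b = if a = b then 1 else 0 := by
  set N := ν 0 ⨯₃ ν 1 with hN
  have hN0 : N ⬝ᵥ N ≠ 0 := fun h' => h.cross_ne_zero (dotProduct_self_eq_zero.1 h')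
  have h1 : ν 0 ⬝ᵥ ν 1 ⨯₃ N = N ⬝ᵥ N := by
    rw [triple_product_permutation, triple_product_permutation, ← hN]
  have h2 : ν 1 ⬝ᵥ N ⨯₃ ν 0 = N ⬝ᵥ N := by
    rw [triple_product_permutation, ← hN]
  refine ⟨![(N ⬝ᵥ N)⁻¹ • (ν 1 ⨯₃ N), (N ⬝ᵥ N)⁻¹ • (N ⨯₃ ν 0)], fun a b => ?_⟩
  fin_cases a <;> fin_cases b <;> simp [dotProduct_smul, h1, h2, hN0]

lemma mem_edgeFaces_of_ne {e e' : Edge} (h : e ≠ e') :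
    e.1.1 ∈ edgeFaces e' ∨ e.1.2 ∈ edgeFaces e' := by
  revert e e'
  decide

/-- Edge bubbles vanish at the vertices and on the other edges. Symmetrized products of the basis
dual to ν pick out single entries, and symmetry of the data joins the two halves. -/
lemma exists_bdry_edge {K : Tetrahedron} (n : Fin 4 → Vec) {ν : Edge → Fin 2 → Vec}
    (hν : ∀ e, IsEdgeNormalPair K e (ν e)) {m : ℕ} {g : BdryData m} (hg : g ∈ bdryData K m) :
    ∃ τ ∈ symPoly (m + 3), (bdry K n ν m τ).1 = 0 ∧ (bdry K n ν m τ).2.1 = g.2.1 := by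
  have h1 : ∀ e a b, ∃ r ∈ PolyLE (m + 1), moment (K.points ∘ edgeIdx e) (m + 1)
      (bary K e.1.1 * bary K e.1.2 * r) = g.2.1 e a b := fun e a b =>
    exists_moment_eq (edgeIdx_injective e) (Z := edgeFaces e) (fun j => not_mem_edgeFaces)
      (fun x hx => by rw [map_mul]; exact mul_nonneg (hx _) (hx _))
      (fun x hx => by
        rw [map_mul]
        exact mul_pos (hx.2 _ (edgeIdx_not_mem e 0)) (hx.2 _ (edgeIdx_not_mem e 1)))
      _ (hg.2.2.1 e a b)
  choose r hr hr' using h1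
  choose μ hμ using fun e => (hν e).exists_dual
  refine ⟨∑ e : Edge, ∑ a, ∑ b, scaled (bary K e.1.1 * bary K e.1.2 * r e a b)
    (symProd (μ e a) (μ e b)), Submodule.sum_mem _ fun e _ => Submodule.sum_mem _ fun a _ =>
    Submodule.sum_mem _ fun b _ => scaled_mem ?_ (symProd_isSymm _ _), funext fun δ => ?_,
    funext fun e => funext fun a => funext fun b => ?_⟩
  · rw [mul_assoc]
    exact polyLE_bary_mul K _ (polyLE_bary_mul K _ (hr e a b))
  · rw [bdry_apply]
    simp only [evalMat_sum, evalMat_scaled]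
    refine Finset.sum_eq_zero fun e _ => Finset.sum_eq_zero fun a _ =>
      Finset.sum_eq_zero fun b _ => ?_
    rw [map_mul, map_mul, eval_bary_point, eval_bary_point]
    by_cases h : e.1.1 = δ
    · rw [if_neg (c := e.1.2 = δ) (fun h2 => e.2.ne (h.trans h2.symm))]
      simp
    · rw [if_neg h]
      simp
  · rw [bdry_apply]
    simp only [map_sum, bilinMap_apply, bilin_scaled, ← smul_eq_C_mul, map_smul]
    rw [Finset.sum_eq_single e]
    · simp only [hr', dotProduct_symProd_mulVec, hμ]
      have := hg.2.1 e
      fin_cases a <;> fin_cases b <;> simp [Fin.sum_univ_two, this 1 0, ← add_smul] <;> norm_num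
    · intro e' _ he'
      refine Finset.sum_eq_zero fun a' _ => Finset.sum_eq_zero fun b' _ => ?_
      rw [moment_eq_zero (edgeIdx_not_mem e) _ fun x hx => ?_, smul_zero]
      rcases mem_edgeFaces_of_ne he' with h | h <;> simp [hx _ h]
    · exact fun h => absurd (Finset.mem_univ _) h

lemma exists_mem_edgeFaces (e : Edge) (i : Fin 4) : ∃ k : Fin 3, i.succAbove k ∈ edgeFaces e := by
  revert e i
  decide

/-- The product of the three coordinates of a face vanishes on all edges and on the other faces, so
multiples of n nᵀ adjust each face independently. -/
lemma exists_bdry_face {K : Tetrahedron} {n : Fin 4 → Vec} (hn : IsFaceNormals K n)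
    (ν : Edge → Fin 2 → Vec) {m : ℕ} {g : BdryData m} (hg : g ∈ bdryData K m) :
    ∃ τ ∈ symPoly (m + 3), (bdry K n ν m τ).1 = 0 ∧ (bdry K n ν m τ).2.1 = 0 ∧
      (bdry K n ν m τ).2.2.1 = g.2.2.1 := by
  set w : Fin 4 → Poly := fun i => ∏ k : Fin 3, bary K (i.succAbove k) with hw
  have hwk : ∀ i (k : Fin 3) (x : Vec), eval x (bary K (i.succAbove k)) = 0 →
      eval x (w i) = 0 := fun i k x h => by
    rw [hw, map_prod]
    exact Finset.prod_eq_zero (Finset.mem_univ k) h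
  have h1 : ∀ i, ∃ r ∈ PolyLE m, moment (K.points ∘ i.succAbove) m (w i * r) = g.2.2.1 i :=
    fun i => exists_moment_eq Fin.succAbove_right_injective (Z := {i}) (fun j => by simp)
      (fun x hx => by rw [hw, map_prod]; exact Finset.prod_nonneg fun k _ => hx _)
      (fun x hx => by
        rw [hw, map_prod]
        exact Finset.prod_pos fun k _ => hx.2 _ (by simp))
      _ (hg.2.2.2.1 i)
  choose r hr hr' using h1
  refine ⟨∑ i, scaled (w i * r i) (symProd (n i) (n i)), Submodule.sum_mem _ fun i _ =>
    scaled_mem ?_ (symProd_isSymm _ _), funext fun δ => ?_,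
    funext fun e => funext fun a => funext fun b => ?_, funext fun i => ?_⟩
  · rw [hw]
    simp only [Fin.prod_univ_three, mul_assoc]
    exact polyLE_bary_mul K _ (polyLE_bary_mul K _ (polyLE_bary_mul K _ (hr i)))
  · rw [bdry_apply]
    simp only [evalMat_sum, evalMat_scaled]
    refine Finset.sum_eq_zero fun i _ => ?_
    obtain ⟨j, hj, hj'⟩ := exists_ne_ne i δ
    obtain ⟨k, rfl⟩ := Fin.exists_succAbove_eq hj
    rw [map_mul, hwk i k _ (by rw [eval_bary_point, if_neg hj']), zero_mul, zero_smul]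
  · rw [bdry_apply]
    simp only [map_sum, bilinMap_apply, bilin_scaled, ← smul_eq_C_mul, map_smul]
    refine Finset.sum_eq_zero fun i _ => ?_
    obtain ⟨k, hk⟩ := exists_mem_edgeFaces e i
    rw [moment_eq_zero (edgeIdx_not_mem e) _ fun x hx => ?_, smul_zero]
    rw [map_mul, hwk i k x (hx _ hk), zero_mul]
  · rw [bdry_apply]
    simp only [map_sum, bilinMap_apply, bilin_scaled, ← smul_eq_C_mul, map_smul]
    rw [Finset.sum_eq_single i]
    · rw [hr', dotProduct_symProd_mulVec, (hn i).1]
      norm_num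
    · intro i' _ hi'
      obtain ⟨k, hk⟩ := Fin.exists_succAbove_eq hi'.symm
      rw [moment_eq_zero (Z := {i}) (fun k => by simp) _ fun x hx => ?_, smul_zero]
      rw [map_mul, hwk i' k x (by rw [hk]; exact mem_flat_singleton.1 hx), zero_mul]
    · exact fun h => absurd (Finset.mem_univ _) h

/-- On a face plane every polynomial is a combination of the barycentric coordinates. -/
lemma exists_eq_sum_bary_mul (K : Tetrahedron) (i : Fin 4) {m : ℕ} {p : Poly}
    (hp : p ∈ PolyLE (m + 1)) : ∃ r : Fin 3 → Poly, (∀ k, r k ∈ PolyLE m) ∧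
      ∀ x ∈ flat K {i}, eval x p = ∑ k, eval x (bary K (i.succAbove k)) * eval x (r k) := by
  obtain ⟨c, r, hr, rfl⟩ := exists_eq_C_add_sum_X_mul hp
  refine ⟨fun k => C c + ∑ a, C (K.points (i.succAbove k) a) * r a, fun k =>
    add_mem (polyLE_C _ _) (Submodule.sum_mem _ fun a _ => polyLE_C_mul _ (hr a)),
    fun x hx => ?_⟩
  have h0 := mem_flat_singleton.1 hx
  have h1 := sum_eval_bary K x
  have h2 := sum_eval_bary_smul K x
  rw [Fin.sum_univ_succAbove _ i, h0, zero_add] at h1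
  rw [Fin.sum_univ_succAbove _ i, h0, zero_smul, zero_add] at h2
  have h3 : ∀ a, x a = ∑ k, eval x (bary K (i.succAbove k)) * K.points (i.succAbove k) a := by
    intro a
    conv_lhs => rw [← h2]
    simp
  simp only [map_add, map_sum, map_mul, eval_C, eval_X, mul_add, Finset.sum_add_distrib,
    ← Finset.sum_mul, h1, one_mul, Finset.mul_sum]
  congr 1
  rw [Finset.sum_comm]
  refine Finset.sum_congr rfl fun a _ => ?_
  conv_lhs => rw [h3 a, Finset.sum_mul]
  exact Finset.sum_congr rfl fun k _ => by ring

/-- On a face, a polynomial of degree m + 2 is a quadratic form in the barycentric coordinates with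
coefficients of degree m. Each term λ_j λ_k t is, up to a constant, the shear trace of a face bubble
that has no other traces. -/
lemma exists_bdry_shear {K : Tetrahedron} {n : Fin 4 → Vec} (hn : IsFaceNormals K n)
    {ν : Edge → Fin 2 → Vec} (hν : ∀ e, IsEdgeNormalPair K e (ν e)) {m : ℕ} {g : BdryData m}
    (hg : g ∈ bdryData K m) :
    ∃ τ ∈ symPoly (m + 3), bdry K n ν m τ = (0, 0, 0, g.2.2.2) := by
  choose c hc0 hc using exists_eval_shearTrace_faceBubble hn
  have h1 : ∀ i, ∃ s ∈ PolyLE (m + 2), moment (K.points ∘ i.succAbove) (m + 2) (1 * s) =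
      (c i)⁻¹ • g.2.2.2 i :=
    fun i => exists_moment_eq Fin.succAbove_right_injective (Z := {i}) (fun j => by simp)
      (by simp) (by simp) _ fun q hq => by
        rw [LinearMap.smul_apply, hg.2.2.2.2 i q hq, smul_zero]
  choose s hs hs' using h1
  choose r hr hr' using fun i => exists_eq_sum_bary_mul K i (hs i)
  choose t ht ht' using fun i j => exists_eq_sum_bary_mul K i (hr i j)
  refine ⟨∑ i, ∑ j, ∑ k, faceBubble K i (i.succAbove j) (i.succAbove k) (t i j k),
    Submodule.sum_mem _ fun i _ => Submodule.sum_mem _ fun j _ => Submodule.sum_mem _ fun k _ =>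
      faceBubble_mem K _ _ _ (ht i j k), ?_⟩
  rw [bdry_eq_of_traces hn hν]
  · refine Prod.ext rfl (Prod.ext rfl (Prod.ext rfl (funext fun i => ?_)))
    have h2 : g.2.2.2 i = moment (K.points ∘ i.succAbove) (m + 2) (c i • s i) := by
      rw [map_smul, ← one_mul (s i), hs', smul_smul, mul_inv_cancel₀ (hc0 i), one_smul]
    simp only [h2]
    refine moment_congr (Z := {i}) (fun k => by simp) _ fun x hx => ?_
    simp only [map_sum, shearMap_apply]
    rw [Finset.sum_eq_single i]
    · rw [smul_eval, hr' i x hx, Finset.mul_sum]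
      refine Finset.sum_congr rfl fun j _ => ?_
      rw [ht' i j x hx, Finset.mul_sum, Finset.mul_sum]
      refine Finset.sum_congr rfl fun k _ => ?_
      rw [hc i _ _ (Fin.succAbove_ne i j) (Fin.succAbove_ne i k) _ x hx]
      ring
    · exact fun i' _ hi' => Finset.sum_eq_zero fun j _ => Finset.sum_eq_zero fun k _ =>
        eval_shearTrace_faceBubble_of_ne hn _ hi' hx
    · exact fun h => absurd (Finset.mem_univ _) h
  · intro i x hx
    simp only [← bilinMap_apply, map_sum]
    exact Finset.sum_eq_zero fun i _ => Finset.sum_eq_zero fun j _ => Finset.sum_eq_zero fun k _ =>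
      eval_bilin_faceBubble hn _ _ _ _ _ _ (mem_flat_singleton.1 hx) (mem_flat_singleton.1 hx)
  · intro i j _ x hx
    simp only [← bilinMap_apply, map_sum]
    exact Finset.sum_eq_zero fun i _ => Finset.sum_eq_zero fun j _ => Finset.sum_eq_zero fun k _ =>
      eval_bilin_faceBubble hn _ _ _ _ _ _ (mem_flat_pair.1 hx).1 (mem_flat_pair.1 hx).2

/-- The boundary degrees of freedom of symmetric tensor fields take all admissible values. -/
theorem exists_bdry_eq {K : Tetrahedron} {n : Fin 4 → Vec} (hn : IsFaceNormals K n)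
    {ν : Edge → Fin 2 → Vec} (hν : ∀ e, IsEdgeNormalPair K e (ν e)) {m : ℕ} {g : BdryData m}
    (hg : g ∈ bdryData K m) : ∃ τ ∈ symPoly (m + 3), bdry K n ν m τ = g := by
  -- Each stage leaves the data of the earlier stages alone, so it only has to correct the residual.
  obtain ⟨τ₁, h₁, e₁⟩ := exists_bdry_vertex K n ν hg
  have hg₁ := sub_mem hg (bdry_mem n ν m h₁.2 (K := K))
  obtain ⟨τ₂, h₂, e₂, e₂'⟩ := exists_bdry_edge n hν hg₁
  have hg₂ := sub_mem hg₁ (bdry_mem n ν m h₂.2 (K := K))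
  obtain ⟨τ₃, h₃, e₃, e₃', e₃''⟩ := exists_bdry_face hn ν hg₂
  have hg₃ := sub_mem hg₂ (bdry_mem n ν m h₃.2 (K := K))
  obtain ⟨τ₄, h₄, e₄⟩ := exists_bdry_shear hn hν hg₃
  refine ⟨τ₁ + τ₂ + τ₃ + τ₄, add_mem (add_mem (add_mem h₁ h₂) h₃) h₄, ?_⟩
  rw [map_add, map_add, map_add, e₄]
  refine Prod.ext ?_ (Prod.ext ?_ (Prod.ext ?_ ?_))
  · simp [e₁, e₂, e₃]
  · simp [e₂', e₃']
  · simp [e₃'']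
  · simp

/-! ### The range of `div div` on tensor fields with vanishing traces -/

/-- Applying Euler's identity twice shows that the weight d(d - 1) kills y. -/
lemma polyLE_one_of_hess {y : Poly} (h : hess y = 0) : y ∈ PolyLE 1 := by
  have h1 : ∀ b, wt (fun d => d) (pderiv b y) = 0 := fun b => by
    rw [← sum_X_mul_pderiv_eq_wt]
    exact Finset.sum_eq_zero fun a _ => by rw [← hess_apply, h, Matrix.zero_apply, mul_zero]
  have h2 : wt (fun d => (d : ℝ) - 1) (wt (fun d => d) y) = 0 := by
    rw [← sum_X_mul_pderiv_eq_wt, map_sum]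
    refine Finset.sum_eq_zero fun b _ => ?_
    rw [wt_X_mul]
    simp [h1]
  rw [mem_polyLE_iff]
  intro s hs
  have h3 := congrArg (coeff s) h2
  rw [coeff_wt, coeff_wt, coeff_zero, ← mul_assoc] at h3
  have hs' : (1 : ℝ) < s.degree := by exact_mod_cast hs
  exact (mul_eq_zero.1 h3).resolve_left (mul_pos (by linarith) (by linarith)).ne'

lemma hess_eq_zero_of_polyLE_one {y : Poly} (h : y ∈ PolyLE 1) : hess y = 0 := by
  obtain ⟨c, r, hr, rfl⟩ := exists_eq_C_add_sum_X_mul (m := 0) h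
  have hr0 : ∀ a b, pderiv b (r a) = 0 := fun a b => by
    have h0 : (r a).totalDegree = 0 := Nat.le_zero.1 ((mem_restrictTotalDegree _ _ _).1 (hr a))
    rw [totalDegree_eq_zero_iff_eq_C.1 h0, pderiv_C]
  ext1 i j
  simp only [hess_apply, map_add, map_sum, pderiv_C, pderiv_mul, hr0, mul_zero, add_zero, zero_add,
    Matrix.zero_apply]
  refine Finset.sum_eq_zero fun a _ => ?_
  rw [pderiv_X, Pi.single_apply]
  split_ifs <;> simp

/-- The pointwise inner product of tensor fields. -/
def ddot : PolyMat →ₗ[ℝ] PolyMat →ₗ[ℝ] Poly :=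
  LinearMap.mk₂ ℝ (fun τ ς => ∑ i, ∑ j, τ i j * ς i j)
    (fun τ τ' ς => by simp [add_mul, Finset.sum_add_distrib])
    (fun c τ ς => by simp [Finset.smul_sum])
    (fun τ ς ς' => by simp [mul_add, Finset.sum_add_distrib])
    (fun c τ ς => by simp [Finset.smul_sum])

lemma ddot_apply (τ ς : PolyMat) : ddot τ ς = ∑ i, ∑ j, τ i j * ς i j := rfl

lemma ddot_scaled_symProd (f : Poly) (t : Vec) (y : Poly) :
    ddot (scaled f (symProd t t)) (hess y) = f * bilin t (hess y) t := by
  simp only [ddot_apply, bilin, mulConst, Finset.smul_sum, Finset.mul_sum]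
  refine Finset.sum_congr rfl fun i _ => Finset.sum_congr rfl fun j _ => ?_
  simp only [scaled, symProd, of_apply, Matrix.smul_apply, Matrix.add_apply, vecMulVec_apply,
    smul_eq_C_mul, smul_eq_mul]
  rw [show 1 / 2 * (t i * t j + t i * t j) = t i * t j by ring, map_mul]
  ring

lemma hess_isSymm (y : Poly) : (hess y).IsSymm :=
  Matrix.IsSymm.ext fun i j => by rw [hess_apply, hess_apply, pderiv_comm]

lemma eq_zero_of_eval_flat_empty {K : Tetrahedron} {p : Poly}
    (h : ∀ x ∈ flat K ∅, eval x p = 0) : p = 0 :=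
  MvPolynomial.funext fun x => by rw [h x (by simp [flat]), map_zero]

lemma eq_zero_of_cellInt_mul_self {K : Tetrahedron} {w p : Poly}
    (h0 : ∀ x, (∀ j, 0 ≤ eval x (bary K j)) → 0 ≤ eval x w)
    (h1 : ∀ x ∈ cell K ∅, 0 < eval x w) (h : cellInt K.points (w * (p * p)) = 0) : p = 0 :=
  eq_zero_of_eval_flat_empty (K := K) (eval_eq_zero_of_cellInt_mul_self (s := id)
    Function.injective_id (fun j => by simp) h0 h1 h)

/-- A symmetric matrix is determined by its values on the six edge directions. -/
lemma eq_zero_of_edges (K : Tetrahedron) {A : Mat} (hA : A.IsSymm)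
    (h : ∀ i j, i ≠ j →
      (K.points i - K.points j) ⬝ᵥ (A *ᵥ (K.points i - K.points j)) = 0) : A = 0 := by
  have h' : ∀ i j, (K.points i - K.points j) ⬝ᵥ (A *ᵥ (K.points i - K.points j)) = 0 := by
    intro i j
    rcases eq_or_ne i j with rfl | hij
    · simp
    · exact h i j hij
  have hs : ∀ u v : Vec, u ⬝ᵥ (A *ᵥ v) = v ⬝ᵥ (A *ᵥ u) := fun u v => by
    rw [dotProduct_mulVec, dotProduct_comm, ← mulVec_transpose, hA]
  have h1 : ∀ i j, (K.points i - K.points 0) ⬝ᵥ (A *ᵥ (K.points j - K.points 0)) = 0 := by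
    intro i j
    have e1 := h' i j
    rw [← sub_sub_sub_cancel_right _ _ (K.points 0), mulVec_sub, sub_dotProduct, dotProduct_sub,
      dotProduct_sub, h' i 0, h' j 0, hs (K.points j - K.points 0)] at e1
    linarith
  have h2 : ∀ j, A *ᵥ (K.points j - K.points 0) = 0 := by
    intro j
    rw [eq_sum_smul_cov K 0 (A *ᵥ _)]
    refine Finset.sum_eq_zero fun i _ => ?_
    rw [dotProduct_comm, h1, zero_smul]
  refine funext fun i => (eq_sum_smul_cov K 0 (A i)).trans (Finset.sum_eq_zero fun j _ => ?_)
  rw [show A i ⬝ᵥ (K.points j - K.points 0) = 0 from congrFun (h2 j) i, zero_smul]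

/-- The only trace a face bubble has is the shear trace on face i, and the extra factor λ_i removes
it. -/
lemma zeroTrace_faceBubble {K : Tetrahedron} {n : Fin 4 → Vec} (hn : IsFaceNormals K n)
    {i j : Fin 4} (hij : i ≠ j) (b : Poly) :
    ZeroTrace K n (faceBubble K i j j (bary K i * b)) := by
  refine ⟨fun a x hx => ?_, fun a c _ x hx => ?_, fun a x hx => ?_⟩
  · exact eval_bilin_faceBubble hn _ _ _ _ _ _ (mem_flat_singleton.1 hx)
      (mem_flat_singleton.1 hx)
  · exact eval_bilin_faceBubble hn _ _ _ _ _ _ (mem_flat_pair.1 hx).1 (mem_flat_pair.1 hx).2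
  · rcases eq_or_ne i a with rfl | ha
    · obtain ⟨c, -, hc⟩ := exists_eval_shearTrace_faceBubble hn i
      rw [hc j j hij.symm hij.symm _ x hx, map_mul, mem_flat_singleton.1 hx]
      simp
    · exact eval_shearTrace_faceBubble_of_ne hn _ ha hx

/-- A polynomial orthogonal to the range of `div div` has vanishing second derivatives along the
edges. -/
lemma bilin_hess_eq_zero {K : Tetrahedron} {n : Fin 4 → Vec} (hn : IsFaceNormals K n) {m : ℕ}
    {y : Poly} (hy : y ∈ PolyLE (m + 2)) (h : ∀ β ∈ symPoly (m + 4), ZeroTrace K n β →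
      cellInt K.points (divDiv β * y) = 0) {i j : Fin 4} (hij : i ≠ j) :
    bilin (K.points i - K.points j) (hess y) (K.points i - K.points j) = 0 := by
  -- With t the edge vector, b is the second derivative of y along t. Testing with β = λ_i² λ_j² b t
  -- tᵀ, Green's identity gives ∫ λ_i² λ_j² b² = 0.
  set b := bilin (K.points i - K.points j) (hess y) (K.points i - K.points j) with hb
  have hbm : b ∈ PolyLE m := polyLE_bilin (fun a c => polyLE_pderiv a (polyLE_pderiv c hy)) _ _
  have hβm := faceBubble_mem K i j j (polyLE_bary_mul K i hbm)
  have hβz := zeroTrace_faceBubble hn hij b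
  have h1 := h _ hβm hβz
  rw [cellInt_divDiv_mul hn hβm.2 hβz, ← ddot_apply, faceBubble, ddot_scaled_symProd, ← hb] at h1
  refine eq_zero_of_cellInt_mul_self (K := K)
    (w := bary K i * bary K i * (bary K j * bary K j)) (fun x _ => ?_) (fun x hx => ?_) ?_
  · simp only [map_mul]
    exact mul_nonneg (mul_self_nonneg _) (mul_self_nonneg _)
  · have hi := hx.2 i (by simp)
    have hj := hx.2 j (by simp)
    simp only [map_mul]
    exact mul_pos (mul_pos hi hi) (mul_pos hj hj)
  · rw [← h1]
    exact congrArg (cellInt K.points) (by ring)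

lemma polyLE_one_of_orthogonal {K : Tetrahedron} {n : Fin 4 → Vec} (hn : IsFaceNormals K n)
    {m : ℕ} {y : Poly} (hy : y ∈ PolyLE (m + 1)) (h : ∀ β ∈ symPoly (m + 3), ZeroTrace K n β →
      cellInt K.points (divDiv β * y) = 0) : y ∈ PolyLE 1 := by
  rcases m with _ | m
  · exact hy
  refine polyLE_one_of_hess ?_
  ext1 i j
  apply MvPolynomial.funext
  intro x
  have h2 : evalMat (hess y) x = 0 := by
    refine eq_zero_of_edges K (evalMat_isSymm (hess_isSymm y) x) fun i j hij => ?_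
    rw [← eval_bilin_eq, bilin_hess_eq_zero hn hy h hij, map_zero]
  rw [Matrix.zero_apply, map_zero]
  exact congrFun (congrFun h2 i) j

/-- The functional `q ↦ ∫ div div β q` as a linear function of `β`. -/
def divDivMoment (K : Tetrahedron) (m : ℕ) : PolyMat →ₗ[ℝ] Module.Dual ℝ (PolyLE m) :=
  moment K.points m ∘ₗ divDiv

lemma divDivMoment_apply (K : Tetrahedron) (m : ℕ) (β : PolyMat) (q : PolyLE m) :
    divDivMoment K m β q = cellInt K.points (divDiv β * q) := rfl

lemma eq_of_moment_eq {K : Tetrahedron} {m : ℕ} {p q : Poly} (hp : p ∈ PolyLE m)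
    (hq : q ∈ PolyLE m) (h : moment K.points m p = moment K.points m q) : p = q := by
  have h1 := LinearMap.congr_fun (sub_eq_zero.2 h) ⟨_, sub_mem hp hq⟩
  rw [← map_sub, moment_apply] at h1
  exact sub_eq_zero.1 (eq_zero_of_cellInt_mul_self (K := K) (w := 1) (by simp) (by simp)
    (by rwa [one_mul]))

/-- By duality: a polynomial of degree m + 1 orthogonal to the image of div div has zero second
derivatives along all six edges, so it is affine, and q is orthogonal to it. -/
theorem exists_zeroTrace_divDiv_eq {K : Tetrahedron} {n : Fin 4 → Vec} (hn : IsFaceNormals K n)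
    {ν : Edge → Fin 2 → Vec} (hν : ∀ e, IsEdgeNormalPair K e (ν e)) {m : ℕ} {q : Poly}
    (hq : q ∈ PolyLE (m + 1)) (hq1 : ∀ p ∈ PolyLE 1, cellInt K.points (q * p) = 0) :
    ∃ β ∈ symPoly (m + 3), ZeroTrace K n β ∧ divDiv β = q := by
  set S := symPoly (m + 3) ⊓ LinearMap.ker (bdry K n ν m) with hS
  obtain ⟨β, hβ⟩ := exists_dual_eq ((divDivMoment K (m + 1)).domRestrict S)
    (moment K.points (m + 1) q) fun y h => hq1 y (polyLE_one_of_orthogonal hn y.2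
      fun β hβ hz => h ⟨β, hβ, hz.bdry_eq_zero hn hν⟩)
  exact ⟨β, β.2.1, zeroTrace_of_bdry_eq_zero hn hν (traceDegree_of_polyLE β.2.1.1) β.2.2,
    eq_of_moment_eq (polyLE_divDiv β.2.1.1) hq hβ⟩

/-! ### Unisolvence -/

lemma finiteDimensional_of_polyLE {m : ℕ} (S : Submodule ℝ PolyMat)
    (h : ∀ τ ∈ S, ∀ i j, τ i j ∈ PolyLE m) : FiniteDimensional ℝ S := by
  let f : S →ₗ[ℝ] (Fin 3 → Fin 3 → PolyLE m) :=
    { toFun := fun τ i j => ⟨(τ : PolyMat) i j, h τ τ.2 i j⟩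
      map_add' := fun _ _ => rfl
      map_smul' := fun _ _ => rfl }
  refine FiniteDimensional.of_injective f fun σ τ hστ => Subtype.ext ?_
  ext1 i j
  exact congrArg Subtype.val (congrFun (congrFun hστ i) j)

lemma eq_zero_of_cellInt_ddot_self {K : Tetrahedron} {τ : PolyMat}
    (h : cellInt K.points (ddot τ τ) = 0) : τ = 0 := by
  have h0 : ∀ x, eval x (ddot τ τ) = ∑ i, ∑ j, eval x (τ i j) * eval x (τ i j) := fun x => by
    simp [ddot_apply]
  have h1 := eval_eq_zero_of_cellInt (K := K) (s := id) (Z := ∅) Function.injective_id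
    (fun j => by simp) (g := ddot τ τ) (fun x _ => by
      rw [h0]
      exact Finset.sum_nonneg fun i _ => Finset.sum_nonneg fun j _ => mul_self_nonneg _) h
  ext1 i j
  refine eq_zero_of_eval_flat_empty (K := K) (eval_eq_zero_of_cell ⟨0, by simp⟩ fun x hx => ?_)
  have h2 := h1 x hx
  rw [h0, Finset.sum_eq_zero_iff_of_nonneg fun i _ => Finset.sum_nonneg fun j _ =>
    mul_self_nonneg _] at h2
  have h3 := h2 i (Finset.mem_univ i)
  rw [Finset.sum_eq_zero_iff_of_nonneg fun j _ => mul_self_nonneg _] at h3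
  exact mul_self_eq_zero.1 (h3 j (Finset.mem_univ j))

/-- The functional `ς ↦ ∫ τ : ς` on a space of tensor fields. -/
def bodyMoment (K : Tetrahedron) (S : Submodule ℝ PolyMat) : PolyMat →ₗ[ℝ] Module.Dual ℝ S :=
  (ddot.compr₂ (cellInt K.points)).compl₂ S.subtype

lemma bodyMoment_apply (K : Tetrahedron) (S : Submodule ℝ PolyMat) (τ : PolyMat) (ς : S) :
    bodyMoment K S τ ς = cellInt K.points (ddot τ ς) := rfl

lemma exists_bodyMoment_eq (K : Tetrahedron) (S : Submodule ℝ PolyMat) [FiniteDimensional ℝ S]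
    (φ : Module.Dual ℝ S) : ∃ τ ∈ S, bodyMoment K S τ = φ := by
  obtain ⟨τ, hτ⟩ := exists_dual_eq ((bodyMoment K S).domRestrict S) φ fun y hy => by
    have h : y = 0 := Subtype.ext (eq_zero_of_cellInt_ddot_self (hy y))
    rw [h, map_zero]
  exact ⟨τ, τ.2, hτ⟩

lemma exists_moment_body_eq (K : Tetrahedron) {m : ℕ} (φ : Module.Dual ℝ (PolyLE m)) :
    ∃ d ∈ PolyLE m, moment K.points m d = φ := by
  obtain ⟨d, hd, h⟩ := exists_moment_eq (K := K) (s := id) Function.injective_id (Z := ∅)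
    (fun j => by simp) (w := 1) (by simp) (by simp) φ fun q hq => by
      have h : q = 0 := Subtype.ext (eq_zero_of_eval_flat_empty hq)
      rw [h, map_zero]
  rw [one_mul] at h
  exact ⟨d, hd, h⟩

/-- The functional `q ↦ ∫ τ : ∇² q`. -/
def hessMoment (K : Tetrahedron) (m : ℕ) : PolyMat →ₗ[ℝ] Module.Dual ℝ (PolyLE m) :=
  (ddot.compr₂ (cellInt K.points)).compl₂ (hess.domRestrict (PolyLE m))

lemma hessMoment_apply (K : Tetrahedron) (m : ℕ) (τ : PolyMat) (q : PolyLE m) :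
    hessMoment K m τ q = cellInt K.points (ddot τ (hess q)) := rfl

lemma hessMoment_eq_divDivMoment {K : Tetrahedron} {n : Fin 4 → Vec} (hn : IsFaceNormals K n)
    {θ : PolyMat} (hθ : θ.IsSymm) (hz : ZeroTrace K n θ) (m : ℕ) :
    hessMoment K m θ = divDivMoment K m θ := by
  ext q
  rw [hessMoment_apply, divDivMoment_apply, cellInt_divDiv_mul hn hθ hz, ddot_apply]

/-- Once the traces vanish, Green's identity makes div div (x xᵀ p) orthogonal to itself, so p = 0.
The remaining sym curl comes from a bubble and is orthogonal to itself as well. -/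
theorem eq_zero_of_dofs {K : Tetrahedron} {n : Fin 4 → Vec} (hn : IsFaceNormals K n)
    {ν : Edge → Fin 2 → Vec} (hν : ∀ e, IsEdgeNormalPair K e (ν e)) {m j : ℕ} (hj : j ≤ m + 2)
    {τ : PolyMat} (hτ : τ ∈ shapeSpace (m + 3) (j + 2)) (hb : bdry K n ν m τ = 0)
    (hH : hessMoment K j τ = 0)
    (hB : bodyMoment K (symCurlBubble K n (m + 4)) τ = 0) : τ = 0 := by
  obtain ⟨_, ⟨σ, hσ, rfl⟩, _, ⟨p, hp, rfl⟩, rfl⟩ := Submodule.mem_sup.1 hτ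
  have hp' : p ∈ PolyLE j := hp
  have hσ' : σ ∈ traceFree (m + 4) := hσ
  have hsymm : (symCurl σ + xxT p).IsSymm := (symCurl_isSymm σ).add (xxT_isSymm p)
  have hz := zeroTrace_of_bdry_eq_zero hn hν ((traceDegree_of_polyLE (polyLE_symCurl hσ'.1)).add
    (traceDegree_xxT hn hν (polyLE_mono hj hp'))) hb
  have hd : divDiv (symCurl σ + xxT p) = divDiv (xxT p) := by
    rw [map_add, divDiv_symCurl, zero_add]
  have hdm : divDiv (xxT p) ∈ PolyLE j := by
    rw [divDiv_xxT]
    exact polyLE_wt _ hp'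
  have h1 := LinearMap.congr_fun (hessMoment_eq_divDivMoment hn hsymm hz j) ⟨_, hdm⟩
  rw [hH, divDivMoment_apply, hd, LinearMap.zero_apply, eq_comm] at h1
  have hp0 : p = 0 := xxT_eq_zero_of_divDiv (eq_zero_of_cellInt_mul_self (K := K) (w := 1)
    (by simp) (by simp) (by rwa [one_mul]))
  subst hp0
  rw [map_zero, add_zero] at hz hB ⊢
  exact eq_zero_of_cellInt_ddot_self
    (LinearMap.congr_fun hB ⟨_, symCurl_mem_symCurlBubble hn hσ' hz⟩)

lemma exists_zeroTrace_xxT_sub {K : Tetrahedron} {n : Fin 4 → Vec} (hn : IsFaceNormals K n)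
    {ν : Edge → Fin 2 → Vec} (hν : ∀ e, IsEdgeNormalPair K e (ν e)) {m : ℕ} {p : Poly}
    (hp : p ∈ PolyLE (m + 2)) : ∃ τ ∈ symPoly (m + 3), ZeroTrace K n (xxT p - τ) := by
  obtain ⟨τ, hτ, hτg⟩ := exists_bdry_eq hn hν (bdry_mem (K := K) n ν m (xxT_isSymm p))
  refine ⟨τ, hτ, zeroTrace_of_bdry_eq_zero hn hν ?_ (by rw [map_sub, hτg, sub_self])⟩
  rw [sub_eq_add_neg]
  exact (traceDegree_xxT hn hν hp).add (traceDegree_of_polyLE (neg_mem hτ).1)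

/-- The degrees of freedom other than the moments against bubbles can be prescribed. -/
theorem exists_bdry_hessMoment_eq {K : Tetrahedron} {n : Fin 4 → Vec} (hn : IsFaceNormals K n)
    {ν : Edge → Fin 2 → Vec} (hν : ∀ e, IsEdgeNormalPair K e (ν e)) {m j : ℕ} (hj1 : 1 ≤ j)
    (hj : j ≤ m + 2) {g : BdryData m} (hg : g ∈ bdryData K m) (ψ : Module.Dual ℝ (PolyLE j))
    (hψ : ∀ q : PolyLE j, hess q = 0 → ψ q = 0) :
    ∃ τ ∈ shapeSpace (m + 3) (j + 2), bdry K n ν m τ = g ∧ hessMoment K j τ = ψ := by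
  obtain ⟨τb, hτb, hτbg⟩ := exists_bdry_eq hn hν hg
  -- The target that cancels later: by Green the corrections x xᵀ p - τp and β change the Hessian
  -- moments of τb by the moments of d - div div τb.
  obtain ⟨d, hd, hdD⟩ := exists_moment_body_eq K (ψ - hessMoment K j τb + divDivMoment K j τb)
  obtain ⟨p, hp, hpd⟩ := exists_divDiv_xxT_eq hd
  obtain ⟨τp, hτp, hθz⟩ := exists_zeroTrace_xxT_sub hn hν (polyLE_mono hj hp)
  have hθs : (xxT p - τp).IsSymm := (xxT_isSymm p).sub hτp.2
  have hpm : divDivMoment K j (xxT p) = ψ - hessMoment K j τb + divDivMoment K j τb := by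
    rw [← hdD, ← hpd]
    rfl
  have hθm := hessMoment_eq_divDivMoment hn hθs hθz j
  obtain ⟨β, hβ, hβz, hβd⟩ := exists_zeroTrace_divDiv_eq hn hν
    -- Orthogonality to affine q: Hessian moments vanish there and so does ψ. Green for x xᵀ p - τp
    -- and the choice of d then give equal moments of div div τp and div div τb. The bound 1 ≤ j
    -- puts q in the test space.
    (q := divDiv (τp - τb)) (polyLE_divDiv (sub_mem hτp hτb).1) (by
      intro q hq
      have h0 := hess_eq_zero_of_polyLE_one hq
      have h1 : ∀ τ, hessMoment K j τ ⟨q, polyLE_mono hj1 hq⟩ = 0 := fun τ => by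
        rw [hessMoment_apply, h0, map_zero, map_zero]
      have h2 := LinearMap.congr_fun hθm ⟨q, polyLE_mono hj1 hq⟩
      have h3 := hψ ⟨q, polyLE_mono hj1 hq⟩ h0
      rw [h1, map_sub, hpm, LinearMap.sub_apply, LinearMap.add_apply, LinearMap.sub_apply, h1,
        h3] at h2
      have h4 : divDivMoment K j (τp - τb) ⟨q, polyLE_mono hj1 hq⟩ = 0 := by
        rw [map_sub, LinearMap.sub_apply]
        linarith
      exact h4)
  have hβm : divDivMoment K j β = divDivMoment K j τp - divDivMoment K j τb := by
    rw [← map_sub]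
    exact congrArg (moment K.points j) hβd
  refine ⟨τb + (xxT p - τp) + β, ?_, ?_, ?_⟩
  -- Everything except x xᵀ p has degree at most m + 3 and zero div div, so it is a sym curl.
  · have h1 : τb - τp + β ∈ symPoly (m + 3) := add_mem (sub_mem hτb hτp) hβ
    obtain ⟨σ, hσ, hσ'⟩ := exists_symCurl_eq (m := m + 2) h1.1 h1.2 (by
      rw [map_add, map_sub, hβd, map_sub]
      ring)
    have h2 : τb + (xxT p - τp) + β = symCurl σ + xxT p := by
      rw [hσ']
      abel
    rw [h2]
    exact Submodule.add_mem_sup ⟨σ, hσ, rfl⟩ ⟨p, hp, rfl⟩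
  · rw [map_add, map_add, hτbg, hθz.bdry_eq_zero hn hν, hβz.bdry_eq_zero hn hν, add_zero,
      add_zero]
  · rw [map_add, map_add, hθm, hessMoment_eq_divDivMoment hn hβ.2 hβz, hβm, map_sub, hpm]
    abel

/-- The moments against bubbles are corrected by a sym curl of a bubble. It has zero traces and zero
div div, so by Green the other functionals do not change. -/
theorem exists_dofs_eq {K : Tetrahedron} {n : Fin 4 → Vec} (hn : IsFaceNormals K n)
    {ν : Edge → Fin 2 → Vec} (hν : ∀ e, IsEdgeNormalPair K e (ν e)) {m j : ℕ} (hj1 : 1 ≤ j)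
    (hj : j ≤ m + 2) {g : BdryData m} (hg : g ∈ bdryData K m) (ψ : Module.Dual ℝ (PolyLE j))
    (hψ : ∀ q : PolyLE j, hess q = 0 → ψ q = 0)
    (φ : Module.Dual ℝ (symCurlBubble K n (m + 4))) :
    ∃ τ ∈ shapeSpace (m + 3) (j + 2), bdry K n ν m τ = g ∧ hessMoment K j τ = ψ ∧
      bodyMoment K (symCurlBubble K n (m + 4)) τ = φ := by
  obtain ⟨τ, hτ, hτg, hτψ⟩ := exists_bdry_hessMoment_eq hn hν hj1 hj hg ψ hψ
  have hfin : FiniteDimensional ℝ (symCurlBubble K n (m + 4)) :=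
    finiteDimensional_of_polyLE (m := m + 3) _ (by
      rintro _ ⟨σ, hσ, rfl⟩
      exact polyLE_symCurl hσ.1.1)
  obtain ⟨_, ⟨σ, hσ, rfl⟩, hς⟩ := exists_bodyMoment_eq K (symCurlBubble K n (m + 4))
    (φ - bodyMoment K _ τ)
  have hz := zeroTrace_symCurl hn hσ
  refine ⟨τ + symCurl σ, add_mem hτ (Submodule.mem_sup_left ⟨σ, hσ.1, rfl⟩), ?_, ?_, ?_⟩
  · rw [map_add, hτg, hz.bdry_eq_zero hn hν, add_zero]
  · have h1 : divDivMoment K j (symCurl σ) = 0 := by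
      rw [divDivMoment, LinearMap.comp_apply, divDiv_symCurl, map_zero]
    rw [map_add, hτψ, hessMoment_eq_divDivMoment hn (symCurl_isSymm σ) hz, h1, add_zero]
  · rw [map_add, hς, add_sub_cancel]

/-- Unisolvence in terms of normalized integrals. -/
theorem existsUnique_dofs {K : Tetrahedron} {n : Fin 4 → Vec} (hn : IsFaceNormals K n)
    {ν : Edge → Fin 2 → Vec} (hν : ∀ e, IsEdgeNormalPair K e (ν e)) {m j : ℕ} (hj1 : 1 ≤ j)
    (hj : j ≤ m + 2) {g : BdryData m} (hg : g ∈ bdryData K m) (ψ : Module.Dual ℝ (PolyLE j))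
    (hψ : ∀ q : PolyLE j, hess q = 0 → ψ q = 0)
    (φ : Module.Dual ℝ (symCurlBubble K n (m + 4))) :
    ∃! τ, τ ∈ shapeSpace (m + 3) (j + 2) ∧ bdry K n ν m τ = g ∧ hessMoment K j τ = ψ ∧
      bodyMoment K (symCurlBubble K n (m + 4)) τ = φ := by
  obtain ⟨τ, h1, h2, h3, h4⟩ := exists_dofs_eq hn hν hj1 hj hg ψ hψ φ
  refine ⟨τ, ⟨h1, h2, h3, h4⟩, fun τ' ⟨h1', h2', h3', h4'⟩ => ?_⟩
  refine sub_eq_zero.1 (eq_zero_of_dofs hn hν hj (sub_mem h1' h1) ?_ ?_ ?_)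
  · rw [map_sub, h2, h2', sub_self]
  · rw [map_sub, h3, h3', sub_self]
  · rw [map_sub, h4, h4', sub_self]

/-! ### The prescribed values in terms of normalized integrals -/

lemma edge_subset_flat (K : Tetrahedron) (e : Edge) : edge K e ⊆ flat K (edgeFaces e) :=
  (convex_flat K _).segment_subset (point_mem_flat K (edgeIdx_not_mem e 0))
    (point_mem_flat K (edgeIdx_not_mem e 1))

/-- A functional on `ℙ_m(G)` as a functional on polynomials. -/
def pullback (G : Set Vec) (m : ℕ) (c : ℝ) (g : Module.Dual ℝ (PolyOn G m)) :
    Module.Dual ℝ (PolyLE m) :=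
  c⁻¹ • (g ∘ₗ (restrictPoly G m).rangeRestrict)

lemma pullback_eq_zero {G Z : Set Vec} (h : G ⊆ Z) {m : ℕ} (c : ℝ)
    (g : Module.Dual ℝ (PolyOn G m)) {q : PolyLE m} (hq : ∀ x ∈ Z, eval x (q : Poly) = 0) :
    pullback G m c g q = 0 := by
  have h0 : (restrictPoly G m).rangeRestrict q = 0 :=
    Subtype.ext (funext fun x => hq x (h x.2))
  rw [pullback, LinearMap.smul_apply, LinearMap.comp_apply, h0, map_zero, smul_zero]

/-- The Hessian as a map onto the space of Hessians. -/
def hessMap (m : ℕ) : PolyLE m →ₗ[ℝ] hessSpace m :=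
  (hess.domRestrict (PolyLE m)).codRestrict (hessSpace m) fun q => ⟨q, q.2, rfl⟩

lemma eq_inv_smul_iff_forall {Y : Type*} [AddCommGroup Y] [Module ℝ Y] {c : ℝ} (hc : 0 < c)
    {f g : Module.Dual ℝ Y} : f = c⁻¹ • g ↔ ∀ y, c * f y = g y := by
  rw [eq_inv_smul_iff₀ hc.ne', LinearMap.ext_iff]
  rfl

/-- Functionals on restricted polynomials pull back to functionals on ambient polynomials that
ignore those vanishing on the cell. Dividing by the positive Jacobian factors turns the true
integrals into normalized ones. -/
theorem existsUnique_shape (m j : ℕ) (hj1 : 1 ≤ j) (hj : j ≤ m + 2)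
    (K : Tetrahedron)
    (n : Fin 4 → Vec) (hn : ∀ i, IsUnitFaceNormal K i (n i))
    (ν : Edge → Fin 2 → Vec) (hν : ∀ e, IsEdgeNormalPair K e (ν e))
    (gV : Fin 4 → Mat) (hgV : ∀ δ, (gV δ).IsSymm)
    (gE : ∀ e : Edge, Fin 2 → Fin 2 → Module.Dual ℝ (PolyOn (edge K e) (m + 1)))
    (hgE : ∀ e i j, gE e i j = gE e j i)
    (gF : ∀ i : Fin 4, Module.Dual ℝ (PolyOn (face K i) m))
    (gF' : ∀ i : Fin 4, Module.Dual ℝ (PolyOn (face K i) (m + 2)))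
    (gH : Module.Dual ℝ (hessSpace j))
    (gB : Module.Dual ℝ (symCurlBubble K n (m + 4))) :
    ∃! τ : PolyMat, τ ∈ shapeSpace (m + 3) (j + 2) ∧
      (∀ δ, evalMat τ (K.points δ) = gV δ) ∧
      (∀ e i j, ∀ q : PolyLE (m + 1),
        edgeInner K e (bilin (ν e i) τ (ν e j)) q =
          gE e i j ((restrictPoly (edge K e) (m + 1)).rangeRestrict q)) ∧
      (∀ i, ∀ q : PolyLE m,
        faceInner K i (bilin (n i) τ (n i)) q =
          gF i ((restrictPoly (face K i) m).rangeRestrict q)) ∧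
      (∀ i, ∀ q : PolyLE (m + 2),
        faceInner K i (shearTrace (n i) τ) q =
          gF' i ((restrictPoly (face K i) (m + 2)).rangeRestrict q)) ∧
      (∀ ς : hessSpace j, bodyInner K τ ς = gH ς) ∧
      (∀ ς : symCurlBubble K n (m + 4), bodyInner K τ ς = gB ς) := by
  choose cE hcE hE using edgeInner_eq K
  choose cF hcF hF using faceInner_eq K
  obtain ⟨cB, hcB, hB⟩ := bodyInner_eq K
  set g : BdryData m := (gV, fun e a b => pullback (edge K e) (m + 1) (cE e) (gE e a b),
    fun i => pullback (face K i) m (cF i) (gF i),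
    fun i => pullback (face K i) (m + 2) (cF i) (gF' i)) with hg
  have hgm : g ∈ bdryData K m :=
    ⟨hgV, fun e a b => congrArg (pullback _ _ _) (hgE e a b),
      fun e a b _ => pullback_eq_zero (edge_subset_flat K e) _ _,
      fun i _ => pullback_eq_zero (face_subset_flat K i) _ _,
      fun i _ => pullback_eq_zero (face_subset_flat K i) _ _⟩
  set ψ : Module.Dual ℝ (PolyLE j) := cB⁻¹ • (gH ∘ₗ hessMap j) with hψ
  have hψ0 : ∀ q : PolyLE j, hess q = 0 → ψ q = 0 := by
    intro q hq
    have h0 : hessMap j q = 0 := Subtype.ext hq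
    rw [hψ, LinearMap.smul_apply, LinearMap.comp_apply, h0, map_zero, smul_zero]
  refine (existsUnique_congr fun τ => and_congr_right fun _ => ?_).1
    (existsUnique_dofs hn hν hj1 hj hgm ψ hψ0 (cB⁻¹ • gB))
  rw [bdry_apply, hg, Prod.mk.injEq, Prod.mk.injEq, Prod.mk.injEq]
  simp only [and_assoc]
  refine and_congr _root_.funext_iff (and_congr ?_ (and_congr ?_ (and_congr ?_ (and_congr ?_ ?_))))
  · simp only [_root_.funext_iff]
    refine forall_congr' fun e => forall_congr' fun a => forall_congr' fun b => ?_
    rw [pullback, eq_inv_smul_iff_forall (hcE e)]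
    simp only [hE, moment_apply, LinearMap.comp_apply, bilinMap_apply]
  · simp only [_root_.funext_iff]
    refine forall_congr' fun i => ?_
    rw [pullback, eq_inv_smul_iff_forall (hcF i)]
    simp only [hF, moment_apply, LinearMap.comp_apply, bilinMap_apply]
  · simp only [_root_.funext_iff]
    refine forall_congr' fun i => ?_
    rw [pullback, eq_inv_smul_iff_forall (hcF i)]
    simp only [hF, moment_apply, LinearMap.comp_apply, shearMap_apply]
  · rw [hψ, eq_inv_smul_iff_forall hcB]
    simp only [hB, hessMoment_apply, ← ddot_apply]
    constructor
    · rintro h ⟨_, q, hq, rfl⟩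
      exact h ⟨q, hq⟩
    · exact fun h q => h ⟨hess q, q, q.2, rfl⟩
  · rw [eq_inv_smul_iff_forall hcB]
    simp only [hB, bodyMoment_apply, ← ddot_apply]

end DivDiv

end

theorem mainTheorem5 (k l : ℕ) (hk : 3 ≤ k) (hl : max (k - 1) 3 ≤ l)
    (K : Tetrahedron)
    (n : Fin 4 → Vec) (hn : ∀ i, IsUnitFaceNormal K i (n i))
    (ν : Edge → Fin 2 → Vec) (hν : ∀ e, IsEdgeNormalPair K e (ν e))
    -- arbitrary prescribed values of the degrees of freedom
    (gV : Fin 4 → Mat) (hgV : ∀ δ, (gV δ).IsSymm)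
    (gE : ∀ e : Edge, Fin 2 → Fin 2 → Module.Dual ℝ (PolyOn (edge K e) (l - 2)))
    (hgE : ∀ e i j, gE e i j = gE e j i)
    (gF : ∀ i : Fin 4, Module.Dual ℝ (PolyOn (face K i) (l - 3)))
    (gF' : ∀ i : Fin 4, Module.Dual ℝ (PolyOn (face K i) (l - 1)))
    (gH : Module.Dual ℝ (hessSpace (k - 2)))
    (gB : Module.Dual ℝ (symCurlBubble K n (l + 1))) :
    ∃! τ : PolyMat, τ ∈ shapeSpace l k ∧
      (∀ δ, evalMat τ (K.points δ) = gV δ) ∧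
      (∀ e i j, ∀ q : PolyLE (l - 2),
        edgeInner K e (bilin (ν e i) τ (ν e j)) q =
          gE e i j ((restrictPoly (edge K e) (l - 2)).rangeRestrict q)) ∧
      (∀ i, ∀ q : PolyLE (l - 3),
        faceInner K i (bilin (n i) τ (n i)) q =
          gF i ((restrictPoly (face K i) (l - 3)).rangeRestrict q)) ∧
      (∀ i, ∀ q : PolyLE (l - 1),
        faceInner K i (shearTrace (n i) τ) q =
          gF' i ((restrictPoly (face K i) (l - 1)).rangeRestrict q)) ∧
      (∀ ς : hessSpace (k - 2), bodyInner K τ ς = gH ς) ∧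
      (∀ ς : symCurlBubble K n (l + 1), bodyInner K τ ς = gB ς) := by
  -- With k = j + 2, the bound 3 ≤ k becomes 1 ≤ j and k - 1 ≤ ℓ becomes j ≤ m + 2.
  obtain ⟨m, rfl⟩ : ∃ m, l = m + 3 := ⟨l - 3, by omega⟩
  obtain ⟨j, rfl⟩ : ∃ j, k = j + 2 := ⟨k - 2, by omega⟩
  exact existsUnique_shape m j (by omega) (by omega) K n hn ν hν gV hgV gE hgE gF gF' gH gB
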